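/- Let $\mathbb X$ be a Polish space, $\alpha$ a finite, diffuse, non-zero Borel measure on $\mathbb X$, $\phi>0$, $d\ge 1$. Write $\mathrm{Gamma}(a,b)$ for the law with shape $a$ and rate $b$. Let $\tilde\eta=\sum_{i\ge1}J_i\delta_{\tilde x_i}$ be a completely random measure without fixed atoms and drift, with Lévy intensity $z^{-1}(1-z)^{\phi-1}\mathbf 1_{(0,1)}(z)\,dz\,\alpha(dx)$ (that is, the points $(J_i,\tilde x_i)$ form a Poisson process with this intensity); let $m_{j,i}$ ($1\le j\le d$, $i\ge1$) be i.i.d. $\mathrm{Gamma}(\phi,1)$ scores independent of the points, and let $$\tilde\mu_j=\sum_{i\ge1}m_{j,i}J_i\delta_{\tilde x_i},\qquad \tilde p_j=\tilde\mu_j/\tilde\mu_j(\mathbb X),\qquad j=1,\dots,d .$$ Then each $\tilde\mu_j$ is a gamma process: its values on pairwise disjoint Borel sets are independent, and $\tilde\mu_j(A)\sim\mathrm{Gamma}(\alpha(A),1)$ (with $\tilde\mu_j(A)=0$ a.s. if $\alpha(A)=0$). Let $n_1,\dots,n_d\ge1$ and suppose that, given $(\tilde\mu_1,\dots,\tilde\mu_d)$,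 the observations $X_{i,j}$ ($1\le i\le n_j$, $1\le j\le d$) are independent with $X_{i,j}\sim\tilde p_j$. Let $U_j=\Gamma_j/\tilde\mu_j(\mathbb X)$, where the $\Gamma_j\sim\mathrm{Gamma}(n_j,1)$ are independent, and independent of the $\tilde\mu$'s and the observations. Let $X_1^*,\dots,X_k^*$ be the distinct values among all observations, $n_{\ell,j}=\#\{i\le n_j: X_{i,j}=X_\ell^*\}$ and $n_{\ell\bullet}=\sum_j n_{\ell,j}$. Then $(\tilde\mu_1,\dots,\tilde\mu_d)$ has a regular conditional distribution given $(X_{i,j})_{i,j}$ and $(U_j)_j$ which is, almost surely, the law of $$(\tilde\mu_1',\dots,\tilde\mu_d')+\sum_{\ell=1}^k (T_{\ell,1},\dots,T_{\ell,d})\,\sigma_\ell\,\delta_{X_\ell^*},$$ where the two summands are independent and: (i) $\tilde\mu_j'=\sum_{i\ge1}m_{j,i}'J_i'\delta_{\tilde x_i'}$, where $\tilde\eta'=\sum_{i\ge1}J_i'\delta_{\tilde x_i'}$ is a completely random measure without fixed atoms and drift, with Lévy intensity $$s^{-1}(1-s)^{\phi-1}\prod_{j=1}^d\frac1{(1+U_js)^{\phi}}\;ds\,\alpha(dx),\qquad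 0<s<1,$$ and, given the points $(J_i',\tilde x_i')_{i\ge1}$, the scores $m_{j,i}'$ are independent with law $\mathrm{Gamma}(\phi,U_jJ_i'+1)$; (ii) $\sigma_1,\dots,\sigma_k$ are independent, $\sigma_\ell$ having density on $(0,1)$ proportional to $$s^{n_{\ell\bullet}-1}(1-s)^{\phi-1}\prod_{j=1}^d\frac{(\phi)_{n_{\ell,j}}}{(sU_j+1)^{n_{\ell,j}+\phi}},$$ where $(\phi)_r=\phi(\phi+1)\cdots(\phi+r-1)$; and, given $(\sigma_1,\dots,\sigma_k)$, the $T_{\ell,j}$ ($1\le\ell\le k$, $1\le j\le d$) are independent with law $\mathrm{Gamma}(\phi+n_{\ell,j},\sigma_\ell U_j+1)$. -/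

import Mathlib

open MeasureTheory ProbabilityTheory

universe u v w

namespace CoRM

noncomputable section

/-- `N` is a Poisson random measure on `E` with (σ-finite) intensity measure `Λ`: the counts of
finitely many pairwise disjoint measurable sets are mutually independent, and the count of a
measurable set `A` of finite intensity is Poisson distributed with mean `Λ A`. -/
structure IsPoissonRandomMeasure {Ω : Type v} [MeasurableSpace Ω] (P : Measure Ω)
    {E : Type w} [MeasurableSpace E] (N : Ω → Measure E) (Λ : Measure E) : Prop where
  measurable : Measurable N
  indep : ∀ (r : ℕ) (A : Fin r → Set E), (∀ i, MeasurableSet (A i)) →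
    (∀ i i', i ≠ i' → Disjoint (A i) (A i')) → iIndepFun (fun i ω => N ω (A i)) P
  law : ∀ A : Set E, MeasurableSet A → Λ A ≠ ⊤ →
    P.map (fun ω => N ω A) = (poissonMeasure (Λ A).toNNReal).map (fun c : ℕ => (c : ENNReal))

/-- Conditionally on the random element `Z`, the random elements `Y i` are mutually independent,
and the conditional law of `Y i` is `K i Z`. -/
structure IsCondIndepWithLaws {Ω : Type v} [MeasurableSpace Ω] (P : Measure Ω)
    {F : Type*} [MeasurableSpace F] (Z : Ω → F)
    {ι : Type*} {E : Type*} [MeasurableSpace E] (Y : ι → Ω → E) (K : ι → F → Measure E) :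
    Prop where
  measurable_cond : Measurable Z
  measurable : ∀ i, Measurable (Y i)
  law : ∀ (s : Finset ι) (B : ι → Set E) (D : Set F), (∀ i, MeasurableSet (B i)) →
    MeasurableSet D →
    P ((Z ⁻¹' D) ∩ ⋂ i ∈ s, Y i ⁻¹' B i) = ∫⁻ ω in Z ⁻¹' D, ∏ i ∈ s, K i (Z ω) (B i) ∂P

/-- The sequence of (jump, location) pairs. -/
def points {X : Type u} {Ω : Type v} (J : ℕ → Ω → ℝ) (x : ℕ → Ω → X) (ω : Ω) : ℕ → ℝ × X :=
  fun i => (J i ω, x i ω)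

/-- The random measure `∑ i, m j i * J i * δ_{x i}` of group `j`, where `m (i, j)` is the score of
the `i`-th atom in group `j`. -/
def compoundMeasure {X : Type u} [MeasurableSpace X] {Ω : Type v} {d : ℕ}
    (J : ℕ → Ω → ℝ) (x : ℕ → Ω → X) (m : ℕ × Fin d → Ω → ℝ) (j : Fin d) (ω : Ω) : Measure X :=
  Measure.sum fun i => ENNReal.ofReal (m (i, j) ω * J i ω) • Measure.dirac (x i ω)

/-- `∑ i, J i * δ_{x i}` is a completely random measure (without fixed atoms and drift) with Lévy
intensity `ν(ds) α(dx)`, i.e. the atoms `(J i, x i)` form a Poisson process with that intensity,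
and given the atoms the scores are independent, the score of group `j` of an atom with jump `s`
having law `f j s`. -/
structure IsCompoundRep {X : Type u} [MeasurableSpace X] {Ω : Type v} [MeasurableSpace Ω]
    (P : Measure Ω) {d : ℕ} (ν : Measure ℝ) (α : Measure X) (f : Fin d → ℝ → Measure ℝ)
    (J : ℕ → Ω → ℝ) (x : ℕ → Ω → X) (m : ℕ × Fin d → Ω → ℝ) : Prop where
  poisson : IsPoissonRandomMeasure P
    (fun ω => Measure.sum fun i => Measure.dirac (points J x ω i)) (ν.prod α)
  scores : IsCondIndepWithLaws P (points J x) m (fun q z => f q.2 (z q.1).1)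

/-- The beta directing Lévy measure `z⁻¹ (1 - z) ^ (φ - 1) dz` on `(0, 1)`. -/
def betaLevy (φ : ℝ) : Measure ℝ :=
  (volume.restrict (Set.Ioo 0 1)).withDensity
    fun z => ENNReal.ofReal (z⁻¹ * (1 - z) ^ (φ - 1))

/-- The updated Lévy measure `s⁻¹ (1 - s) ^ (φ - 1) ∏ j, (1 + u j * s) ^ (-φ) ds` on `(0, 1)`. -/
def updatedLevy {d : ℕ} (φ : ℝ) (U : Fin d → ℝ) : Measure ℝ :=
  (volume.restrict (Set.Ioo 0 1)).withDensity
    fun s => ENNReal.ofReal (s⁻¹ * (1 - s) ^ (φ - 1) * ∏ j, 1 / (1 + U j * s) ^ φ)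

/-- The unnormalized law, on `(0, 1)`, of the latent jump of a distinct value that has
multiplicity `c j` in the `j`-th sample. -/
def fixedJumpWeight {d : ℕ} (φ : ℝ) (U : Fin d → ℝ) (c : Fin d → ℕ) : Measure ℝ :=
  (volume.restrict (Set.Ioo 0 1)).withDensity
    fun s => ENNReal.ofReal (s ^ (((∑ j, c j : ℕ) : ℝ) - 1) * (1 - s) ^ (φ - 1) *
      ∏ j, (ascPochhammer ℝ (c j)).eval φ / (s * U j + 1) ^ ((c j : ℝ) + φ))

/-- The probability measure proportional to `M`. -/
def normalize {E : Type w} [MeasurableSpace E] (M : Measure E) : Measure E :=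
  (M Set.univ)⁻¹ • M

/-- `μ` is a gamma process with base measure `α`: it is completely random, and `μ A` is
`Gamma(α A, 1)` distributed (equal to `0` if `α A = 0`). -/
structure IsGammaProcess {X : Type u} [MeasurableSpace X] {Ω : Type v} [MeasurableSpace Ω]
    (P : Measure Ω) (μ : Ω → Measure X) (α : Measure X) : Prop where
  measurable : Measurable μ
  indep : ∀ (r : ℕ) (A : Fin r → Set X), (∀ i, MeasurableSet (A i)) →
    (∀ i i', i ≠ i' → Disjoint (A i) (A i')) → iIndepFun (fun i ω => μ ω (A i)) P
  law_of_null : ∀ A : Set X, MeasurableSet A → α A = 0 → ∀ᵐ ω ∂P, μ ω A = 0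
  law : ∀ A : Set X, MeasurableSet A → α A ≠ 0 →
    P.map (fun ω => μ ω A) = (gammaMeasure (α A).toReal 1).map ENNReal.ofReal

/-- `Q` is the law of the random vector of measures
`(μ'_1, …, μ'_d) + ∑ l, (T l 1, …, T l d) σ l δ_{xs l}`, where
* `μ'_j = ∑ i, m' (i, j) * J' i * δ_{x' i}`, the atoms `(J', x')` form a Poisson process whose
  intensity is the updated Lévy intensity, and the scores given the atoms are independent with law
  `Gamma(φ, U j * J' i + 1)`;
* the `σ l` are independent with the normalized densities, and given them the `T l j` are
  independent with law `Gamma(φ + c l j, σ l * U j + 1)`;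
* the two parts are independent. -/
def IsPosteriorLaw {X : Type u} [MeasurableSpace X] {d k : ℕ} (φ : ℝ) (α : Measure X)
    (U : Fin d → ℝ) (xs : Fin k → X) (c : Fin k → Fin d → ℕ)
    (Q : Measure (Fin d → Measure X)) : Prop :=
  ∃ (Ω' : Type u) (_ : MeasurableSpace Ω') (P' : Measure Ω') (_ : IsProbabilityMeasure P')
    (J' : ℕ → Ω' → ℝ) (x' : ℕ → Ω' → X) (m' : ℕ × Fin d → Ω' → ℝ)
    (σ : Fin k → Ω' → ℝ) (T : Fin k × Fin d → Ω' → ℝ),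
    IsCompoundRep P' (updatedLevy φ U) α (fun j s => gammaMeasure φ (U j * s + 1)) J' x' m' ∧
    iIndepFun σ P' ∧
    (∀ l, HasLaw (σ l) (normalize (fixedJumpWeight φ U (c l))) P') ∧
    IsCondIndepWithLaws P' (fun ω l => σ l ω) T
      (fun q s => gammaMeasure (φ + c q.1 q.2) (s q.1 * U q.2 + 1)) ∧
    IndepFun (fun ω => (points J' x' ω, fun q => m' q ω))
      (fun ω => ((fun l => σ l ω), fun q => T q ω)) P' ∧
    HasLaw (fun ω j => compoundMeasure J' x' m' j ω +
      ∑ l, ENNReal.ofReal (T (l, j) ω * σ l ω) • Measure.dirac (xs l)) Q P'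

end

end CoRM

set_option linter.unusedSectionVars false

open scoped ENNReal NNReal
open Filter Topology

/-! The whole argument is carried by Laplace functionals. The function `expNeg` is bounded and
injective on `[0, ∞]`, so the law of a vector of random measures is determined by the means of `exp
(-∑ j, ∫ f j dμ j)` over measurable `f j ≥ 0` (`ext_of_lintegral_pairing`). For a compound vector,
integrating out the scores and then the Poisson atoms gives `exp (-L f)`, where `L f` is the
integral of `1 - ∏ j, E exp (-t s f j)` against the jump intensity times `α`
(`IsCompoundRep.lintegral_expNeg_pairing`). With one active group the jump integral equals `log (1 +
f)` (`lintegral_betaLevy_one_sub`), which is the exponent of a gamma process.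

For the posterior, let `m j` be the total mass of `μ j`. Given the measures, `U j` has density `e^r
(m j)^(n j) e^(-r m j)` with respect to `Gamma(n j, 1)`. The powers of `m j` cancel the
normalizations of the sampling laws, so conditioning on the latent variables and the observations
amounts to weighting by `exp (-∑ j, u j m j)` and by one factor `μ j (dz)` for each observation `z`
in group `j` (`IsCompoundRep.lintegral_latent`).

The exponential weight keeps the compound form and only changes the Lévy measure and the rates of
the scores (`IsCompoundRep.tilt`). Weighting by `μ j (dz)` is governed by a Campbell formula, the
derivative of the Laplace functional in one direction
(`IsCompoundRep.lintegral_apply_mul_expNeg_pairing`). Its diffuse part creates a fixed atom at a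
location which, `α` having no atoms, differs from all earlier values; its atomic part raises the
count of a value already seen (`IsCompoundRep.lintegral_apply_posterior`). Adding the observations
one at a time gives Bayes' rule by induction (`IsCompoundRep.lintegral_likelihood_mul`).

Finally, gamma conjugacy turns the law of a fixed atom, given by the likelihood weight `(t s)^c
e^(-a t s)` in each group, into the stated laws of `σ` and `T`
(`IsCompoundRep.isPosteriorLaw_fixedLaw`). -/

namespace CoRM

noncomputable section

/-! ### Laplace transforms on `[0, ∞]` and Laplace functionals of random measures -/

/-- The function `x ↦ e⁻ˣ` on `[0, ∞]`. -/
def expNeg (x : ℝ≥0∞) : ℝ≥0∞ := EReal.exp (-(x : EReal))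

@[simp] lemma expNeg_zero : expNeg 0 = 1 := by simp [expNeg]

@[simp] lemma expNeg_top : expNeg ∞ = 0 := by simp [expNeg]

lemma expNeg_coe (x : ℝ≥0) : expNeg x = ENNReal.ofReal (Real.exp (-x)) := by
  have : ((x : ℝ≥0∞) : EReal) = ((x : ℝ) : EReal) := rfl
  rw [expNeg, this, ← EReal.coe_neg, EReal.exp_coe]

lemma expNeg_ofReal {x : ℝ} (hx : 0 ≤ x) :
    expNeg (ENNReal.ofReal x) = ENNReal.ofReal (Real.exp (-x)) := by
  rw [ENNReal.ofReal, expNeg_coe, Real.coe_toNNReal _ hx]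

lemma expNeg_add (x y : ℝ≥0∞) : expNeg (x + y) = expNeg x * expNeg y := by
  rw [expNeg, expNeg, expNeg, ← EReal.exp_add, EReal.coe_ennreal_add,
    EReal.neg_add (.inl (EReal.coe_ennreal_ne_bot _)) (.inr (EReal.coe_ennreal_ne_bot _))]
  rfl

lemma expNeg_sum {ι : Type*} (s : Finset ι) (f : ι → ℝ≥0∞) :
    expNeg (∑ i ∈ s, f i) = ∏ i ∈ s, expNeg (f i) := by
  classical
  induction s using Finset.induction_on with
  | empty => simp
  | insert a s ha ih => rw [Finset.sum_insert ha, Finset.prod_insert ha, expNeg_add, ih]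

lemma expNeg_antitone : Antitone expNeg := fun x y h =>
  EReal.exp_monotone (EReal.neg_le_neg_iff.2 (by exact_mod_cast h))

lemma expNeg_injective : Function.Injective expNeg := fun x y h => by
  have := EReal.exp_strictMono.injective h
  rw [neg_inj] at this
  exact_mod_cast this

lemma expNeg_le_one (x : ℝ≥0∞) : expNeg x ≤ 1 := by
  simpa using expNeg_antitone (zero_le (a := x))

lemma expNeg_ne_top (x : ℝ≥0∞) : expNeg x ≠ ∞ :=
  ((expNeg_le_one x).trans_lt ENNReal.one_lt_top).ne

lemma expNeg_eq_zero_iff {x : ℝ≥0∞} : expNeg x = 0 ↔ x = ∞ := by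
  rw [← expNeg_top, expNeg_injective.eq_iff]

lemma expNeg_pos {x : ℝ≥0∞} (hx : x ≠ ∞) : 0 < expNeg x :=
  pos_iff_ne_zero.2 fun h => hx (expNeg_eq_zero_iff.1 h)

lemma continuous_expNeg : Continuous expNeg :=
  ENNReal.continuous_exp.comp (continuous_neg.comp continuous_coe_ennreal_ereal)

@[fun_prop]
lemma measurable_expNeg : Measurable expNeg := continuous_expNeg.measurable

lemma one_sub_expNeg_le (x : ℝ≥0∞) : 1 - expNeg x ≤ x := by
  induction x with
  | top => simp
  | coe x =>
    rw [expNeg_coe, ← ENNReal.ofReal_one, ← ENNReal.ofReal_sub _ (Real.exp_pos _).le,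
      ← ENNReal.ofReal_coe_nnreal]
    exact ENNReal.ofReal_le_ofReal (by linarith [Real.one_sub_le_exp_neg x])

/-- The function `y ↦ - log y` on `[0, 1]`, the inverse of `expNeg`. -/
def negLog (y : ℝ≥0∞) : ℝ≥0∞ := (-ENNReal.log y).toENNReal

/-- Rewrites a factor in `[0, 1]` as an exponential, so that infinite products of conditional
expectations become `expNeg` of a sum in `[0, ∞]`, where every sum converges. -/
lemma expNeg_negLog {y : ℝ≥0∞} (hy : y ≤ 1) : expNeg (negLog y) = y := by
  have : 0 ≤ -ENNReal.log y := by
    rw [EReal.neg_nonneg]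
    exact ENNReal.log_le_zero_iff.2 hy
  rw [expNeg, negLog, EReal.coe_toENNReal this, neg_neg, ENNReal.exp_log]

@[fun_prop]
lemma measurable_negLog : Measurable negLog :=
  EReal.continuous_toENNReal.measurable.comp
    (continuous_neg.measurable.comp ENNReal.continuous_log.measurable)

lemma tendsto_prod_expNeg {ι : Type*} (f : ι → ℝ≥0∞) :
    Tendsto (fun s : Finset ι => ∏ i ∈ s, expNeg (f i)) atTop (𝓝 (expNeg (∑' i, f i))) := by
  simp_rw [← expNeg_sum]
  exact (continuous_expNeg.tendsto _).comp ENNReal.summable.hasSum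

/-- The coordinate functions `x ↦ e^{-x i}` as bounded continuous functions. -/
def expNegCoord {ι : Type*} (i : ι) : BoundedContinuousFunction (ι → ℝ≥0∞) ℝ :=
  BoundedContinuousFunction.ofNormedAddCommGroup (fun x => (expNeg (x i)).toReal)
    (ENNReal.continuousOn_toReal.comp_continuous
      (continuous_expNeg.comp (continuous_apply i)) fun x => expNeg_ne_top _) 1 fun x => by
    rw [Real.norm_of_nonneg ENNReal.toReal_nonneg]
    simpa using ENNReal.toReal_mono ENNReal.one_ne_top (expNeg_le_one (x i))

/-- The functions `e^(-x i)` separate points, those with infinite coordinates included, so the real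
algebra they generate determines finite measures. It is spanned by monomials, whose integrals are
the Laplace transforms at integer arguments; this is why natural coefficients suffice. -/
lemma ext_of_lintegral_expNeg {ι : Type*} [Fintype ι] {μ ν : Measure (ι → ℝ≥0∞)}
    [IsFiniteMeasure μ] [IsFiniteMeasure ν]
    (h : ∀ a : ι → ℕ, ∫⁻ x, expNeg (∑ i, a i * x i) ∂μ = ∫⁻ x, expNeg (∑ i, a i * x i) ∂ν) :
    μ = ν := by
  classical
  let A₀ : Subalgebra ℝ (BoundedContinuousFunction (ι → ℝ≥0∞) ℝ) :=
    Algebra.adjoin ℝ (Set.range (expNegCoord (ι := ι)))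
  let A : StarSubalgebra ℝ (BoundedContinuousFunction (ι → ℝ≥0∞) ℝ) :=
    { A₀ with
      star_mem' := fun {a} ha => by
        have h' : star a = a := by ext x; simp
        rw [h']
        exact ha }
  refine ext_of_forall_mem_subalgebra_integral_eq_of_polish (A := A) ?_ ?_
  · intro x y hxy
    obtain ⟨i, hi⟩ := Function.ne_iff.1 hxy
    refine ⟨fun z => expNegCoord i z, ⟨_, ⟨expNegCoord i, ?_, rfl⟩, rfl⟩, ?_⟩
    · exact Algebra.subset_adjoin ⟨i, rfl⟩
    · intro h'
      refine hi (expNeg_injective ?_)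
      exact (ENNReal.toReal_eq_toReal_iff' (expNeg_ne_top _) (expNeg_ne_top _)).1 h'
  · intro g hg
    have hg' : g ∈ Submodule.span ℝ
        (Submonoid.closure (Set.range (expNegCoord (ι := ι))) : Set _) := by
      rw [← Algebra.adjoin_eq_span]
      exact hg
    clear hg
    induction hg' using Submodule.span_induction with
    | zero => simp
    | add f g _ _ ihf ihg =>
      simp only [BoundedContinuousFunction.coe_add, Pi.add_apply]
      rw [integral_add (f.integrable _) (g.integrable _),
        integral_add (f.integrable _) (g.integrable _), ihf, ihg]
    | smul c f _ ih => simp only [BoundedContinuousFunction.coe_smul, integral_smul, ih]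
    | mem f hf =>
      -- By linearity only products of generators remain, and each of these is a monomial with
      -- exponent vector `a`.
      obtain ⟨a, rfl⟩ : ∃ a : ι → ℕ, f = ∏ i, expNegCoord i ^ a i := by
        induction hf using Submonoid.closure_induction with
        | mem f hf =>
          obtain ⟨i, rfl⟩ := hf
          refine ⟨Pi.single i 1, ?_⟩
          rw [Finset.prod_eq_single i] <;> simp +contextual
        | one => exact ⟨0, by simp⟩
        | mul f g _ _ hf hg =>
          obtain ⟨a, rfl⟩ := hf
          obtain ⟨b, rfl⟩ := hg
          exact ⟨a + b, by simp [pow_add, Finset.prod_mul_distrib]⟩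
      have hm : Measurable fun x : ι → ℝ≥0∞ => expNeg (∑ i, a i * x i) := by fun_prop
      have key : ∀ x : ι → ℝ≥0∞, (∏ i, expNegCoord i ^ a i : BoundedContinuousFunction _ ℝ) x
          = (expNeg (∑ i, a i * x i)).toReal := by
        intro x
        rw [expNeg_sum, ENNReal.toReal_prod]
        have : ∀ (n : ℕ) (y : ℝ≥0∞), expNeg (n * y) = expNeg y ^ n := by
          intro n y
          have := expNeg_sum (Finset.range n) (fun _ => y)
          simpa using this
        simp_rw [this, ENNReal.toReal_pow]
        have hp : ∀ s : Finset ι, (∏ i ∈ s, expNegCoord i ^ a i : BoundedContinuousFunction _ ℝ) x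
            = ∏ i ∈ s, (expNeg (x i)).toReal ^ a i := by
          intro s
          induction s using Finset.induction_on with
          | empty => simp
          | insert i s hi ih =>
            rw [Finset.prod_insert hi, Finset.prod_insert hi, BoundedContinuousFunction.mul_apply,
              ih, BoundedContinuousFunction.pow_apply]
            rfl
        exact hp _
      simp_rw [key]
      rw [integral_toReal hm.aemeasurable (ae_of_all _ fun x => (expNeg_ne_top _).lt_top),
        integral_toReal hm.aemeasurable (ae_of_all _ fun x => (expNeg_ne_top _).lt_top), h]

/-- A finite measure is determined by the Laplace transforms of finitely many of the
`[0, ∞]`-valued functions which generate the σ-algebra. -/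
lemma ext_of_lintegral_expNeg_of_generate {S I : Type*} [mS : MeasurableSpace S]
    {ev : I → S → ℝ≥0∞} (hev : ∀ i, Measurable (ev i))
    (hgen : mS ≤ ⨆ i, MeasurableSpace.comap (ev i) inferInstance)
    {μ ν : Measure S} [IsFiniteMeasure μ] [IsFiniteMeasure ν]
    (h : ∀ (s : Finset I) (a : I → ℕ), ∫⁻ x, expNeg (∑ i ∈ s, a i * ev i x) ∂μ
      = ∫⁻ x, expNeg (∑ i ∈ s, a i * ev i x) ∂ν) : μ = ν := by
  classical
  let E : S → I → ℝ≥0∞ := fun x i => ev i x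
  have hE : Measurable E := measurable_pi_lambda _ hev
  have hmap : μ.map E = ν.map E := by
    -- Laws on the possibly uncountable product are compared through their finite-dimensional
    -- marginals, where the finite case applies.
    refine IsProjectiveLimit.unique (P := fun s => (μ.map E).map s.restrict)
      (fun s => rfl) (fun s => ?_)
    refine ext_of_lintegral_expNeg fun a => ?_
    beta_reduce
    rw [Measure.map_map (by fun_prop) hE, Measure.map_map (by fun_prop) hE,
      lintegral_map (by fun_prop) (by fun_prop), lintegral_map (by fun_prop) (by fun_prop)]
    have := h s (fun i => if hi : i ∈ s then a ⟨i, hi⟩ else 0)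
    have key : ∀ x, ∑ i ∈ s, ((if hi : i ∈ s then a ⟨i, hi⟩ else 0 : ℕ) : ℝ≥0∞) * ev i x
        = ∑ i : s, (a i : ℝ≥0∞) * ev i x := by
      intro x
      rw [← Finset.sum_coe_sort s]
      exact Finset.sum_congr rfl fun i _ => by simp
    simp_rw [key] at this
    exact this.symm
  have hcomap : mS = MeasurableSpace.comap E MeasurableSpace.pi := by
    refine le_antisymm (hgen.trans ?_) hE.comap_le
    refine iSup_le fun i => ?_
    rintro _ ⟨t, ht, rfl⟩
    exact ⟨Function.eval i ⁻¹' t, measurable_pi_apply i ht, rfl⟩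
  ext t ht
  rw [hcomap] at ht
  obtain ⟨T, hT, rfl⟩ := ht
  rw [← Measure.map_apply hE hT, ← Measure.map_apply hE hT, hmap]

/-- The sum of the integrals of the components of `f` against the components of `M`. -/
def pairing {X : Type*} [MeasurableSpace X] {d : ℕ} (f : Fin d → X → ℝ≥0∞)
    (M : Fin d → Measure X) : ℝ≥0∞ := ∑ j, ∫⁻ x, f j x ∂(M j)

lemma measurable_pairing {X : Type*} [MeasurableSpace X] {d : ℕ} {f : Fin d → X → ℝ≥0∞}
    (hf : ∀ j, Measurable (f j)) : Measurable (pairing f) :=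
  Finset.measurable_sum _ fun j _ =>
    (Measure.measurable_lintegral (hf j)).comp (measurable_pi_apply j)

/-- The law of a vector of random measures is determined by its Laplace functional. -/
lemma ext_of_lintegral_pairing {X : Type*} [MeasurableSpace X] {d : ℕ}
    {μ ν : Measure (Fin d → Measure X)} [IsFiniteMeasure μ] [IsFiniteMeasure ν]
    (h : ∀ f : Fin d → X → ℝ≥0, (∀ j, Measurable (f j)) →
      ∫⁻ M, expNeg (pairing (fun j x => f j x) M) ∂μ
        = ∫⁻ M, expNeg (pairing (fun j x => f j x) M) ∂ν) : μ = ν := by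
  classical
  let I := Fin d × {A : Set X // MeasurableSet A}
  let ev : I → (Fin d → Measure X) → ℝ≥0∞ := fun i M => M i.1 i.2.1
  have hev : ∀ i, Measurable (ev i) := fun i =>
    (Measure.measurable_coe i.2.2).comp (measurable_pi_apply i.1)
  refine ext_of_lintegral_expNeg_of_generate (ev := ev) hev ?_ ?_
  · refine iSup_le fun j => ?_
    rw [Measure.instMeasurableSpace, MeasurableSpace.comap_iSup]
    refine iSup_le fun A => ?_
    rw [MeasurableSpace.comap_iSup]
    refine iSup_le fun hA => ?_
    refine le_trans ?_ (le_iSup _ ((j, ⟨A, hA⟩) : I))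
    rw [MeasurableSpace.comap_comp]
    exact le_of_eq (by rw [BorelSpace.measurable_eq (α := ℝ≥0∞)]; rfl)
  · intro s a
    -- The evaluations on sets generate the σ-algebra; a combination of them is the pairing with
    -- this weighted sum of indicators.
    let f : Fin d → X → ℝ≥0 := fun j x =>
      ∑ i ∈ s, if i.1 = j then (a i : ℝ≥0) * (i.2.1.indicator 1 x) else 0
    have hf : ∀ j, Measurable (f j) := fun j => by
      refine Finset.measurable_sum _ fun i _ => ?_
      by_cases hij : i.1 = j
      · simp only [hij, if_true]
        exact (measurable_one.indicator i.2.2).const_mul _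
      · simp only [hij, if_false]; exact measurable_const
    have key : ∀ M : Fin d → Measure X, ∑ i ∈ s, (a i : ℝ≥0∞) * ev i M
        = pairing (fun j x => (f j x : ℝ≥0∞)) M := by
      intro M
      have h1 : ∀ j x, (f j x : ℝ≥0∞)
          = ∑ i ∈ s, if i.1 = j then (a i : ℝ≥0∞) * (i.2.1.indicator 1 x) else 0 := by
        intro j x
        simp only [f, ENNReal.ofNNReal_finsetSum]
        refine Finset.sum_congr rfl fun i _ => ?_
        split_ifs
        · by_cases hx : x ∈ i.2.1 <;> simp [hx]
        · simp
      simp only [pairing, h1]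
      have h2 : ∀ j, ∫⁻ x, ∑ i ∈ s, (if i.1 = j then (a i : ℝ≥0∞) * (i.2.1.indicator 1 x) else 0)
          ∂(M j) = ∑ i ∈ s, if i.1 = j then (a i : ℝ≥0∞) * ev i M else 0 := by
        intro j
        rw [lintegral_finsetSum']
        · refine Finset.sum_congr rfl fun i _ => ?_
          by_cases hij : i.1 = j
          · simp only [hij, if_true]
            rw [lintegral_const_mul _ (measurable_one.indicator i.2.2),
              lintegral_indicator_one i.2.2, ← hij]
          · simp [hij]
        · intro i _
          by_cases hij : i.1 = j
          · simp only [hij, if_true]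
            exact ((measurable_one.indicator i.2.2).const_mul _).aemeasurable
          · simp only [hij, if_false]; exact aemeasurable_const
      simp_rw [h2]
      rw [Finset.sum_comm]
      simp
    simp_rw [key]
    exact h f hf

lemma lintegral_pi_prod {ι : Type*} [Fintype ι] {E : ι → Type*} [∀ i, MeasurableSpace (E i)]
    {μ : (i : ι) → Measure (E i)} [∀ i, IsProbabilityMeasure (μ i)]
    {g : (i : ι) → E i → ℝ≥0∞} (hg : ∀ i, Measurable (g i)) :
    ∫⁻ x, ∏ i, g i (x i) ∂(Measure.pi μ) = ∏ i, ∫⁻ y, g i y ∂(μ i) := by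
  refine (lintegral_prod_eq_prod_lintegral_of_indepFun Finset.univ
    (fun i (x : (i : ι) → E i) => g i (x i))
    (iIndepFun_pi fun i => (hg i).aemeasurable)
    fun i => (hg i).comp (measurable_pi_apply i)).trans ?_
  refine Finset.prod_congr rfl fun i _ => ?_
  exact (measurePreserving_eval μ i).lintegral_comp (hg i)

/-- Random variables with values in `[0, ∞]` are independent as soon as their joint Laplace
transform factorizes. -/
lemma iIndepFun_of_lintegral_expNeg {Ω : Type*} [MeasurableSpace Ω] {P : Measure Ω}
    [IsProbabilityMeasure P] {ι : Type*} [Fintype ι] {Y : ι → Ω → ℝ≥0∞}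
    (hY : ∀ i, Measurable (Y i))
    (h : ∀ a : ι → ℕ, ∫⁻ ω, ∏ i, expNeg (a i * Y i ω) ∂P
      = ∏ i, ∫⁻ ω, expNeg (a i * Y i ω) ∂P) : iIndepFun Y P := by
  rw [iIndepFun_iff_map_fun_eq_pi_map fun i => (hY i).aemeasurable]
  have : ∀ i, IsProbabilityMeasure (P.map (Y i)) := fun i =>
    Measure.isProbabilityMeasure_map (hY i).aemeasurable
  have hm : Measurable fun ω i => Y i ω := measurable_pi_lambda _ hY
  refine ext_of_lintegral_expNeg fun a => ?_
  rw [lintegral_map (by fun_prop) hm]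
  simp only [expNeg_sum]
  rw [h a, lintegral_pi_prod (g := fun i x => expNeg (a i * x)) (fun i => measurable_expNeg.comp
    (measurable_id.const_mul _))]
  exact Finset.prod_congr rfl fun i _ => (lintegral_map
    (measurable_expNeg.comp (measurable_id.const_mul _)) (hY i)).symm

/-- A law on `[0, ∞]` is determined by its Laplace transform. -/
lemma ext_of_lintegral_expNeg_mul {μ ν : Measure ℝ≥0∞} [IsFiniteMeasure μ] [IsFiniteMeasure ν]
    (h : ∀ a : ℕ, ∫⁻ x, expNeg (a * x) ∂μ = ∫⁻ x, expNeg (a * x) ∂ν) : μ = ν := by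
  refine ext_of_lintegral_expNeg_of_generate (ev := fun (_ : Unit) x => x)
    (fun _ => measurable_id) ?_ ?_
  · exact le_iSup_of_le () (le_of_eq MeasurableSpace.comap_id.symm)
  · intro s a
    by_cases hs : () ∈ s
    · have : s = {()} := by ext x; simp [hs]
      simpa [this] using h (a ())
    · have : s = ∅ := by ext x; simp [hs]
      simpa [this] using h 0


/-! ### The Laplace functional characterizes Poisson random measures -/

lemma expNeg_nat_mul (n : ℕ) (y : ℝ≥0∞) : expNeg (n * y) = expNeg y ^ n := by
  simpa using expNeg_sum (Finset.range n) (fun _ => y)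

/-- Exponential series at `r z` with `z = e^(-a)`. The case `a = ∞` is included: then `z = 0` and
only the event of a zero count contributes. -/
lemma lintegral_poissonMeasure_expNeg (r : ℝ≥0) (a : ℝ≥0∞) :
    ∫⁻ c : ℕ, expNeg (a * c) ∂(poissonMeasure r) = expNeg (r * (1 - expNeg a)) := by
  obtain ⟨z, hz⟩ : ∃ z : ℝ≥0, expNeg a = z := ⟨_, (ENNReal.coe_toNNReal (expNeg_ne_top a)).symm⟩
  have hz1 : (z : ℝ) ≤ 1 := by
    have := expNeg_le_one a
    rw [hz] at this
    exact_mod_cast this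
  have h1 : (r : ℝ≥0∞) * (1 - expNeg a) = ENNReal.ofReal (r * (1 - z)) := by
    rw [hz, ENNReal.ofReal_mul r.coe_nonneg, ENNReal.ofReal_sub _ z.coe_nonneg]
    simp
  rw [h1, expNeg_ofReal (mul_nonneg r.coe_nonneg (by linarith)), poissonMeasure, lintegral_sum_measure]
  have h2 : ∀ n : ℕ, ∫⁻ c : ℕ, expNeg (a * c)
      ∂(ENNReal.ofReal (Real.exp (-r) * r ^ n / n.factorial) • Measure.dirac n)
      = ENNReal.ofReal (Real.exp (-r) * ((r * z) ^ n / n.factorial)) := by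
    intro n
    rw [lintegral_smul_measure, lintegral_dirac, mul_comm a, expNeg_nat_mul, hz,
      ← ENNReal.ofReal_coe_nnreal, ← ENNReal.ofReal_pow z.coe_nonneg, smul_eq_mul,
      ← ENNReal.ofReal_mul (by positivity)]
    congr 1
    rw [mul_pow]
    ring
  simp_rw [h2]
  have h3 := (NormedSpace.expSeries_div_hasSum_exp (r * z : ℝ)).mul_left (Real.exp (-r))
  rw [← ENNReal.ofReal_tsum_of_nonneg (fun n => by positivity) h3.summable, h3.tsum_eq,
    ← Real.exp_eq_exp_ℝ, ← Real.exp_add]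
  congr 2
  ring

/-- At most one indicator is nonzero at a given point, so a map vanishing at zero acts term by term.
It serves for `1 - e^(-y)` and for `log (1 + y)`, turning disjoint sets into independent values. -/
lemma apply_sum_indicator_of_disjoint {E ι : Type*} [Fintype ι] {A : ι → Set E}
    (hA : ∀ i i', i ≠ i' → Disjoint (A i) (A i')) (a : ι → ℝ≥0∞) {ψ : ℝ≥0∞ → ℝ≥0∞}
    (hψ : ψ 0 = 0) (x : E) :
    ψ (∑ i, (A i).indicator (fun _ => a i) x) = ∑ i, (A i).indicator (fun _ => ψ (a i)) x := by
  classical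
  by_cases hx : ∃ i, x ∈ A i
  · obtain ⟨i, hi⟩ := hx
    have hne : ∀ b : ι → ℝ≥0∞, ∑ i', (A i').indicator (fun _ => b i') x = b i := by
      intro b
      rw [Finset.sum_eq_single i]
      · simp [hi]
      · intro i' _ hi'
        exact Set.indicator_of_notMem
          (fun h => Set.disjoint_left.1 (hA i' i hi') h hi) _
      · simp
    rw [hne, hne]
  · push Not at hx
    simp [Set.indicator_of_notMem (hx _), hψ]

lemma lintegral_sum_indicator {E ι : Type*} [MeasurableSpace E] [Fintype ι] {A : ι → Set E}
    (hA : ∀ i, MeasurableSet (A i)) (a : ι → ℝ≥0∞) (M : Measure E) :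
    ∫⁻ x, ∑ i, (A i).indicator (fun _ => a i) x ∂M = ∑ i, a i * M (A i) := by
  rw [lintegral_finsetSum _ fun i _ => measurable_const.indicator (hA i)]
  exact Finset.sum_congr rfl fun i _ => lintegral_indicator_const (hA i) _

section Poisson

variable {Ω : Type v} [MeasurableSpace Ω] {P : Measure Ω}
  {E : Type w} [MeasurableSpace E] {N : Ω → Measure E} {Λ : Measure E}

lemma IsPoissonRandomMeasure.lintegral_expNeg_mul (h : IsPoissonRandomMeasure P N Λ) {A : Set E}
    (hA : MeasurableSet A) (hΛ : Λ A ≠ ∞) (a : ℝ≥0∞) :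
    ∫⁻ ω, expNeg (a * N ω A) ∂P = expNeg ((1 - expNeg a) * Λ A) := by
  have hm : Measurable fun ω => N ω A := (Measure.measurable_coe hA).comp h.measurable
  have hg : Measurable fun y => expNeg (a * y) := measurable_expNeg.comp (measurable_id.const_mul _)
  rw [← lintegral_map (f := fun y => expNeg (a * y)) hg hm, h.law A hA hΛ,
    lintegral_map hg (by fun_prop), lintegral_poissonMeasure_expNeg, ENNReal.coe_toNNReal hΛ,
    mul_comm]

variable [IsProbabilityMeasure P]

/-- The level sets are disjoint, so their counts are independent Poisson variables and the transform
factorizes. The level `0` is exempt from finiteness because it contributes the factor `1` on both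
sides. -/
lemma IsPoissonRandomMeasure.lintegral_expNeg_simpleFunc (h : IsPoissonRandomMeasure P N Λ)
    (g : SimpleFunc E ℝ≥0∞) (hg : ∀ y ≠ 0, Λ (g ⁻¹' {y}) ≠ ∞) :
    ∫⁻ ω, expNeg (∫⁻ p, g p ∂(N ω)) ∂P = expNeg (∫⁻ p, (1 - expNeg (g p)) ∂Λ) := by
  let e : Fin g.range.card ≃ g.range := g.range.equivFin.symm
  have hind := h.indep g.range.card (fun i => g ⁻¹' {(e i : ℝ≥0∞)})
    (fun i => g.measurableSet_fiber _) (fun i i' hii' => by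
      refine Disjoint.preimage _ (Set.disjoint_singleton.2 fun h' => hii' ?_)
      exact e.injective (Subtype.ext h'))
  have hm : ∀ y : ℝ≥0∞, Measurable fun ω => N ω (g ⁻¹' {y}) := fun y =>
    (Measure.measurable_coe (g.measurableSet_fiber _)).comp h.measurable
  have hm' : ∀ y : ℝ≥0∞, Measurable fun z : ℝ≥0∞ => expNeg (y * z) := fun y =>
    measurable_expNeg.comp (measurable_id.const_mul _)
  have hind2 := hind.comp (fun i z => expNeg (e i * z)) (fun i => hm' _)
  have h1 := lintegral_prod_eq_prod_lintegral_of_indepFun Finset.univ _ hind2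
    (fun i => (hm' _).comp (hm _))
  have h2 : ∀ ω, ∏ i, ((fun z => expNeg (e i * z)) ∘ fun ω => N ω (g ⁻¹' {(e i : ℝ≥0∞)})) ω
      = expNeg (∫⁻ p, g p ∂(N ω)) := by
    intro ω
    rw [SimpleFunc.lintegral_eq_lintegral g (N ω), SimpleFunc.lintegral, expNeg_sum,
      ← Finset.prod_coe_sort g.range (fun y => expNeg (y * N ω (g ⁻¹' {y})))]
    exact Fintype.prod_equiv e _ _ fun i => rfl
  simp_rw [h2] at h1
  rw [h1]
  have h3 : ∫⁻ p, (1 - expNeg (g p)) ∂Λ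
      = ∑ y ∈ g.range, (1 - expNeg y) * Λ (g ⁻¹' {y}) := by
    rw [← SimpleFunc.map_lintegral (fun y => 1 - expNeg y), ← SimpleFunc.lintegral_eq_lintegral]
    rfl
  rw [h3, expNeg_sum, ← Finset.prod_coe_sort g.range (fun y => expNeg ((1 - expNeg y) * _))]
  refine Fintype.prod_equiv e _ _ fun i => ?_
  by_cases hi : (e i : ℝ≥0∞) = 0
  · simp [hi]
  · exact h.lintegral_expNeg_mul (g.measurableSet_fiber _) (hg _ hi) _

/-- The Laplace functional of a Poisson random measure. -/
lemma IsPoissonRandomMeasure.lintegral_expNeg (h : IsPoissonRandomMeasure P N Λ) [SigmaFinite Λ]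
    {f : E → ℝ≥0∞} (hf : Measurable f) :
    ∫⁻ ω, expNeg (∫⁻ p, f p ∂(N ω)) ∂P = expNeg (∫⁻ p, (1 - expNeg (f p)) ∂Λ) := by
  -- Cutting the simple approximations off outside `spanningSets Λ n` gives their nonzero levels
  -- finite intensity. The integrals increase to those of `f`, and `expNeg ≤ 1` gives domination.
  let g : ℕ → SimpleFunc E ℝ≥0∞ := fun n =>
    (SimpleFunc.eapprox f n).restrict (spanningSets Λ n)
  have hgi : ∀ n p, g n p = (spanningSets Λ n).indicator (SimpleFunc.eapprox f n) p := fun n p =>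
    SimpleFunc.restrict_apply _ (measurableSet_spanningSets Λ n) _
  have hmono : ∀ p, Monotone fun n => g n p := by
    intro p n m hnm
    simp only [hgi]
    refine (Set.indicator_le_indicator_of_subset (monotone_spanningSets Λ hnm)
      (fun _ => zero_le) p).trans ?_
    exact Set.indicator_le_indicator (SimpleFunc.monotone_eapprox f hnm p)
  have htend : ∀ p, Tendsto (fun n => g n p) atTop (𝓝 (f p)) := by
    intro p
    have h1 : Tendsto (fun n => SimpleFunc.eapprox f n p) atTop (𝓝 (f p)) := by
      rw [← SimpleFunc.iSup_eapprox_apply hf p]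
      exact tendsto_atTop_iSup fun n m hnm => SimpleFunc.monotone_eapprox f hnm p
    refine h1.congr' ?_
    filter_upwards [eventually_ge_atTop (spanningSetsIndex Λ p)] with n hn
    rw [hgi, Set.indicator_of_mem]
    exact monotone_spanningSets Λ hn (mem_spanningSetsIndex Λ p)
  have hfin : ∀ n, ∀ y ≠ 0, Λ (g n ⁻¹' {y}) ≠ ∞ := by
    intro n y hy
    refine ((measure_mono ?_).trans_lt (measure_spanningSets_lt_top Λ n)).ne
    intro p hp
    by_contra hpn
    refine hy ?_
    rw [← (hp : g n p = y), hgi, Set.indicator_of_notMem hpn]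
  have hL : Tendsto (fun n => ∫⁻ ω, expNeg (∫⁻ p, g n p ∂(N ω)) ∂P) atTop
      (𝓝 (∫⁻ ω, expNeg (∫⁻ p, f p ∂(N ω)) ∂P)) := by
    refine tendsto_lintegral_of_dominated_convergence (fun _ => 1) ?_ ?_ ?_ ?_
    · exact fun n => measurable_expNeg.comp
        ((Measure.measurable_lintegral (g n).measurable).comp h.measurable)
    · exact fun n => ae_of_all _ fun ω => expNeg_le_one _
    · simp
    · refine ae_of_all _ fun ω => (continuous_expNeg.tendsto _).comp ?_
      exact lintegral_tendsto_of_tendsto_of_monotone (fun n => (g n).measurable.aemeasurable)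
        (ae_of_all _ hmono) (ae_of_all _ htend)
  have hR : Tendsto (fun n => expNeg (∫⁻ p, (1 - expNeg (g n p)) ∂Λ)) atTop
      (𝓝 (expNeg (∫⁻ p, (1 - expNeg (f p)) ∂Λ))) := by
    refine (continuous_expNeg.tendsto _).comp ?_
    refine lintegral_tendsto_of_tendsto_of_monotone
      (fun n => ((measurable_expNeg.comp (g n).measurable).const_sub 1).aemeasurable)
      (ae_of_all _ fun p n m hnm => tsub_le_tsub_left (expNeg_antitone (hmono p hnm)) 1)
      (ae_of_all _ fun p => ?_)
    exact ENNReal.Tendsto.sub tendsto_const_nhds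
      ((continuous_expNeg.tendsto _).comp (htend p)) (.inl ENNReal.one_ne_top)
  refine tendsto_nhds_unique hL (hR.congr fun n => ?_)
  exact (h.lintegral_expNeg_simpleFunc (g n) (hfin n)).symm

/-- A random measure with the Laplace functional of a Poisson random measure is one. -/
lemma isPoissonRandomMeasure_of_lintegral_expNeg (hN : Measurable N)
    (h : ∀ f : E → ℝ≥0∞, Measurable f →
      ∫⁻ ω, expNeg (∫⁻ p, f p ∂(N ω)) ∂P = expNeg (∫⁻ p, (1 - expNeg (f p)) ∂Λ)) :
    IsPoissonRandomMeasure P N Λ := by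
  have hm : ∀ A, MeasurableSet A → Measurable fun ω => N ω A := fun A hA =>
    (Measure.measurable_coe hA).comp hN
  have h1 : ∀ A, MeasurableSet A → ∀ a : ℝ≥0∞,
      ∫⁻ ω, expNeg (a * N ω A) ∂P = expNeg ((1 - expNeg a) * Λ A) := by
    intro A hA a
    have := h (A.indicator fun _ => a) (measurable_const.indicator hA)
    simp_rw [lintegral_indicator_const hA] at this
    rw [this, ← lintegral_indicator_const hA]
    congr 2 with p
    by_cases hp : p ∈ A <;> simp [hp]
  refine ⟨hN, fun r A hA hd => ?_, fun A hA hΛ => ?_⟩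
  · refine iIndepFun_of_lintegral_expNeg (fun i => hm _ (hA i)) fun a => ?_
    have h2 := h (fun p => ∑ i, (A i).indicator (fun _ => (a i : ℝ≥0∞)) p)
      (Finset.measurable_sum _ fun i _ => measurable_const.indicator (hA i))
    simp_rw [lintegral_sum_indicator hA, expNeg_sum] at h2
    rw [h2]
    -- Disjointness makes the exponent additive over the sets, so the joint transform is a product
    -- of marginal ones.
    have h3 : ∀ p, 1 - ∏ i, expNeg ((A i).indicator (fun _ => (a i : ℝ≥0∞)) p)
        = ∑ i, (A i).indicator (fun _ => 1 - expNeg (a i)) p := by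
      intro p
      rw [← expNeg_sum]
      exact apply_sum_indicator_of_disjoint hd _ (ψ := fun y => 1 - expNeg y) (by simp) p
    simp_rw [h3, lintegral_sum_indicator hA, expNeg_sum, h1 _ (hA _)]
  · have : IsProbabilityMeasure (P.map fun ω => N ω A) :=
      Measure.isProbabilityMeasure_map (hm A hA).aemeasurable
    refine ext_of_lintegral_expNeg_mul fun a => ?_
    have hg : Measurable fun y => expNeg (a * y) :=
      measurable_expNeg.comp (measurable_id.const_mul _)
    rw [lintegral_map hg (hm A hA), h1 A hA, lintegral_map hg (by fun_prop),
      lintegral_poissonMeasure_expNeg, ENNReal.coe_toNNReal hΛ, mul_comm]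

end Poisson


/-! ### Integrating out independent scores -/

section Marks

variable {Ω : Type v} [MeasurableSpace Ω] {P : Measure Ω} [IsProbabilityMeasure P]
  {F E ι : Type*} [MeasurableSpace F] [MeasurableSpace E] {Z : Ω → F} {m : ι → Ω → E}
  {γ : Measure E} [IsProbabilityMeasure γ]

/-- Scores with a constant conditional law are i.i.d. and independent of the atoms. -/
lemma IsCondIndepWithLaws.map_eq_prod (h : IsCondIndepWithLaws P Z m fun _ _ => γ) :
    P.map (fun ω => (Z ω, fun q => m q ω)) = (P.map Z).prod (Measure.infinitePi fun _ => γ) := by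
  have hm : Measurable fun ω q => m q ω := measurable_pi_lambda _ h.measurable
  have hZ := h.measurable_cond
  have : IsProbabilityMeasure (P.map Z) := Measure.isProbabilityMeasure_map hZ.aemeasurable
  refine (Measure.prod_eq fun D S hD hS => ?_).symm
  rw [Measure.map_apply (hZ.prodMk hm) (hD.prod hS), Measure.map_apply hZ hD]
  have hset : (fun ω => (Z ω, fun q => m q ω)) ⁻¹' D ×ˢ S
      = Z ⁻¹' D ∩ (fun ω q => m q ω) ⁻¹' S := rfl
  rw [hset]
  by_cases h0 : P (Z ⁻¹' D) = 0
  · rw [h0, zero_mul]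
    exact measure_mono_null Set.inter_subset_left h0
  -- Conditionally on `Z ∈ D` the scores have the infinite product law, since they agree with it on
  -- cylinders; the null case was treated separately.
  have hprob := cond_isProbabilityMeasure (μ := P) h0
  have key : (P[|Z ⁻¹' D]).map (fun ω q => m q ω) = Measure.infinitePi fun _ => γ := by
    refine Measure.eq_infinitePi _ fun s B hB => ?_
    have hpre : (fun ω q => m q ω) ⁻¹' (Set.pi (s : Set ι) B) = ⋂ q ∈ s, m q ⁻¹' B q := by
      ext ω; simp [Set.mem_pi]
    have hlaw := h.law s B D hB hD
    rw [setLIntegral_const] at hlaw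
    rw [Measure.map_apply hm (MeasurableSet.pi s.countable_toSet fun q _ => hB q), hpre,
      cond_apply (hZ hD), hlaw, mul_comm (∏ q ∈ s, γ (B q)), ← mul_assoc,
      ENNReal.inv_mul_cancel h0 (measure_ne_top _ _), one_mul]
  rw [← key, Measure.map_apply hm hS, cond_apply (hZ hD), ← mul_assoc,
    ENNReal.mul_inv_cancel h0 (measure_ne_top _ _), one_mul]

/-- The product form of the joint law lets Fubini freeze `Z`; for fixed `Z` the factors involve
distinct coordinates of a product measure. -/
lemma IsCondIndepWithLaws.lintegral_prod (h : IsCondIndepWithLaws P Z m fun _ _ => γ)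
    {k : F → ℝ≥0∞} (hk : Measurable k) {g : ι → F → E → ℝ≥0∞}
    (hg : ∀ q, Measurable (Function.uncurry (g q))) (s : Finset ι) :
    ∫⁻ ω, k (Z ω) * ∏ q ∈ s, g q (Z ω) (m q ω) ∂P
      = ∫⁻ ω, k (Z ω) * ∏ q ∈ s, ∫⁻ t, g q (Z ω) t ∂γ ∂P := by
  have hm : Measurable fun ω q => m q ω := measurable_pi_lambda _ h.measurable
  have hZ := h.measurable_cond
  have hg' : ∀ q, Measurable fun z => ∫⁻ t, g q z t ∂γ := fun q => (hg q).lintegral_prod_right'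
  have hG : Measurable fun y : F × (ι → E) => k y.1 * ∏ q ∈ s, g q y.1 (y.2 q) := by
    refine (hk.comp measurable_fst).mul (Finset.measurable_prod _ fun q _ => ?_)
    exact (hg q).comp (measurable_fst.prodMk ((measurable_pi_apply q).comp measurable_snd))
  calc ∫⁻ ω, k (Z ω) * ∏ q ∈ s, g q (Z ω) (m q ω) ∂P
      = ∫⁻ y, k y.1 * ∏ q ∈ s, g q y.1 (y.2 q) ∂(P.map fun ω => (Z ω, fun q => m q ω)) :=
        (lintegral_map hG (hZ.prodMk hm)).symm
    _ = ∫⁻ z, k z * ∏ q ∈ s, ∫⁻ t, g q z t ∂γ ∂(P.map Z) := by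
        rw [h.map_eq_prod, MeasureTheory.lintegral_prod _ hG.aemeasurable]
        refine lintegral_congr fun z => ?_
        have hgz : ∀ q, Measurable (g q z) := fun q => (hg q).comp measurable_prodMk_left
        have hpz : Measurable fun t : ι → E => ∏ q ∈ s, g q z (t q) :=
          Finset.measurable_prod _ fun q _ => (hgz q).comp (measurable_pi_apply q)
        refine (lintegral_const_mul (k z) hpz).trans ?_
        congr 1
        refine (lintegral_prod_eq_prod_lintegral_of_indepFun s
          (fun q (t : ι → E) => g q z (t q)) (iIndepFun_infinitePi hgz)
          fun q => (hgz q).comp (measurable_pi_apply q)).trans ?_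
        refine Finset.prod_congr rfl fun q _ => ?_
        rw [← lintegral_map (hgz q) (measurable_pi_apply q), Measure.infinitePi_map_eval]
    _ = _ := lintegral_map (hk.mul (Finset.measurable_prod _ fun q _ => hg' q)) hZ

/-- Limit of the finite products along finite subsets of `ι`, dominated by `1`. The extra factor `k`
lets a functional of the atoms be carried along. -/
lemma IsCondIndepWithLaws.lintegral_expNeg [Countable ι]
    (h : IsCondIndepWithLaws P Z m fun _ _ => γ) {k : F → ℝ≥0∞} (hk : Measurable k)
    (hk1 : ∀ z, k z ≤ 1) {g : ι → F → E → ℝ≥0∞}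
    (hg : ∀ q, Measurable (Function.uncurry (g q))) :
    ∫⁻ ω, k (Z ω) * expNeg (∑' q, g q (Z ω) (m q ω)) ∂P
      = ∫⁻ ω, k (Z ω) * expNeg (∑' q, negLog (∫⁻ t, expNeg (g q (Z ω) t) ∂γ)) ∂P := by
  have hZ := h.measurable_cond
  have he : ∀ q, Measurable (Function.uncurry fun z t => expNeg (g q z t)) := fun q =>
    measurable_expNeg.comp (hg q)
  have he' : ∀ q, Measurable fun z => ∫⁻ t, expNeg (g q z t) ∂γ := fun q =>
    (he q).lintegral_prod_right'
  have hle : ∀ q z, ∫⁻ t, expNeg (g q z t) ∂γ ≤ 1 := fun q z =>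
    (lintegral_mono fun t => expNeg_le_one _).trans (by simp)
  have hfin : ∫⁻ _, (1 : ℝ≥0∞) ∂P ≠ ∞ := by simp
  have hL : Tendsto (fun s : Finset ι => ∫⁻ ω, k (Z ω) * ∏ q ∈ s, expNeg (g q (Z ω) (m q ω)) ∂P)
      atTop (𝓝 (∫⁻ ω, k (Z ω) * expNeg (∑' q, g q (Z ω) (m q ω)) ∂P)) := by
    refine tendsto_lintegral_filter_of_dominated_convergence (fun _ => 1)
      (.of_forall fun s => ?_) (.of_forall fun s => ae_of_all _ fun ω => ?_) hfin
      (ae_of_all _ fun ω => ?_)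
    · exact (hk.comp hZ).mul (Finset.measurable_prod _ fun q _ =>
        (he q).comp (hZ.prodMk (h.measurable q)))
    · exact mul_le_one' (hk1 _) (Finset.prod_le_one' fun q _ => expNeg_le_one _)
    · exact ENNReal.Tendsto.const_mul (tendsto_prod_expNeg _)
        (.inr ((hk1 _).trans_lt ENNReal.one_lt_top).ne)
  have hR : Tendsto (fun s : Finset ι =>
      ∫⁻ ω, k (Z ω) * ∏ q ∈ s, ∫⁻ t, expNeg (g q (Z ω) t) ∂γ ∂P)
      atTop (𝓝 (∫⁻ ω, k (Z ω) * expNeg (∑' q, negLog (∫⁻ t, expNeg (g q (Z ω) t) ∂γ)) ∂P)) := by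
    refine tendsto_lintegral_filter_of_dominated_convergence (fun _ => 1)
      (.of_forall fun s => ?_) (.of_forall fun s => ae_of_all _ fun ω => ?_) hfin
      (ae_of_all _ fun ω => ?_)
    · exact (hk.comp hZ).mul (Finset.measurable_prod _ fun q _ => (he' q).comp hZ)
    · exact mul_le_one' (hk1 _) (Finset.prod_le_one' fun q _ => hle q _)
    · refine ENNReal.Tendsto.const_mul ?_ (.inr ((hk1 _).trans_lt ENNReal.one_lt_top).ne)
      refine (tendsto_prod_expNeg _).congr fun s => ?_
      exact Finset.prod_congr rfl fun q _ => expNeg_negLog (hle q _)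
  refine tendsto_nhds_unique hL (hR.congr fun s => ?_)
  exact (h.lintegral_prod hk he s).symm

end Marks

/-! ### Compound random measures and their joint Laplace functional -/

section Compound

variable {X : Type u} [MeasurableSpace X] {Ω : Type v}
  {d : ℕ} {J : ℕ → Ω → ℝ} {x : ℕ → Ω → X} {m : ℕ × Fin d → Ω → ℝ}

lemma lintegral_compoundMeasure {g : X → ℝ≥0∞} (hg : Measurable g) (j : Fin d) (ω : Ω) :
    ∫⁻ y, g y ∂(compoundMeasure J x m j ω)
      = ∑' i, ENNReal.ofReal (m (i, j) ω * J i ω) * g (x i ω) := by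
  simp only [compoundMeasure, lintegral_sum_measure, lintegral_smul_measure,
    lintegral_dirac' _ hg, smul_eq_mul]

lemma pairing_compoundMeasure {g : Fin d → X → ℝ≥0∞} (hg : ∀ j, Measurable (g j)) (ω : Ω) :
    pairing g (fun j => compoundMeasure J x m j ω)
      = ∑' q : ℕ × Fin d, ENNReal.ofReal (m q ω * J q.1 ω) * g q.2 (x q.1 ω) := by
  simp only [pairing, lintegral_compoundMeasure (hg _)]
  rw [ENNReal.tsum_prod', ENNReal.tsum_comm, tsum_fintype]

variable [MeasurableSpace Ω]

lemma measurable_compoundMeasure (hJ : ∀ i, Measurable (J i)) (hx : ∀ i, Measurable (x i))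
    (hm : ∀ q, Measurable (m q)) (j : Fin d) : Measurable (compoundMeasure J x m j) := by
  refine Measure.measurable_of_measurable_coe _ fun s hs => ?_
  simp only [compoundMeasure, Measure.sum_apply _ hs, Measure.smul_apply, smul_eq_mul,
    Measure.dirac_apply' _ hs]
  refine Measurable.tsum fun i => ?_
  exact ((hm _).mul (hJ i)).ennreal_ofReal.mul ((measurable_one.indicator hs).comp (hx i))

variable {P : Measure Ω} {ν : Measure ℝ} {α : Measure X}

lemma IsCompoundRep.measurable_jump {f : Fin d → ℝ → Measure ℝ} (h : IsCompoundRep P ν α f J x m)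
    (i : ℕ) : Measurable (J i) :=
  measurable_fst.comp ((measurable_pi_apply i).comp h.scores.measurable_cond)

lemma IsCompoundRep.measurable_loc {f : Fin d → ℝ → Measure ℝ} (h : IsCompoundRep P ν α f J x m)
    (i : ℕ) : Measurable (x i) :=
  measurable_snd.comp ((measurable_pi_apply i).comp h.scores.measurable_cond)

lemma IsCompoundRep.measurable_vec {f : Fin d → ℝ → Measure ℝ} (h : IsCompoundRep P ν α f J x m) :
    Measurable fun ω j => compoundMeasure J x m j ω :=
  measurable_pi_lambda _ fun j =>
    measurable_compoundMeasure h.measurable_jump h.measurable_loc h.scores.measurable j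

variable [IsProbabilityMeasure P] [SigmaFinite ν] [SigmaFinite α] {γ : Measure ℝ}
  [IsProbabilityMeasure γ]

/-- The joint Laplace functional of the atoms and the scores. -/
lemma IsCompoundRep.lintegral_expNeg_marked (h : IsCompoundRep P ν α (fun _ _ => γ) J x m)
    {f : ℝ × X → ℝ≥0∞} (hf : Measurable f) {g : Fin d → ℝ × X → ℝ → ℝ≥0∞}
    (hg : ∀ j, Measurable (Function.uncurry (g j))) :
    ∫⁻ ω, expNeg (∑' i, f (J i ω, x i ω)) *
        expNeg (∑' q : ℕ × Fin d, g q.2 (J q.1 ω, x q.1 ω) (m q ω)) ∂P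
      = expNeg (∫⁻ p, (1 - expNeg (f p) * ∏ j, ∫⁻ t, expNeg (g j p t) ∂γ) ∂(ν.prod α)) := by
  have h1 := h.scores.lintegral_expNeg (k := fun z => expNeg (∑' i, f (z i)))
    (measurable_expNeg.comp (Measurable.tsum fun i => hf.comp (measurable_pi_apply i)))
    (fun z => expNeg_le_one _) (g := fun q z t => g q.2 (z q.1) t)
    (fun q => (hg q.2).comp (f := fun y : (ℕ → ℝ × X) × ℝ => (y.1 q.1, y.2)) (by fun_prop))
  refine h1.trans ?_
  let G : Fin d → ℝ × X → ℝ≥0∞ := fun j p => ∫⁻ t, expNeg (g j p t) ∂γ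
  have hG : ∀ j, Measurable (G j) := fun j =>
    (measurable_expNeg.comp (hg j)).lintegral_prod_right'
  have hG1 : ∀ j p, G j p ≤ 1 := fun j p =>
    (lintegral_mono fun t => expNeg_le_one _).trans (by simp)
  -- Once the scores are integrated out, an atom `p` contributes the exponent `f p` plus one
  -- logarithm for each group, which is a function of the atom alone, as the Poisson formula
  -- requires.
  have hF : Measurable fun p => f p + ∑ j, negLog (G j p) :=
    hf.add (Finset.measurable_sum _ fun j _ => measurable_negLog.comp (hG j))
  have h2 := h.poisson.lintegral_expNeg hF
  simp only [lintegral_sum_measure, lintegral_dirac' _ hF, points] at h2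
  have h3 : ∀ p, expNeg (f p + ∑ j, negLog (G j p)) = expNeg (f p) * ∏ j, G j p := fun p => by
    rw [expNeg_add, expNeg_sum]
    simp_rw [expNeg_negLog (hG1 _ p)]
  simp_rw [h3] at h2
  rw [← h2]
  refine lintegral_congr fun ω => ?_
  rw [← expNeg_add, ENNReal.tsum_add, ENNReal.tsum_prod']
  simp only [tsum_fintype]
  rfl

end Compound


/-! ### Gamma and beta integrals -/

lemma lintegral_Ioo_of_hasDerivAt_of_nonneg {F F' : ℝ → ℝ} {a b : ℝ} (hab : a ≤ b)
    (hc : ContinuousOn F (Set.Icc a b)) (hd : ∀ x ∈ Set.Ioo a b, HasDerivAt F (F' x) x)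
    (hpos : ∀ x ∈ Set.Ioo a b, 0 ≤ F' x) :
    ∫⁻ x in Set.Ioo a b, ENNReal.ofReal (F' x) = ENNReal.ofReal (F b - F a) := by
  -- Nonnegativity of the derivative supplies integrability, so `F'` may blow up at an endpoint, as
  -- `(1 - s) ^ (φ - 1)` does at `1` when `φ < 1`.
  have hint : IntegrableOn F' (Set.Ioc a b) :=
    intervalIntegral.integrableOn_deriv_of_nonneg hc hd hpos
  have hint' : IntegrableOn F' (Set.Ioo a b) := hint.mono_set Set.Ioo_subset_Ioc_self
  rw [← ofReal_integral_eq_lintegral_ofReal hint'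
    ((ae_restrict_iff' measurableSet_Ioo).2 (ae_of_all _ hpos)),
    ← integral_Ioc_eq_integral_Ioo, ← intervalIntegral.integral_of_le hab,
    intervalIntegral.integral_eq_sub_of_hasDerivAt_of_le hab hc hd
      ((intervalIntegrable_iff_integrableOn_Ioc_of_le hab).2 hint)]

section Gamma

variable {φ : ℝ}

lemma Gamma_add_nat (hφ : 0 < φ) (c : ℕ) :
    Real.Gamma (φ + c) = (ascPochhammer ℝ c).eval φ * Real.Gamma φ := by
  induction c with
  | zero => simp
  | succ c ih =>
    have : φ + (c + 1 : ℕ) = (φ + c) + 1 := by push_cast; ring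
    rw [this, Real.Gamma_add_one (by positivity), ih, ascPochhammer_succ_eval]
    ring

/-- The factor contributed by a score `t` of an atom with jump `s` which is observed `c` times. -/
def scoreWeight (c : ℕ) (a : ℝ≥0) (s t : ℝ) : ℝ≥0∞ :=
  ENNReal.ofReal (t * s) ^ c * expNeg (ENNReal.ofReal (t * s) * a)

@[fun_prop]
lemma measurable_scoreWeight (c : ℕ) :
    Measurable fun y : ℝ≥0 × ℝ × ℝ => scoreWeight c y.1 y.2.1 y.2.2 := by
  unfold scoreWeight
  fun_prop

lemma scoreWeight_add (c : ℕ) (a b : ℝ≥0) (s t : ℝ) :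
    scoreWeight c (a + b) s t = scoreWeight c a s t * expNeg (ENNReal.ofReal (t * s) * b) := by
  rw [scoreWeight, scoreWeight, mul_assoc, ← expNeg_add, ENNReal.coe_add, mul_add]

lemma scoreWeight_succ (c : ℕ) (a : ℝ≥0) (s t : ℝ) :
    scoreWeight (c + 1) a s t = ENNReal.ofReal (t * s) * scoreWeight c a s t := by
  rw [scoreWeight, scoreWeight, pow_succ']
  ring

/-- The total mass of `scoreWeight` under the `Gamma(φ, 1)` law. -/
def scoreMass (φ : ℝ) (c : ℕ) (a s : ℝ) : ℝ :=
  s ^ c * ((ascPochhammer ℝ c).eval φ / (s * a + 1) ^ ((c : ℝ) + φ))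

lemma scoreMass_pos (hφ : 0 < φ) (c : ℕ) (a : ℝ≥0) {s : ℝ} (hs : 0 < s) :
    0 < scoreMass φ c a s := by
  have := ascPochhammer_pos c φ hφ
  unfold scoreMass
  positivity

/-- Gamma conjugacy: the factor `(t s)^c` raises the shape by `c`, the factor `e^(-a t s)` raises
the rate by `s a`, and `scoreMass` is the ratio of normalizing constants. All posterior laws of
scores come from this. -/
lemma gammaMeasure_withDensity_scoreWeight (hφ : 0 < φ) (c : ℕ) (a : ℝ≥0) {s : ℝ} (hs : 0 < s) :
    (gammaMeasure φ 1).withDensity (scoreWeight c a s)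
      = ENNReal.ofReal (scoreMass φ c a s) • gammaMeasure (φ + c) (s * a + 1) := by
  have hmeas : Measurable (scoreWeight c a s) :=
    (measurable_scoreWeight c).comp (f := fun t => (a, s, t)) (by fun_prop)
  have hpdf : ∀ a r, Measurable (gammaPDF a r) := fun a r =>
    (measurable_gammaPDFReal a r).ennreal_ofReal
  have hpoch := ascPochhammer_pos c φ hφ
  rw [gammaMeasure, gammaMeasure, ← withDensity_mul _ (hpdf _ _) hmeas,
    ← withDensity_smul _ (hpdf _ _)]
  refine withDensity_congr_ae ?_
  -- The origin is discarded because real powers do not multiply additively in the exponent there.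
  have h0 : ∀ᵐ t : ℝ, t ≠ 0 := by simp [ae_iff]
  filter_upwards [h0] with t ht
  rcases lt_or_gt_of_ne ht with ht | ht
  · simp [gammaPDF_of_neg ht]
  · have hr : 0 < s * a + 1 := by positivity
    simp only [Pi.mul_apply, Pi.smul_apply, smul_eq_mul]
    rw [gammaPDF_of_nonneg ht.le, gammaPDF_of_nonneg ht.le, scoreWeight,
      ← ENNReal.ofReal_pow (by positivity), ← ENNReal.ofReal_coe_nnreal,
      ← ENNReal.ofReal_mul (by positivity), expNeg_ofReal (by positivity),
      ← ENNReal.ofReal_mul (by positivity), ← ENNReal.ofReal_mul (by positivity),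
      ← ENNReal.ofReal_mul (scoreMass_pos hφ c a hs).le]
    congr 1
    have hG := Real.Gamma_pos_of_pos hφ
    have hexp : Real.exp (-((s * a + 1) * t)) = Real.exp (-(1 * t)) * Real.exp (-(t * s * a)) := by
      rw [← Real.exp_add]; congr 1; ring
    have hpow : t ^ (φ + c - 1) = t ^ (φ - 1) * t ^ c := by
      rw [← Real.rpow_natCast, ← Real.rpow_add ht]; congr 1; ring
    rw [Gamma_add_nat hφ, hexp, hpow, scoreMass, add_comm (c : ℝ) φ, Real.one_rpow, mul_pow]
    have hr' : (s * a + 1) ^ (φ + c) ≠ 0 := (Real.rpow_pos_of_pos hr _).ne'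
    field_simp

lemma lintegral_scoreWeight_mul (hφ : 0 < φ) (c : ℕ) (a : ℝ≥0) {s : ℝ} (hs : 0 < s)
    {g : ℝ → ℝ≥0∞} (hg : Measurable g) :
    ∫⁻ t, scoreWeight c a s t * g t ∂(gammaMeasure φ 1)
      = ENNReal.ofReal (scoreMass φ c a s) * ∫⁻ t, g t ∂(gammaMeasure (φ + c) (s * a + 1)) := by
  have hmeas : Measurable (scoreWeight c a s) :=
    (measurable_scoreWeight c).comp (f := fun t => (a, s, t)) (by fun_prop)
  rw [← smul_eq_mul (ENNReal.ofReal _), ← lintegral_smul_measure,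
    ← gammaMeasure_withDensity_scoreWeight hφ c a hs,
    lintegral_withDensity_eq_lintegral_mul _ hmeas hg]
  rfl

lemma lintegral_scoreWeight (hφ : 0 < φ) (c : ℕ) (a : ℝ≥0) {s : ℝ} (hs : 0 < s) :
    ∫⁻ t, scoreWeight c a s t ∂(gammaMeasure φ 1) = ENNReal.ofReal (scoreMass φ c a s) := by
  have : IsProbabilityMeasure (gammaMeasure (φ + c) (s * a + 1)) :=
    isProbabilityMeasure_gammaMeasure (by positivity) (by positivity)
  simpa using lintegral_scoreWeight_mul hφ c a hs (g := 1) measurable_one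

lemma ae_nonneg_gammaMeasure (a r : ℝ) : ∀ᵐ t ∂(gammaMeasure a r), 0 ≤ t := by
  rw [ae_iff, gammaMeasure, withDensity_apply' _ _]
  have : {t : ℝ | ¬0 ≤ t} = Set.Iio 0 := by ext t; simp
  rw [this]
  exact lintegral_gammaPDF_of_nonpos le_rfl

end Gamma

section BetaLevy

variable {φ : ℝ}

instance : SigmaFinite (betaLevy φ) := by
  unfold betaLevy
  exact SigmaFinite.withDensity_ofReal _

lemma measurable_betaLevy_density :
    Measurable fun z : ℝ => ENNReal.ofReal (z⁻¹ * (1 - z) ^ (φ - 1)) := by fun_prop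

lemma ae_betaLevy : ∀ᵐ s ∂(betaLevy φ), s ∈ Set.Ioo (0 : ℝ) 1 :=
  (withDensity_absolutelyContinuous _ _).ae_le (ae_restrict_mem measurableSet_Ioo)

lemma lintegral_betaLevy {g : ℝ → ℝ≥0∞} (hg : Measurable g) :
    ∫⁻ s, g s ∂(betaLevy φ)
      = ∫⁻ s in Set.Ioo (0 : ℝ) 1, ENNReal.ofReal (s⁻¹ * (1 - s) ^ (φ - 1)) * g s := by
  rw [betaLevy, lintegral_withDensity_eq_lintegral_mul _ measurable_betaLevy_density hg]
  rfl

lemma lintegral_one_sub_rpow (hφ : 0 < φ) :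
    ∫⁻ s in Set.Ioo (0 : ℝ) 1, ENNReal.ofReal ((1 - s) ^ (φ - 1)) = ENNReal.ofReal (1 / φ) := by
  have h := lintegral_Ioo_of_hasDerivAt_of_nonneg (F := fun s => -((1 - s) ^ φ / φ))
    (F' := fun s => (1 - s) ^ (φ - 1)) zero_le_one ?_ ?_ ?_
  · rw [h]
    simp [hφ.ne']
  · refine ContinuousOn.neg (ContinuousOn.div_const (ContinuousOn.rpow_const (by fun_prop) ?_) _)
    exact fun _ _ => .inr hφ.le
  · intro s hs
    have h1 : HasDerivAt (fun s : ℝ => 1 - s) (-1) s := by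
      simpa using (hasDerivAt_id s).const_sub 1
    have h2 := (h1.rpow_const (p := φ) (.inl (by linarith [hs.2]))).div_const φ |>.neg
    refine h2.congr_deriv ?_
    field_simp
  · exact fun s hs => Real.rpow_nonneg (by linarith [hs.2]) _

/-- The inner transform is `(1 + a s)^(-φ)`, and its defect from `1` is the integral over `0 < b <
a` of `φ s (1 + b s)^(-φ-1)`. After exchanging the integrals, the jump integral equals `1 / (1 +
b)`, whose primitive is the logarithm. This is where the beta directing measure and gamma scores
combine into gamma processes. -/
lemma lintegral_betaLevy_one_sub (hφ : 0 < φ) (a : ℝ≥0) :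
    ∫⁻ s, (1 - ∫⁻ t, expNeg (ENNReal.ofReal (t * s) * a) ∂(gammaMeasure φ 1)) ∂(betaLevy φ)
      = ENNReal.ofReal (Real.log (1 + a)) := by
  have h1 : ∫⁻ s, (1 - ∫⁻ t, expNeg (ENNReal.ofReal (t * s) * a) ∂(gammaMeasure φ 1)) ∂(betaLevy φ)
      = ∫⁻ s, (∫⁻ b in Set.Ioo (0 : ℝ) a, ENNReal.ofReal (φ * s * (1 + b * s) ^ (-φ - 1)))
        ∂(betaLevy φ) := by
    refine lintegral_congr_ae ?_
    filter_upwards [ae_betaLevy] with s hs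
    have h2 := lintegral_scoreWeight hφ 0 a hs.1
    simp only [scoreWeight, scoreMass, pow_zero, one_mul, ascPochhammer_zero, Polynomial.eval_one,
      Nat.cast_zero, zero_add] at h2
    rw [h2, lintegral_Ioo_of_hasDerivAt_of_nonneg (F := fun b => -((1 + b * s) ^ (-φ)))
      (F' := fun b => φ * s * (1 + b * s) ^ (-φ - 1)) a.coe_nonneg]
    · rw [← ENNReal.ofReal_one, ← ENNReal.ofReal_sub _ (by have := hs.1; positivity)]
      congr 1
      have : (0 : ℝ) ≤ 1 + s * a := by have := hs.1; positivity
      simp only [zero_mul, add_zero, Real.one_rpow]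
      rw [mul_comm (a : ℝ) s, Real.rpow_neg this, one_div, add_comm (s * (a : ℝ))]
      ring
    · refine ContinuousOn.neg (ContinuousOn.rpow_const (by fun_prop) fun b hb => .inl ?_)
      have := mul_nonneg hb.1 hs.1.le
      positivity
    · intro b hb
      have h3 : HasDerivAt (fun b : ℝ => 1 + b * s) s b := by
        simpa using ((hasDerivAt_id b).mul_const s).const_add 1
      have := mul_nonneg hb.1.le hs.1.le
      refine (h3.rpow_const (p := -φ) (.inl (by positivity))).neg.congr_deriv ?_
      ring
    · intro b hb
      have := mul_nonneg hb.1.le hs.1.le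
      have := hs.1
      positivity
  rw [h1, lintegral_lintegral_swap (by fun_prop)]
  have h4 : ∀ b ∈ Set.Ioo (0 : ℝ) a,
      ∫⁻ s, ENNReal.ofReal (φ * s * (1 + b * s) ^ (-φ - 1)) ∂(betaLevy φ)
        = ENNReal.ofReal ((1 + b)⁻¹) := by
    intro b hb
    rw [lintegral_betaLevy (by fun_prop)]
    have hpos : ∀ s ∈ Set.Icc (0 : ℝ) 1, 0 < 1 + b * s := fun s hs => by
      have := mul_nonneg hb.1.le hs.1
      positivity
    have hb1 : 0 < 1 + b := by linarith [hb.1]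
    -- The derivative of `(1 - s) / (1 + b s)` is `-(1 + b) / (1 + b s)^2`, which explains the power
    -- `φ` of this quotient and the division by `1 + b`.
    have h5 := lintegral_Ioo_of_hasDerivAt_of_nonneg
      (F := fun s => -(((1 - s) / (1 + b * s)) ^ φ / (1 + b)))
      (F' := fun s => s⁻¹ * (1 - s) ^ (φ - 1) * (φ * s * (1 + b * s) ^ (-φ - 1)))
      zero_le_one ?_ ?_ ?_
    · have h6 : ENNReal.ofReal ((1 + b)⁻¹) = ENNReal.ofReal
          (-(((1 - 1) / (1 + b * 1)) ^ φ / (1 + b)) - -(((1 - 0) / (1 + b * 0)) ^ φ / (1 + b))) := by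
        congr 1
        simp [hφ.ne']
      rw [h6, ← h5]
      refine setLIntegral_congr_fun measurableSet_Ioo fun s hs => ?_
      have h1s : 0 < 1 - s := by linarith [hs.2]
      have := hs.1
      exact (ENNReal.ofReal_mul (by positivity)).symm
    · refine ContinuousOn.neg (ContinuousOn.div_const (ContinuousOn.rpow_const ?_ ?_) _)
      · exact ContinuousOn.div (by fun_prop) (by fun_prop) fun s hs => (hpos s hs).ne'
      · exact fun _ _ => .inr hφ.le
    · intro s hs
      have h1s : 0 < 1 - s := by linarith [hs.2]
      have hbs := hpos s ⟨hs.1.le, hs.2.le⟩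
      have h7 : HasDerivAt (fun s : ℝ => 1 - s) (-1) s := by
        simpa using (hasDerivAt_id s).const_sub 1
      have h8 : HasDerivAt (fun s : ℝ => 1 + b * s) b s := by
        simpa using ((hasDerivAt_id s).const_mul b).const_add 1
      have h9 := (((h7.div h8 hbs.ne').rpow_const (p := φ)
        (.inl (div_pos h1s hbs).ne')).div_const (1 + b)).neg
      refine h9.congr_deriv ?_
      simp only [Pi.div_apply]
      rw [Real.div_rpow h1s.le hbs.le, Real.rpow_sub_one hbs.ne' φ,
        Real.rpow_sub_one hbs.ne' (-φ), Real.rpow_neg hbs.le]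
      have := hs.1
      have hp : 0 < (1 + b * s) ^ φ := Real.rpow_pos_of_pos hbs _
      field_simp
      ring
    · intro s hs
      have h1s : 0 < 1 - s := by linarith [hs.2]
      have hbs := hpos s ⟨hs.1.le, hs.2.le⟩
      have := hs.1
      positivity
  rw [setLIntegral_congr_fun measurableSet_Ioo h4,
    lintegral_Ioo_of_hasDerivAt_of_nonneg (F := fun b => Real.log (1 + b))
      (F' := fun b => (1 + b)⁻¹) a.coe_nonneg]
  · simp
  · exact ContinuousOn.log (by fun_prop) fun b hb => by linarith [hb.1]
  · intro b hb
    have h3 : HasDerivAt (fun b : ℝ => 1 + b) 1 b := by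
      simpa using (hasDerivAt_id b).const_add 1
    simpa using h3.log (by linarith [hb.1])
  · exact fun b hb => by have := hb.1; positivity

end BetaLevy


/-! ### Monotone dyadic difference quotients, replacing differentiation under the integral -/

section DiffQuotient

/-- The difference quotients `2ⁿ (1 - exp (-x / 2ⁿ))`, which increase to `x`. -/
def expQuot (n : ℕ) (x : ℝ≥0∞) : ℝ≥0∞ := 2 ^ n * (1 - expNeg (x * (2 ^ n)⁻¹))

@[fun_prop]
lemma measurable_expQuot (n : ℕ) : Measurable (expQuot n) := by
  unfold expQuot
  fun_prop

lemma two_pow_mul_inv_cancel (n : ℕ) : (2 : ℝ≥0∞) ^ n * (2 ^ n)⁻¹ = 1 :=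
  ENNReal.mul_inv_cancel (by simp) (by simp)

lemma expQuot_le (n : ℕ) (x : ℝ≥0∞) : expQuot n x ≤ x := by
  calc expQuot n x ≤ 2 ^ n * (x * (2 ^ n)⁻¹) := by
        unfold expQuot; gcongr; exact one_sub_expNeg_le _
    _ = x := by rw [mul_left_comm, two_pow_mul_inv_cancel, mul_one]

/-- Halving the step relates consecutive quotients: with `y = exp (-x / 2^(n+1))` the claim is `1 -
y^2 ≤ 2 (1 - y)`. Monotone convergence then needs no integrability. -/
lemma monotone_expQuot_left (x : ℝ≥0∞) : Monotone fun n => expQuot n x := by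
  refine monotone_nat_of_le_succ fun n => ?_
  have h : x * (2 ^ n)⁻¹ = x * (2 ^ (n + 1))⁻¹ + x * (2 ^ (n + 1))⁻¹ := by
    rw [pow_succ, ENNReal.mul_inv (by simp) (by simp), ← mul_assoc, ← mul_add,
      ENNReal.inv_two_add_inv_two, mul_one]
  obtain ⟨y, hy⟩ : ∃ y, y = expNeg (x * (2 ^ (n + 1))⁻¹) := ⟨_, rfl⟩
  have hy1 : y ≤ 1 := hy ▸ expNeg_le_one _
  simp only [expQuot]
  rw [h, expNeg_add, ← hy, pow_succ, mul_assoc]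
  gcongr
  rw [tsub_le_iff_right, two_mul]
  -- This expands `1 = (1 - y) + y (1 - y) + y^2`, avoiding a factorization with truncated
  -- subtraction.
  calc (1 : ℝ≥0∞) = (1 - y) + y * 1 := by rw [mul_one, tsub_add_cancel_of_le hy1]
    _ = (1 - y) + y * ((1 - y) + y) := by rw [tsub_add_cancel_of_le hy1]
    _ = (1 - y) + y * (1 - y) + y * y := by ring
    _ ≤ (1 - y) + 1 * (1 - y) + y * y := by gcongr
    _ = _ := by rw [one_mul]

lemma continuous_expQuot (n : ℕ) : Continuous (expQuot n) := by
  refine ENNReal.continuous_const_mul (by simp) |>.comp ?_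
  refine (ENNReal.continuous_sub_left ENNReal.one_ne_top).comp ?_
  exact continuous_expNeg.comp (ENNReal.continuous_mul_const (by simp))

/-- At `∞` the quotient is `2^n`; at a finite point it is the slope at `0` of `y ↦ -exp (-x y)`. -/
lemma tendsto_expQuot (x : ℝ≥0∞) : Tendsto (fun n => expQuot n x) atTop (𝓝 x) := by
  induction x with
  | top =>
    have : ∀ n, expQuot n ∞ = 2 ^ n := fun n => by simp [expQuot, ENNReal.top_mul]
    simp_rw [this]
    exact ENNReal.tendsto_pow_atTop_nhds_top_iff.2 (by norm_num)
  | coe x =>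
    have h1 : HasDerivAt (fun y : ℝ => -Real.exp (-(x * y))) x 0 := by
      have h2 : HasDerivAt (fun y : ℝ => x * y) (x : ℝ) 0 := by
        simpa using (hasDerivAt_id (0 : ℝ)).const_mul (x : ℝ)
      refine h2.neg.exp.neg.congr_deriv ?_
      simp
    have h3 := h1.tendsto_slope_zero_right.comp (x := atTop) (f := fun n : ℕ => (2 ^ n : ℝ)⁻¹)
      (tendsto_nhdsWithin_iff.2 ⟨?_, .of_forall fun n => ?_⟩)
    · have h4 := (ENNReal.continuous_ofReal.tendsto _).comp h3
      rw [ENNReal.ofReal_coe_nnreal] at h4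
      refine h4.congr fun n => ?_
      have h5 : (x : ℝ≥0∞) * (2 ^ n)⁻¹ = ENNReal.ofReal (x * (2 ^ n)⁻¹) := by
        rw [ENNReal.ofReal_mul x.coe_nonneg, ENNReal.ofReal_coe_nnreal,
          ENNReal.ofReal_inv_of_pos (by positivity), ENNReal.ofReal_pow (by norm_num)]
        simp
      have h6 : (2 : ℝ≥0∞) ^ n = ENNReal.ofReal (2 ^ n) := by
        rw [ENNReal.ofReal_pow (by norm_num)]; simp
      rw [expQuot, h5, expNeg_ofReal (by positivity), ← ENNReal.ofReal_one,
        ← ENNReal.ofReal_sub _ (Real.exp_pos _).le, h6, ← ENNReal.ofReal_mul (by positivity)]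
      simp only [Function.comp_apply, zero_add, mul_zero, neg_zero, Real.exp_zero, smul_eq_mul,
        inv_inv]
      congr 1
      ring
    · exact (tendsto_pow_atTop_atTop_of_one_lt (by norm_num : (1 : ℝ) < 2)).inv_tendsto_atTop
    · simp

lemma iSup_expQuot (x : ℝ≥0∞) : ⨆ n, expQuot n x = x :=
  iSup_eq_of_tendsto (monotone_expQuot_left x) (tendsto_expQuot x)

/-- For fixed `k`, continuity passes to the limit in `D n`, and monotonicity replaces the index `k`
by any `n ≥ k`. It is needed because the increments of the Laplace exponent themselves depend on the
step. -/
lemma iSup_expQuot_diag {D : ℕ → ℝ≥0∞} (hD : Monotone D) :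
    ⨆ n, expQuot n (D n) = ⨆ n, D n := by
  refine le_antisymm (iSup_mono fun n => expQuot_le _ _) ?_
  rw [← iSup_expQuot (⨆ n, D n)]
  refine iSup_le fun k => ?_
  refine le_of_tendsto (((continuous_expQuot k).tendsto _).comp (tendsto_atTop_iSup hD)) ?_
  filter_upwards [eventually_ge_atTop k] with n hn
  exact (monotone_expQuot_left (D n) hn).trans (le_iSup (fun n => expQuot n (D n)) n)

end DiffQuotient

/-! ### Masses of the jump weights -/

section

variable {φ : ℝ} {d : ℕ}

/-- The mass of the jump weights `∏ j, (t j * s) ^ c j * exp (-a j * t j * s)` under the intensity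
of the jumps and scores. -/
def jumpMass (φ : ℝ) (c : Fin d → ℕ) (a : Fin d → ℝ≥0) : ℝ≥0∞ :=
  ∫⁻ s, ∏ j, (∫⁻ t, scoreWeight (c j) (a j) s t ∂(gammaMeasure φ 1)) ∂(betaLevy φ)

instance [hφ : Fact (0 < φ)] : IsProbabilityMeasure (gammaMeasure φ 1) :=
  isProbabilityMeasure_gammaMeasure hφ.out one_pos

variable [hφ : Fact (0 < φ)]

lemma measurable_lintegral_scoreWeight (c : ℕ) :
    Measurable fun y : ℝ≥0 × ℝ => ∫⁻ t, scoreWeight c y.1 y.2 t ∂(gammaMeasure φ 1) :=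
  Measurable.lintegral_prod_right' (f := fun z : (ℝ≥0 × ℝ) × ℝ => scoreWeight c z.1.1 z.1.2 z.2)
    ((measurable_scoreWeight c).comp (f := fun z : (ℝ≥0 × ℝ) × ℝ => (z.1.1, z.1.2, z.2))
      (by fun_prop))

lemma measurable_prod_lintegral_scoreWeight (c : Fin d → ℕ) :
    Measurable fun y : (Fin d → ℝ≥0) × ℝ =>
      ∏ j, ∫⁻ t, scoreWeight (c j) (y.1 j) y.2 t ∂(gammaMeasure φ 1) :=
  Finset.measurable_prod _ fun j _ =>
    (measurable_lintegral_scoreWeight (c j)).comp (f := fun y : (Fin d → ℝ≥0) × ℝ => (y.1 j, y.2))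
      (by fun_prop)

lemma measurable_jumpMass (c : Fin d → ℕ) : Measurable fun a => jumpMass φ c a :=
  (measurable_prod_lintegral_scoreWeight c).lintegral_prod_right'

/-- The weight of a fixed jump is the mass of its score weights. -/
lemma fixedJumpWeight_eq (c : Fin d → ℕ) (a : Fin d → ℝ≥0) :
    fixedJumpWeight φ (fun j => a j) c = (betaLevy φ).withDensity
      fun s => ∏ j, ∫⁻ t, scoreWeight (c j) (a j) s t ∂(gammaMeasure φ 1) := by
  have hm : Measurable fun s => ∏ j, ∫⁻ t, scoreWeight (c j) (a j) s t ∂(gammaMeasure φ 1) :=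
    (measurable_prod_lintegral_scoreWeight c).comp (f := fun s => (a, s)) (by fun_prop)
  rw [fixedJumpWeight, betaLevy, ← withDensity_mul _ measurable_betaLevy_density hm]
  refine withDensity_congr_ae ?_
  filter_upwards [ae_restrict_mem measurableSet_Ioo] with s hs
  have hs0 := hs.1
  have hs1 : 0 < 1 - s := by linarith [hs.2]
  simp_rw [Pi.mul_apply, lintegral_scoreWeight hφ.out _ _ hs0]
  rw [← ENNReal.ofReal_prod_of_nonneg fun j _ => (scoreMass_pos hφ.out _ _ hs0).le,
    ← ENNReal.ofReal_mul (by positivity)]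
  congr 1
  simp only [scoreMass]
  rw [Finset.prod_mul_distrib, Finset.prod_pow_eq_pow_sum, Real.rpow_sub_one hs0.ne',
    Real.rpow_natCast]
  ring

lemma fixedJumpWeight_univ (c : Fin d → ℕ) (a : Fin d → ℝ≥0) :
    fixedJumpWeight φ (fun j => a j) c Set.univ = jumpMass φ c a := by
  rw [fixedJumpWeight_eq, withDensity_apply _ MeasurableSet.univ, setLIntegral_univ, jumpMass]

/-- One observation suffices to cancel the singularity `s⁻¹`; what remains is bounded by a constant
times `(1 - s) ^ (φ - 1)`. For zero counts the mass is infinite, hence the hypothesis. -/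
lemma jumpMass_ne_top {c : Fin d → ℕ} (hc : c ≠ 0) (a : Fin d → ℝ≥0) : jumpMass φ c a ≠ ∞ := by
  have hφ := hφ.out
  rw [← fixedJumpWeight_univ, fixedJumpWeight, withDensity_apply _ MeasurableSet.univ,
    setLIntegral_univ]
  have hC : 0 ≤ ∏ j, (ascPochhammer ℝ (c j)).eval φ :=
    Finset.prod_nonneg fun j _ => (ascPochhammer_pos _ _ hφ).le
  have hsum : (1 : ℝ) ≤ ((∑ j, c j : ℕ) : ℝ) := by
    obtain ⟨j, hj⟩ := Function.ne_iff.1 hc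
    have h1 : c j ≤ ∑ j, c j := Finset.single_le_sum (fun _ _ => Nat.zero_le _) (Finset.mem_univ j)
    have h2 : 1 ≤ c j := Nat.one_le_iff_ne_zero.2 hj
    exact_mod_cast h2.trans h1
  refine ne_top_of_le_ne_top (b := ENNReal.ofReal (∏ j, (ascPochhammer ℝ (c j)).eval φ) *
    ENNReal.ofReal (1 / φ)) (by simp [ENNReal.mul_eq_top]) ?_
  rw [← lintegral_one_sub_rpow hφ, ← lintegral_const_mul _ (by fun_prop)]
  refine setLIntegral_mono (by fun_prop) fun s hs => ?_
  rw [← ENNReal.ofReal_mul hC]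
  refine ENNReal.ofReal_le_ofReal ?_
  have hs0 := hs.1
  have hs1 : 0 < 1 - s := by linarith [hs.2]
  rw [mul_comm]
  refine mul_le_mul (Finset.prod_le_prod (fun j _ => ?_) fun j _ => ?_) ?_ (by positivity) hC
  · have := ascPochhammer_pos (c j) φ hφ
    positivity
  · refine div_le_self (ascPochhammer_pos _ _ hφ).le (Real.one_le_rpow ?_ (by positivity))
    have : 0 ≤ s * a j := by positivity
    linarith
  · refine mul_le_of_le_one_left (by positivity) ?_
    exact Real.rpow_le_one hs0.le hs.2.le (by linarith)

lemma jumpMass_ne_zero (c : Fin d → ℕ) (a : Fin d → ℝ≥0) : jumpMass φ c a ≠ 0 := by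
  have hφ := hφ.out
  rw [← fixedJumpWeight_univ, fixedJumpWeight, withDensity_apply _ MeasurableSet.univ,
    setLIntegral_univ]
  refine (setLIntegral_pos_iff (by fun_prop) |>.2 ?_).ne'
  have hsub : Set.Ioo (0 : ℝ) 1 ⊆ Function.support (fun s => ENNReal.ofReal
      (s ^ (((∑ j, c j : ℕ) : ℝ) - 1) * (1 - s) ^ (φ - 1) *
      ∏ j, (ascPochhammer ℝ (c j)).eval φ / (s * a j + 1) ^ ((c j : ℝ) + φ))) := by
    intro s hs
    have hs0 := hs.1
    have hs1 : 0 < 1 - s := by linarith [hs.2]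
    have h1 : 0 < ∏ j, (ascPochhammer ℝ (c j)).eval φ / (s * a j + 1) ^ ((c j : ℝ) + φ) :=
      Finset.prod_pos fun j _ => by
        have := ascPochhammer_pos (c j) φ hφ
        positivity
    rw [Function.mem_support, ne_eq, ENNReal.ofReal_eq_zero, not_le]
    positivity
  rw [Set.inter_eq_self_of_subset_right hsub]
  simp

end

/-! ### The Laplace functional of the vector and its Campbell formula -/

section LaplaceFunctional

attribute [local irreducible] expNeg scoreWeight expQuot

variable {X : Type u} [MeasurableSpace X] {Ω : Type v} [MeasurableSpace Ω] {P : Measure Ω}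
  [IsProbabilityMeasure P] {α : Measure X} [IsFiniteMeasure α] {φ : ℝ} [hφ : Fact (0 < φ)]
  {d : ℕ} {J : ℕ → Ω → ℝ} {x : ℕ → Ω → X} {m : ℕ × Fin d → Ω → ℝ}

/-- The Laplace exponent of a vector of compound random measures. -/
def lapExponent (φ : ℝ) (α : Measure X) (f : Fin d → X → ℝ≥0) : ℝ≥0∞ :=
  ∫⁻ p : ℝ × X, (1 - ∏ j, ∫⁻ t, scoreWeight 0 (f j p.2) p.1 t ∂(gammaMeasure φ 1))
    ∂((betaLevy φ).prod α)

lemma IsCompoundRep.lintegral_expNeg_points_pairing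
    (h : IsCompoundRep P (betaLevy φ) α (fun _ _ => gammaMeasure φ 1) J x m)
    {g : ℝ × X → ℝ≥0∞} (hg : Measurable g)
    {f : Fin d → X → ℝ≥0} (hf : ∀ j, Measurable (f j)) :
    ∫⁻ ω, expNeg (∑' i, g (J i ω, x i ω)) *
        expNeg (pairing (fun j y => f j y) fun j => compoundMeasure J x m j ω) ∂P
      = expNeg (∫⁻ p : ℝ × X, (1 - expNeg (g p) *
          ∏ j, ∫⁻ t, scoreWeight 0 (f j p.2) p.1 t ∂(gammaMeasure φ 1))
        ∂((betaLevy φ).prod α)) := by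
  have h1 := h.lintegral_expNeg_marked hg
    (g := fun j p t => ENNReal.ofReal (t * p.1) * f j p.2) (fun j => by
      have := hf j
      unfold Function.uncurry
      fun_prop)
  simp only [scoreWeight, pow_zero, one_mul]
  rw [← h1]
  refine lintegral_congr fun ω => ?_
  rw [pairing_compoundMeasure fun j => (hf j).coe_nnreal_ennreal]

/-- The Laplace functional of a vector of compound random measures. -/
lemma IsCompoundRep.lintegral_expNeg_pairing
    (h : IsCompoundRep P (betaLevy φ) α (fun _ _ => gammaMeasure φ 1) J x m)
    {f : Fin d → X → ℝ≥0} (hf : ∀ j, Measurable (f j)) :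
    ∫⁻ ω, expNeg (pairing (fun j y => f j y) fun j => compoundMeasure J x m j ω) ∂P
      = expNeg (lapExponent φ α f) := by
  simpa [lapExponent] using h.lintegral_expNeg_points_pairing (g := 0) measurable_zero hf

lemma lintegral_scoreWeight_zero_le_one (a : ℝ≥0) (s : ℝ) :
    ∫⁻ t, scoreWeight 0 a s t ∂(gammaMeasure φ 1) ≤ 1 :=
  (lintegral_mono fun t => by simpa [scoreWeight] using expNeg_le_one _).trans (by simp)

/-- Perturbing the test function of group `j` on `B` is the direction of differentiation that brings
down the factor `M j B`. -/
lemma pairing_add_single {f : Fin d → X → ℝ≥0} (hf : ∀ j, Measurable (f j)) (j : Fin d)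
    {B : Set X} (hB : MeasurableSet B) (ε : ℝ≥0) (M : Fin d → Measure X) :
    pairing (fun i y => ((f i y + if i = j then B.indicator (fun _ => ε) y else 0 : ℝ≥0) : ℝ≥0∞)) M
      = pairing (fun i y => f i y) M + ε * M j B := by
  have h1 : ∀ i, ∫⁻ y, ((f i y + if i = j then B.indicator (fun _ => ε) y else 0 : ℝ≥0) : ℝ≥0∞)
      ∂(M i) = ∫⁻ y, f i y ∂(M i) + if i = j then ε * M j B else 0 := by
    intro i
    split_ifs with hij
    · subst hij
      simp_rw [ENNReal.coe_add]
      rw [lintegral_add_left (hf i).coe_nnreal_ennreal, ← lintegral_indicator_const hB]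
      congr 2 with y
      by_cases hy : y ∈ B <;> simp [hy]
    · simp
  simp only [pairing, h1, Finset.sum_add_distrib]
  simp

/-- The difference quotient of `1 - ∏ i, E[exp (-a i * t * s)]` in the direction `j`. -/
def lapQuot (φ : ℝ) (j : Fin d) (n : ℕ) (a : Fin d → ℝ≥0) (s : ℝ) : ℝ≥0∞ :=
  (∫⁻ t, scoreWeight 0 (a j) s t * expQuot n (ENNReal.ofReal (t * s)) ∂(gammaMeasure φ 1)) *
    ∏ i ∈ Finset.univ.erase j, ∫⁻ t, scoreWeight 0 (a i) s t ∂(gammaMeasure φ 1)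

lemma measurable_scoreWeight_mul_expQuot (n : ℕ) :
    Measurable fun z : (ℝ≥0 × ℝ) × ℝ =>
      scoreWeight 0 z.1.1 z.1.2 z.2 * expQuot n (ENNReal.ofReal (z.2 * z.1.2)) :=
  ((measurable_scoreWeight 0).comp (f := fun z : (ℝ≥0 × ℝ) × ℝ => (z.1.1, z.1.2, z.2))
    (by fun_prop)).mul (by fun_prop)

lemma measurable_lapQuot (j : Fin d) (n : ℕ) :
    Measurable fun y : (Fin d → ℝ≥0) × ℝ => lapQuot φ j n y.1 y.2 := by
  refine Measurable.mul ?_ (Finset.measurable_prod _ fun i _ => ?_)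
  · exact (measurable_scoreWeight_mul_expQuot n).lintegral_prod_right'.comp
      (f := fun y : (Fin d → ℝ≥0) × ℝ => (y.1 j, y.2)) (by fun_prop)
  · exact (measurable_lintegral_scoreWeight 0).comp
      (f := fun y : (Fin d → ℝ≥0) × ℝ => (y.1 i, y.2)) (by fun_prop)

lemma measurable_scoreWeight_right (a : ℝ≥0) (s : ℝ) :
    Measurable fun t => scoreWeight 0 a s t :=
  (measurable_scoreWeight 0).comp (f := fun t => (a, s, t)) (by fun_prop)

lemma measurable_scoreWeight_mul_expQuot_right (n : ℕ) (a : ℝ≥0) (s : ℝ) :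
    Measurable fun t => scoreWeight 0 a s t * expQuot n (ENNReal.ofReal (t * s)) :=
  (measurable_scoreWeight_right a s).mul (by fun_prop)

lemma monotone_lapQuot (j : Fin d) (a : Fin d → ℝ≥0) (s : ℝ) :
    Monotone fun n => lapQuot φ j n a s := fun n k hnk => by
  simp only [lapQuot]
  gcongr
  exact monotone_expQuot_left _ hnk

/-- In the limit the quotient brings down a factor `t s` in group `j`, that is, one observation of
that group; the other groups are unaffected. -/
lemma iSup_lapQuot (j : Fin d) (a : Fin d → ℝ≥0) (s : ℝ) :
    ⨆ n, lapQuot φ j n a s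
      = ∏ i, ∫⁻ t, scoreWeight ((Pi.single j 1 : Fin d → ℕ) i) (a i) s t ∂(gammaMeasure φ 1) := by
  simp only [lapQuot]
  rw [← ENNReal.iSup_mul, ← Finset.mul_prod_erase _ _ (Finset.mem_univ j)]
  congr 1
  · refine (lintegral_iSup (fun n => measurable_scoreWeight_mul_expQuot_right n (a j) s)
      ?_).symm.trans ?_
    · intro n k hnk t
      simp only
      gcongr
      exact monotone_expQuot_left _ hnk
    · refine lintegral_congr fun t => ?_
      rw [← ENNReal.mul_iSup, iSup_expQuot, Pi.single_eq_same, ← zero_add 1, scoreWeight_succ,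
        mul_comm]
  · refine Finset.prod_congr rfl fun i hi => ?_
    rw [Pi.single_eq_of_ne (Finset.ne_of_mem_erase hi)]

/-- Only the `j`-th factor moves, and with step `ε = 2^(-n)` one has `e^(-a y) = e^(-(a + ε) y) + ε
e^(-a y) expQuot n y` exactly. No error term appears. -/
lemma one_sub_prod_add_single (j : Fin d) (n : ℕ) (a : Fin d → ℝ≥0) (s : ℝ) :
    1 - ∏ i, ∫⁻ t, scoreWeight 0 (a i + if i = j then (2 ^ n)⁻¹ else 0) s t ∂(gammaMeasure φ 1)
      = (1 - ∏ i, ∫⁻ t, scoreWeight 0 (a i) s t ∂(gammaMeasure φ 1))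
        + (2 ^ n)⁻¹ * lapQuot φ j n a s := by
  obtain ⟨a', ha'⟩ : ∃ a' : Fin d → ℝ≥0, a' = fun i => a i + if i = j then (2 ^ n)⁻¹ else 0 :=
    ⟨_, rfl⟩
  have h0 : ∀ i, a i + (if i = j then (2 ^ n)⁻¹ else 0) = a' i := fun i => by rw [ha']
  simp_rw [h0]
  have h1 : ∀ i ∈ Finset.univ.erase j, ∫⁻ t, scoreWeight 0 (a' i) s t ∂(gammaMeasure φ 1)
      = ∫⁻ t, scoreWeight 0 (a i) s t ∂(gammaMeasure φ 1) := by
    intro i hi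
    simp [ha', Finset.ne_of_mem_erase hi]
  have h2 : ∫⁻ t, scoreWeight 0 (a j) s t ∂(gammaMeasure φ 1)
      = ∫⁻ t, scoreWeight 0 (a' j) s t ∂(gammaMeasure φ 1) + (2 ^ n)⁻¹ *
      ∫⁻ t, scoreWeight 0 (a j) s t * expQuot n (ENNReal.ofReal (t * s)) ∂(gammaMeasure φ 1) := by
    have hfj : a' j = a j + (2 ^ n)⁻¹ := by simp [ha']
    have hmj := measurable_scoreWeight_right (a' j) s
    have hmq := measurable_scoreWeight_mul_expQuot_right n (a j) s
    have hε : (((2 ^ n)⁻¹ : ℝ≥0) : ℝ≥0∞) = (2 ^ n)⁻¹ := by simp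
    rw [← lintegral_const_mul _ hmq, ← lintegral_add_left hmj]
    refine lintegral_congr fun t => ?_
    rw [hfj, scoreWeight_add, hε, expQuot, mul_left_comm _ (2 ^ n), ← mul_assoc (2 ^ n)⁻¹,
      mul_comm _ (2 ^ n), two_pow_mul_inv_cancel, one_mul, ← mul_add,
      add_tsub_cancel_of_le (expNeg_le_one _), mul_one]
  have h3 : ∏ i, ∫⁻ t, scoreWeight 0 (a i) s t ∂(gammaMeasure φ 1)
      = ∏ i, ∫⁻ t, scoreWeight 0 (a' i) s t ∂(gammaMeasure φ 1)
        + (2 ^ n)⁻¹ * lapQuot φ j n a s := by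
    rw [← Finset.mul_prod_erase _ _ (Finset.mem_univ j),
      ← Finset.mul_prod_erase _ (fun i => ∫⁻ t, scoreWeight 0 (a' i) s t ∂(gammaMeasure φ 1))
        (Finset.mem_univ j), Finset.prod_congr rfl h1, h2, lapQuot]
    ring
  have hle : ∀ b : Fin d → ℝ≥0, ∏ i, ∫⁻ t, scoreWeight 0 (b i) s t ∂(gammaMeasure φ 1) ≤ 1 :=
    fun b => Finset.prod_le_one' fun i _ => lintegral_scoreWeight_zero_le_one _ _
  refine ENNReal.sub_eq_of_eq_add ((hle a').trans_lt ENNReal.one_lt_top).ne ?_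
  rw [add_assoc, add_comm (_ * _), ← h3, tsub_add_cancel_of_le (hle a)]

lemma lapExponent_add_single {f : Fin d → X → ℝ≥0} (hf : ∀ j, Measurable (f j)) (j : Fin d)
    {B : Set X} (hB : MeasurableSet B) (n : ℕ) :
    lapExponent φ α
        (fun i y => f i y + if i = j then B.indicator (fun _ => (2 ^ n)⁻¹) y else 0)
      = lapExponent φ α f + (∫⁻ p in {p : ℝ × X | p.2 ∈ B}, lapQuot φ j n (fun i => f i p.2) p.1
          ∂((betaLevy φ).prod α)) * (2 ^ n)⁻¹ := by
  have hBp : MeasurableSet {p : ℝ × X | p.2 ∈ B} := measurable_snd hB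
  have hfm : Measurable fun p : ℝ × X => ((fun i => f i p.2), p.1) :=
    (measurable_pi_lambda _ fun i => (hf i).comp measurable_snd).prodMk measurable_fst
  have hpt : ∀ p : ℝ × X, (1 - ∏ i, ∫⁻ t, scoreWeight 0
      (f i p.2 + if i = j then B.indicator (fun _ => (2 ^ n)⁻¹) p.2 else 0) p.1 t
        ∂(gammaMeasure φ 1))
      = (1 - ∏ i, ∫⁻ t, scoreWeight 0 (f i p.2) p.1 t ∂(gammaMeasure φ 1)) +
        (2 ^ n)⁻¹ * {p : ℝ × X | p.2 ∈ B}.indicator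
          (fun p => lapQuot φ j n (fun i => f i p.2) p.1) p := by
    intro p
    by_cases hp : p.2 ∈ B
    · have hp' : p ∈ {p : ℝ × X | p.2 ∈ B} := hp
      simp_rw [Set.indicator_of_mem hp', Set.indicator_of_mem hp]
      exact one_sub_prod_add_single j n _ _
    · have hp' : p ∉ {p : ℝ × X | p.2 ∈ B} := hp
      simp_rw [Set.indicator_of_notMem hp', Set.indicator_of_notMem hp]
      simp
  have hmf : Measurable fun p : ℝ × X =>
      1 - ∏ i, ∫⁻ t, scoreWeight 0 (f i p.2) p.1 t ∂(gammaMeasure φ 1) :=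
    ((measurable_prod_lintegral_scoreWeight fun _ => 0).comp hfm).const_sub 1
  have hmq : Measurable fun p : ℝ × X => lapQuot φ j n (fun i => f i p.2) p.1 :=
    (measurable_lapQuot j n).comp hfm
  simp only [lapExponent]
  simp_rw [hpt]
  rw [lintegral_add_left hmf, lintegral_const_mul _ (hmq.indicator hBp),
    lintegral_indicator hBp, mul_comm]

/-- The Laplace functional is subtracted at two test functions differing by the step. Since the
exponent changes by an exact multiple of the step, the right side is again of the form `expQuot`. -/
lemma IsCompoundRep.lintegral_expNeg_pairing_mul_expQuot
    (h : IsCompoundRep P (betaLevy φ) α (fun _ _ => gammaMeasure φ 1) J x m)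
    {f : Fin d → X → ℝ≥0} (hf : ∀ j, Measurable (f j)) (j : Fin d) {B : Set X}
    (hB : MeasurableSet B) (n : ℕ) :
    ∫⁻ ω, expNeg (pairing (fun j y => f j y) fun j => compoundMeasure J x m j ω) *
        expQuot n (compoundMeasure J x m j ω B) ∂P
      = expNeg (lapExponent φ α f) * expQuot n (∫⁻ p in {p : ℝ × X | p.2 ∈ B},
          lapQuot φ j n (fun i => f i p.2) p.1 ∂((betaLevy φ).prod α)) := by
  let fn : Fin d → X → ℝ≥0 := fun i y =>
    f i y + if i = j then B.indicator (fun _ => (2 ^ n)⁻¹) y else 0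
  have hfn : ∀ i, Measurable (fn i) := fun i => by
    refine (hf i).add ?_
    split_ifs
    · exact measurable_const.indicator hB
    · exact measurable_const
  have h1 := h.lintegral_expNeg_pairing hfn
  have h0 := h.lintegral_expNeg_pairing hf
  have h2 : ∀ ω, expNeg (pairing (fun i y => (fn i y : ℝ≥0∞))
        fun j => compoundMeasure J x m j ω)
      = expNeg (pairing (fun i y => (f i y : ℝ≥0∞)) fun j => compoundMeasure J x m j ω) *
        expNeg (compoundMeasure J x m j ω B * (2 ^ n)⁻¹) := by
    intro ω
    have hε : (((2 ^ n)⁻¹ : ℝ≥0) : ℝ≥0∞) = (2 ^ n)⁻¹ := by simp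
    rw [pairing_add_single hf j hB, expNeg_add, hε, mul_comm _ (compoundMeasure J x m j ω B)]
  have h3 : ∀ ω, expNeg (pairing (fun i y => (f i y : ℝ≥0∞))
        fun j => compoundMeasure J x m j ω) * expQuot n (compoundMeasure J x m j ω B)
      = 2 ^ n * (expNeg (pairing (fun i y => (f i y : ℝ≥0∞)) fun j => compoundMeasure J x m j ω)
        - expNeg (pairing (fun i y => (fn i y : ℝ≥0∞)) fun j => compoundMeasure J x m j ω)) := by
    intro ω
    rw [h2, expQuot, mul_left_comm, ENNReal.mul_sub (fun _ _ => expNeg_ne_top _), mul_one]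
  have hpair : ∀ g : Fin d → X → ℝ≥0, (∀ j, Measurable (g j)) → Measurable fun ω =>
      expNeg (pairing (fun j y => (g j y : ℝ≥0∞)) fun j => compoundMeasure J x m j ω) :=
    fun g hg => measurable_expNeg.comp
      ((measurable_pairing fun j => (hg j).coe_nnreal_ennreal).comp h.measurable_vec)
  simp_rw [h3]
  refine (lintegral_const_mul _ ((hpair f hf).sub (hpair fn hfn))).trans ?_
  simp only [Pi.sub_apply]
  rw [lintegral_sub (hpair fn hfn)]
  · rw [h0, h1, lapExponent_add_single hf j hB, expNeg_add, expQuot, mul_left_comm,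
      ENNReal.mul_sub (fun _ _ => expNeg_ne_top _), mul_one]
  · rw [h1]; exact expNeg_ne_top _
  · refine ae_of_all _ fun ω => ?_
    beta_reduce
    rw [h2]
    exact mul_le_of_le_one_right' (expNeg_le_one _)

/-- The Campbell formula for the exponential functionals of a vector of compound random
measures. -/
lemma IsCompoundRep.lintegral_apply_mul_expNeg_pairing
    (h : IsCompoundRep P (betaLevy φ) α (fun _ _ => gammaMeasure φ 1) J x m)
    {f : Fin d → X → ℝ≥0} (hf : ∀ j, Measurable (f j)) (j : Fin d) {B : Set X}
    (hB : MeasurableSet B) :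
    ∫⁻ ω, compoundMeasure J x m j ω B *
        expNeg (pairing (fun j y => f j y) fun j => compoundMeasure J x m j ω) ∂P
      = expNeg (lapExponent φ α f) * ∫⁻ y in B, jumpMass φ (Pi.single j 1) (fun i => f i y) ∂α := by
  have hμB : Measurable fun ω => compoundMeasure J x m j ω B :=
    (Measure.measurable_coe hB).comp ((measurable_pi_apply j).comp h.measurable_vec)
  have hpair : Measurable fun ω =>
      expNeg (pairing (fun j y => (f j y : ℝ≥0∞)) fun j => compoundMeasure J x m j ω) :=
    measurable_expNeg.comp
      ((measurable_pairing fun j => (hf j).coe_nnreal_ennreal).comp h.measurable_vec)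
  have hfm : Measurable fun p : ℝ × X => ((fun i => f i p.2), p.1) :=
    (measurable_pi_lambda _ fun i => (hf i).comp measurable_snd).prodMk measurable_fst
  have hmq : ∀ n, Measurable fun p : ℝ × X => lapQuot φ j n (fun i => f i p.2) p.1 := fun n =>
    (measurable_lapQuot j n).comp hfm
  have hL : ∫⁻ ω, compoundMeasure J x m j ω B *
        expNeg (pairing (fun j y => f j y) fun j => compoundMeasure J x m j ω) ∂P
      = ⨆ n, ∫⁻ ω, expNeg (pairing (fun j y => f j y) fun j => compoundMeasure J x m j ω) *
        expQuot n (compoundMeasure J x m j ω B) ∂P := by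
    rw [← lintegral_iSup]
    · refine lintegral_congr fun ω => ?_
      rw [← ENNReal.mul_iSup, iSup_expQuot, mul_comm]
    · exact fun n => hpair.mul ((measurable_expQuot n).comp hμB)
    · intro n k hnk ω
      simp only
      gcongr
      exact monotone_expQuot_left _ hnk
  rw [hL]
  simp_rw [h.lintegral_expNeg_pairing_mul_expQuot hf j hB]
  have hmono : Monotone fun n (p : ℝ × X) => lapQuot φ j n (fun i => f i p.2) p.1 :=
    fun n k hnk p => monotone_lapQuot j _ _ hnk
  have hmono' : Monotone fun n => ∫⁻ p in {p : ℝ × X | p.2 ∈ B},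
      lapQuot φ j n (fun i => f i p.2) p.1 ∂((betaLevy φ).prod α) :=
    fun n k hnk => lintegral_mono (hmono hnk)
  -- The step occurs on the right both in `expQuot` and in its argument, so the diagonal limit is
  -- used.
  rw [← ENNReal.mul_iSup, iSup_expQuot_diag hmono', ← lintegral_iSup hmq hmono]
  simp_rw [iSup_lapQuot]
  have hset : {p : ℝ × X | p.2 ∈ B} = Set.univ ×ˢ B := by ext; simp
  rw [hset, ← Measure.prod_restrict, Measure.restrict_univ, lintegral_prod_symm']
  · rfl
  · exact (measurable_prod_lintegral_scoreWeight _).comp hfm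

end LaplaceFunctional


lemma ae_eq_zero_of_lintegral_expNeg {Ω : Type*} [MeasurableSpace Ω] {P : Measure Ω}
    [IsProbabilityMeasure P] {Y : Ω → ℝ≥0∞} (hY : Measurable Y)
    (h : ∫⁻ ω, expNeg (Y ω) ∂P = 1) : ∀ᵐ ω ∂P, Y ω = 0 := by
  have hm : Measurable fun ω => expNeg (Y ω) := measurable_expNeg.comp hY
  have h1 : ∫⁻ ω, (1 - expNeg (Y ω)) ∂P = 0 := by
    rw [lintegral_sub hm (by simp [h])
      (ae_of_all _ fun ω => expNeg_le_one _), h]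
    simp
  rw [lintegral_eq_zero_iff (hm.const_sub 1)] at h1
  filter_upwards [h1] with ω hω
  have h2 : 1 ≤ expNeg (Y ω) := tsub_eq_zero_iff_le.1 hω
  exact expNeg_injective ((le_antisymm (expNeg_le_one _) h2).trans expNeg_zero.symm)

lemma negLog_mul {a b : ℝ≥0∞} (ha : a ≤ 1) (hb : b ≤ 1) : negLog (a * b) = negLog a + negLog b :=
  expNeg_injective (by
    rw [expNeg_add, expNeg_negLog ha, expNeg_negLog hb, expNeg_negLog (mul_le_one' ha hb)])

/-- A union bound, by which the joint Laplace exponent is controlled by those of the single groups.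
-/
lemma one_sub_prod_le {ι : Type*} (s : Finset ι) {a : ι → ℝ≥0∞} (ha : ∀ i, a i ≤ 1) :
    1 - ∏ i ∈ s, a i ≤ ∑ i ∈ s, (1 - a i) := by
  classical
  induction s using Finset.induction_on with
  | empty => simp
  | insert i s hi ih =>
    rw [Finset.prod_insert hi, Finset.sum_insert hi, tsub_le_iff_right]
    calc (1 : ℝ≥0∞) = (1 - a i) + a i * 1 := by rw [mul_one, tsub_add_cancel_of_le (ha i)]
      _ ≤ (1 - a i) + a i * ((1 - ∏ i ∈ s, a i) + ∏ i ∈ s, a i) := by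
          gcongr; exact le_tsub_add
      _ = (1 - a i) + a i * (1 - ∏ i ∈ s, a i) + a i * ∏ i ∈ s, a i := by ring
      _ ≤ (1 - a i) + 1 * (1 - ∏ i ∈ s, a i) + a i * ∏ i ∈ s, a i := by
          gcongr; exact ha i
      _ ≤ _ := by rw [one_mul]; gcongr

lemma isProbabilityMeasure_normalize {E : Type*} [MeasurableSpace E] {M : Measure E}
    (h0 : M Set.univ ≠ 0) (h1 : M Set.univ ≠ ∞) : IsProbabilityMeasure (normalize M) :=
  ⟨by rw [normalize, Measure.smul_apply, smul_eq_mul, ENNReal.inv_mul_cancel h0 h1]⟩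

/-! ### Each coordinate is a gamma process -/

section GammaProcess

variable {X : Type u} [MeasurableSpace X] {Ω : Type v} [MeasurableSpace Ω] {P : Measure Ω}
  [IsProbabilityMeasure P] {α : Measure X} [IsFiniteMeasure α] {φ : ℝ} [hφ : Fact (0 < φ)]
  {d : ℕ} {J : ℕ → Ω → ℝ} {x : ℕ → Ω → X} {m : ℕ × Fin d → Ω → ℝ}

/-- Test functions vanishing in the other groups give trivial factors, and the remaining jump
integral is `lintegral_betaLevy_one_sub`. -/
lemma IsCompoundRep.lintegral_expNeg_single
    (h : IsCompoundRep P (betaLevy φ) α (fun _ _ => gammaMeasure φ 1) J x m) (j : Fin d)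
    {g : X → ℝ≥0} (hg : Measurable g) :
    ∫⁻ ω, expNeg (∫⁻ y, g y ∂(compoundMeasure J x m j ω)) ∂P
      = expNeg (∫⁻ y, ENNReal.ofReal (Real.log (1 + g y)) ∂α) := by
  let f : Fin d → X → ℝ≥0 := fun i => if i = j then g else 0
  have hf : ∀ i, Measurable (f i) := fun i => by
    simp only [f]; split_ifs; exacts [hg, measurable_zero]
  have h1 := h.lintegral_expNeg_pairing hf
  have h2 : ∀ M : Fin d → Measure X,
      pairing (fun i y => (f i y : ℝ≥0∞)) M = ∫⁻ y, g y ∂(M j) := by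
    intro M
    rw [pairing, Finset.sum_eq_single j]
    · simp [f]
    · intro i _ hi
      simp [f, hi]
    · simp
  simp_rw [h2] at h1
  rw [h1]
  congr 1
  have h3 : ∀ p : ℝ × X, ∏ i, ∫⁻ t, scoreWeight 0 (f i p.2) p.1 t ∂(gammaMeasure φ 1)
      = ∫⁻ t, scoreWeight 0 (g p.2) p.1 t ∂(gammaMeasure φ 1) := by
    intro p
    rw [Finset.prod_eq_single j]
    · simp [f]
    · intro i _ hi
      simp [f, hi, scoreWeight]
    · simp
  simp only [lapExponent, h3]
  rw [lintegral_prod_symm']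
  · refine lintegral_congr fun y => ?_
    simpa [scoreWeight] using lintegral_betaLevy_one_sub hφ.out (g y)
  · exact ((measurable_lintegral_scoreWeight 0).comp
      (f := fun p : ℝ × X => (g p.2, p.1)) (by fun_prop)).const_sub 1

lemma IsCompoundRep.lintegral_expNeg_mul_apply
    (h : IsCompoundRep P (betaLevy φ) α (fun _ _ => gammaMeasure φ 1) J x m) (j : Fin d)
    {A : Set X} (hA : MeasurableSet A) (a : ℝ≥0) :
    ∫⁻ ω, expNeg (a * compoundMeasure J x m j ω A) ∂P
      = expNeg (ENNReal.ofReal (Real.log (1 + a)) * α A) := by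
  have h1 := h.lintegral_expNeg_single j (measurable_const.indicator hA : Measurable
    (A.indicator fun _ => a))
  have h2 : ∀ y, ((A.indicator (fun _ => a) y : ℝ≥0) : ℝ≥0∞) = A.indicator (fun _ => (a : ℝ≥0∞)) y :=
    fun y => by by_cases hy : y ∈ A <;> simp [hy]
  have h3 : ∀ y, ENNReal.ofReal (Real.log (1 + (A.indicator (fun _ => a) y : ℝ≥0)))
      = A.indicator (fun _ => ENNReal.ofReal (Real.log (1 + a))) y :=
    fun y => by by_cases hy : y ∈ A <;> simp [hy]
  simp_rw [h3] at h1
  simp only [h2] at h1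
  simp_rw [lintegral_indicator_const hA] at h1
  exact h1

lemma lintegral_expNeg_gammaMeasure {b : ℝ} (hb : 0 < b) (a : ℝ≥0) :
    ∫⁻ t, expNeg (a * ENNReal.ofReal t) ∂(gammaMeasure b 1)
      = expNeg (ENNReal.ofReal (Real.log (1 + a)) * ENNReal.ofReal b) := by
  have h1 := lintegral_scoreWeight hb 0 a one_pos
  simp only [scoreWeight, scoreMass, pow_zero, one_mul, mul_one, ascPochhammer_zero,
    Polynomial.eval_one, Nat.cast_zero, zero_add] at h1
  simp_rw [mul_comm (a : ℝ≥0∞)]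
  have ha : (0 : ℝ) < a + 1 := by positivity
  have hlog : 0 ≤ Real.log (1 + a) := Real.log_nonneg (by simp)
  rw [h1, ← ENNReal.ofReal_mul hlog, expNeg_ofReal (mul_nonneg hlog hb.le), one_div,
    ← Real.rpow_neg ha.le, Real.rpow_def_of_pos ha, add_comm (1 : ℝ)]
  congr 2
  ring

/-- The compound random measures are gamma processes. -/
lemma IsCompoundRep.isGammaProcess
    (h : IsCompoundRep P (betaLevy φ) α (fun _ _ => gammaMeasure φ 1) J x m) (j : Fin d) :
    IsGammaProcess P (compoundMeasure J x m j) α := by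
  have hm : Measurable (compoundMeasure J x m j) :=
    (measurable_pi_apply j).comp h.measurable_vec
  have hmA : ∀ A, MeasurableSet A → Measurable fun ω => compoundMeasure J x m j ω A :=
    fun A hA => (Measure.measurable_coe hA).comp hm
  refine ⟨hm, fun r A hA hd => ?_, fun A hA h0 => ?_, fun A hA h0 => ?_⟩
  · refine iIndepFun_of_lintegral_expNeg (fun i => hmA _ (hA i)) fun a => ?_
    let g : X → ℝ≥0 := fun y => ∑ i, (A i).indicator (fun _ => (a i : ℝ≥0)) y
    have hg : Measurable g := Finset.measurable_sum _ fun i _ => measurable_const.indicator (hA i)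
    have hgc : ∀ y, (g y : ℝ≥0∞) = ∑ i, (A i).indicator (fun _ => (a i : ℝ≥0∞)) y := fun y => by
      simp only [g, ENNReal.ofNNReal_finsetSum]
      refine Finset.sum_congr rfl fun i _ => ?_
      by_cases hy : y ∈ A i <;> simp [hy]
    have h1 := h.lintegral_expNeg_single j hg
    have h2 : ∀ y, ENNReal.ofReal (Real.log (1 + g y))
        = ∑ i, (A i).indicator (fun _ => ENNReal.ofReal (Real.log (1 + a i))) y := fun y => by
      have := apply_sum_indicator_of_disjoint hd (fun i => (a i : ℝ≥0∞))
        (ψ := fun z => ENNReal.ofReal (Real.log (1 + z.toReal))) (by simp) y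
      rw [← hgc] at this
      simpa using this
    simp_rw [h2] at h1
    simp only [hgc] at h1
    simp_rw [lintegral_sum_indicator hA, expNeg_sum] at h1
    rw [h1]
    refine Finset.prod_congr rfl fun i _ => ?_
    have := h.lintegral_expNeg_mul_apply j (hA i) (a i)
    simp only [ENNReal.coe_natCast, NNReal.coe_natCast] at this
    exact this.symm
  · refine ae_eq_zero_of_lintegral_expNeg (hmA A hA) ?_
    -- On an `α`-null set the transform at `1` equals `1`, which forces the mass to vanish almost
    -- surely.
    simpa [h0] using h.lintegral_expNeg_mul_apply j hA 1
  · have hpos : 0 < (α A).toReal := ENNReal.toReal_pos h0 (measure_ne_top _ _)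
    have := isProbabilityMeasure_gammaMeasure hpos one_pos
    have : IsProbabilityMeasure (P.map fun ω => compoundMeasure J x m j ω A) :=
      Measure.isProbabilityMeasure_map (hmA A hA).aemeasurable
    have : IsProbabilityMeasure ((gammaMeasure (α A).toReal 1).map ENNReal.ofReal) :=
      Measure.isProbabilityMeasure_map ENNReal.measurable_ofReal.aemeasurable
    refine ext_of_lintegral_expNeg_mul fun a => ?_
    have hg : Measurable fun y => expNeg (a * y) :=
      measurable_expNeg.comp (measurable_id.const_mul _)
    rw [lintegral_map hg (hmA A hA), lintegral_map hg ENNReal.measurable_ofReal]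
    have h1 := h.lintegral_expNeg_mul_apply j hA a
    have h2 := lintegral_expNeg_gammaMeasure hpos a
    rw [ENNReal.ofReal_toReal (measure_ne_top _ _), ← h1] at h2
    simpa using h2.symm

end GammaProcess

/-! ### Exponential tilting preserves the compound form -/

section Tilt

variable {X : Type u} [MeasurableSpace X] {Ω : Type v} [MeasurableSpace Ω] {P : Measure Ω}
  [IsProbabilityMeasure P] {α : Measure X} [IsFiniteMeasure α] {φ : ℝ} [hφ : Fact (0 < φ)]
  {d : ℕ} {J : ℕ → Ω → ℝ} {x : ℕ → Ω → X} {m : ℕ × Fin d → Ω → ℝ}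

attribute [local irreducible] expNeg

/-- The exponent is at most the sum over the groups of `log (1 + u j)` times the mass of `α`. Its
finiteness keeps the normalizing constant of the tilting nonzero. -/
lemma lapExponent_const_ne_top (u : Fin d → ℝ≥0) : lapExponent φ α (fun j _ => u j) ≠ ∞ := by
  have hm : ∀ j, Measurable fun p : ℝ × X =>
      1 - ∫⁻ t, scoreWeight 0 (u j) p.1 t ∂(gammaMeasure φ 1) := fun j =>
    ((measurable_lintegral_scoreWeight 0).comp
      (f := fun p : ℝ × X => (u j, p.1)) (by fun_prop)).const_sub 1
  have h1 : lapExponent φ α (fun j _ => u j)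
      ≤ ∑ j, ∫⁻ p : ℝ × X, (1 - ∫⁻ t, scoreWeight 0 (u j) p.1 t ∂(gammaMeasure φ 1))
        ∂((betaLevy φ).prod α) := by
    rw [← lintegral_finsetSum _ fun j _ => hm j]
    exact lintegral_mono fun p =>
      one_sub_prod_le _ fun j => lintegral_scoreWeight_zero_le_one _ _
  refine ne_top_of_le_ne_top ?_ h1
  refine ENNReal.sum_ne_top.2 fun j _ => ?_
  rw [lintegral_prod_symm' _ (hm j)]
  have h2 := lintegral_betaLevy_one_sub hφ.out (u j)
  simp only [scoreWeight, pow_zero, one_mul]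
  rw [h2]
  simp [ENNReal.mul_eq_top]

/-- The exponential tilting of `P` by `exp (- ∑ j, u j * μ j (X))`. -/
def tilt (P : Measure Ω) (J : ℕ → Ω → ℝ) (x : ℕ → Ω → X) (m : ℕ × Fin d → Ω → ℝ)
    (u : Fin d → ℝ≥0) : Measure Ω :=
  normalize (P.withDensity fun ω =>
    expNeg (pairing (fun j _ => u j) fun j => compoundMeasure J x m j ω))

lemma IsCompoundRep.measurable_expNeg_pairing {ν : Measure ℝ} {s : Fin d → ℝ → Measure ℝ}
    (h : IsCompoundRep P ν α s J x m) {f : Fin d → X → ℝ≥0∞} (hf : ∀ j, Measurable (f j)) :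
    Measurable fun ω => expNeg (pairing f fun j => compoundMeasure J x m j ω) :=
  measurable_expNeg.comp ((measurable_pairing hf).comp h.measurable_vec)

lemma IsCompoundRep.tilt_univ
    (h : IsCompoundRep P (betaLevy φ) α (fun _ _ => gammaMeasure φ 1) J x m) (u : Fin d → ℝ≥0) :
    (P.withDensity fun ω => expNeg (pairing (fun j _ => u j) fun j => compoundMeasure J x m j ω))
      Set.univ = expNeg (lapExponent φ α fun j _ => u j) := by
  rw [withDensity_apply _ MeasurableSet.univ, setLIntegral_univ]
  exact h.lintegral_expNeg_pairing (f := fun j _ => u j) fun j => measurable_const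

lemma IsCompoundRep.isProbabilityMeasure_tilt
    (h : IsCompoundRep P (betaLevy φ) α (fun _ _ => gammaMeasure φ 1) J x m) (u : Fin d → ℝ≥0) :
    IsProbabilityMeasure (tilt P J x m u) := by
  refine isProbabilityMeasure_normalize ?_ ?_ <;> rw [h.tilt_univ]
  · exact (expNeg_pos (lapExponent_const_ne_top u)).ne'
  · exact expNeg_ne_top _

lemma IsCompoundRep.lintegral_tilt
    (h : IsCompoundRep P (betaLevy φ) α (fun _ _ => gammaMeasure φ 1) J x m) (u : Fin d → ℝ≥0)
    {g : Ω → ℝ≥0∞} (hg : Measurable g) :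
    ∫⁻ ω, g ω ∂(tilt P J x m u) = (expNeg (lapExponent φ α fun j _ => u j))⁻¹ *
      ∫⁻ ω, expNeg (pairing (fun j _ => u j) fun j => compoundMeasure J x m j ω) * g ω ∂P := by
  rw [tilt, normalize, lintegral_smul_measure, h.tilt_univ,
    lintegral_withDensity_eq_lintegral_mul _ (h.measurable_expNeg_pairing fun j =>
      measurable_const) hg]
  rfl

lemma tilt_absolutelyContinuous (u : Fin d → ℝ≥0) : tilt P J x m u ≪ P :=
  (withDensity_absolutelyContinuous _ _).smul_left _

/-- The set of atoms with a jump outside `(0, 1)` has zero intensity, so the Laplace functional of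
its indicator is `1`. Positivity of the jumps is needed for the rates of the tilted scores. -/
lemma IsCompoundRep.ae_jump_mem
    (h : IsCompoundRep P (betaLevy φ) α (fun _ _ => gammaMeasure φ 1) J x m) :
    ∀ᵐ ω ∂P, ∀ i, J i ω ∈ Set.Ioo (0 : ℝ) 1 := by
  let A : Set (ℝ × X) := Prod.fst ⁻¹' (Set.Ioo (0 : ℝ) 1)ᶜ
  have hA : MeasurableSet A := measurable_fst measurableSet_Ioo.compl
  have hf : Measurable (A.indicator fun _ => (1 : ℝ≥0∞)) := measurable_const.indicator hA
  have h1 := h.poisson.lintegral_expNeg hf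
  have hA0 : ((betaLevy φ).prod α) A = 0 := by
    have : A = (Set.Ioo (0 : ℝ) 1)ᶜ ×ˢ Set.univ := by ext; simp [A]
    have h0 : betaLevy φ (Set.Ioo (0 : ℝ) 1)ᶜ = 0 := ae_iff.1 ae_betaLevy
    rw [this, Measure.prod_prod, h0, zero_mul]
  have h2 : ∫⁻ p, (1 - expNeg (A.indicator (fun _ => (1 : ℝ≥0∞)) p)) ∂((betaLevy φ).prod α)
      = 0 := by
    have : ∀ p, 1 - expNeg (A.indicator (fun _ => (1 : ℝ≥0∞)) p)
        = A.indicator (fun _ => 1 - expNeg 1) p := fun p => by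
      by_cases hp : p ∈ A <;> simp [hp]
    simp_rw [this, lintegral_indicator_const hA, hA0, mul_zero]
  rw [h2, expNeg_zero] at h1
  have h3 := ae_eq_zero_of_lintegral_expNeg
    ((Measure.measurable_lintegral hf).comp h.poisson.measurable) h1
  filter_upwards [h3] with ω hω i
  simp only [Function.comp_apply] at hω
  rw [lintegral_sum_measure, ENNReal.tsum_eq_zero] at hω
  have := hω i
  rw [lintegral_dirac' _ hf] at this
  by_contra hi
  have hmem : points J x ω i ∈ A := hi
  simp [hmem] at this

lemma updatedLevy_eq (u : Fin d → ℝ≥0) :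
    updatedLevy φ (fun j => u j) = (betaLevy φ).withDensity
      fun s => ∏ j, ∫⁻ t, scoreWeight 0 (u j) s t ∂(gammaMeasure φ 1) := by
  have hm : Measurable fun s => ∏ j, ∫⁻ t, scoreWeight 0 (u j) s t ∂(gammaMeasure φ 1) :=
    (measurable_prod_lintegral_scoreWeight fun _ => 0).comp (f := fun s => (u, s)) (by fun_prop)
  rw [updatedLevy, betaLevy, ← withDensity_mul _ measurable_betaLevy_density hm]
  refine withDensity_congr_ae ?_
  filter_upwards [ae_restrict_mem measurableSet_Ioo] with s hs
  have hs0 := hs.1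
  have hs1 : 0 < 1 - s := by linarith [hs.2]
  simp_rw [Pi.mul_apply, lintegral_scoreWeight hφ.out _ _ hs0]
  rw [← ENNReal.ofReal_prod_of_nonneg fun j _ => (scoreMass_pos hφ.out _ _ hs0).le,
    ← ENNReal.ofReal_mul (by positivity)]
  congr 2
  refine Finset.prod_congr rfl fun j _ => ?_
  simp [scoreMass, add_comm, mul_comm]

lemma IsCompoundRep.isPoisson_tilt
    (h : IsCompoundRep P (betaLevy φ) α (fun _ _ => gammaMeasure φ 1) J x m) (u : Fin d → ℝ≥0) :
    IsPoissonRandomMeasure (tilt P J x m u)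
      (fun ω => Measure.sum fun i => Measure.dirac (points J x ω i))
      ((updatedLevy φ fun j => u j).prod α) := by
  have := h.isProbabilityMeasure_tilt u
  refine isPoissonRandomMeasure_of_lintegral_expNeg h.poisson.measurable fun f hf => ?_
  let W : ℝ → ℝ≥0∞ := fun s => ∏ j, ∫⁻ t, scoreWeight 0 (u j) s t ∂(gammaMeasure φ 1)
  have hW : Measurable W :=
    (measurable_prod_lintegral_scoreWeight fun _ => 0).comp (f := fun s => (u, s)) (by fun_prop)
  have hW1 : ∀ s, W s ≤ 1 := fun s =>
    Finset.prod_le_one' fun i _ => lintegral_scoreWeight_zero_le_one _ _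
  have hN : Measurable fun ω => expNeg (∫⁻ p, f p
      ∂(Measure.sum fun i => Measure.dirac (points J x ω i))) :=
    measurable_expNeg.comp ((Measure.measurable_lintegral hf).comp h.poisson.measurable)
  rw [h.lintegral_tilt u hN]
  have h1 := h.lintegral_expNeg_points_pairing hf (f := fun j _ => u j) fun j => measurable_const
  have h2 : ∀ ω, ∫⁻ p, f p ∂(Measure.sum fun i => Measure.dirac (points J x ω i))
      = ∑' i, f (J i ω, x i ω) := fun ω => by
    simp only [lintegral_sum_measure, lintegral_dirac' _ hf, points]
  simp_rw [h2, mul_comm (expNeg (pairing _ _))]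
  rw [h1]
  -- The part `1 - W` is cancelled by the normalizing constant, while the factor `W` in the other
  -- part is the density of the updated Lévy measure.
  have h3 : ∀ p : ℝ × X, 1 - expNeg (f p) * W p.1
      = (1 - W p.1) + W p.1 * (1 - expNeg (f p)) := by
    intro p
    have hW' := hW1 p.1
    have hWtop : W p.1 ≠ ∞ := (hW'.trans_lt ENNReal.one_lt_top).ne
    rw [ENNReal.mul_sub (fun _ _ => hWtop), mul_one, mul_comm,
      tsub_add_tsub_cancel hW' (mul_le_of_le_one_right' (expNeg_le_one _))]
  have hWp : Measurable fun p : ℝ × X => W p.1 := hW.comp measurable_fst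
  have hfe : Measurable fun p => expNeg (f p) := measurable_expNeg.comp hf
  have h4 : ∫⁻ p : ℝ × X, (1 - expNeg (f p) * W p.1) ∂((betaLevy φ).prod α)
      = lapExponent φ α (fun j _ => u j) +
        ∫⁻ p, (1 - expNeg (f p)) ∂((updatedLevy φ fun j => u j).prod α) := by
    simp_rw [h3]
    rw [lintegral_add_left (hWp.const_sub 1), updatedLevy_eq]
    have h5 : ((betaLevy φ).withDensity W).prod α
        = ((betaLevy φ).prod α).withDensity fun p => W p.1 :=
      prod_withDensity_left hW
    rw [h5, lintegral_withDensity_eq_lintegral_mul _ hWp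
      (hfe.const_sub 1)]
    rfl
  rw [h4, expNeg_add, ← mul_assoc, ENNReal.inv_mul_cancel
    (expNeg_pos (lapExponent_const_ne_top u)).ne' (expNeg_ne_top _), one_mul]

/-- The law of a score under the tilting, as a quotient of integrals against its original law. -/
lemma gammaMeasure_tilt_apply (a : ℝ≥0) {s : ℝ} (hs : 0 < s) {B : Set ℝ} (hB : MeasurableSet B) :
    gammaMeasure φ (a * s + 1) B = (∫⁻ t, scoreWeight 0 a s t ∂(gammaMeasure φ 1))⁻¹ *
      ∫⁻ t in B, scoreWeight 0 a s t ∂(gammaMeasure φ 1) := by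
  have h1 := lintegral_scoreWeight_mul hφ.out 0 a hs (measurable_one.indicator hB)
  have hpos := scoreMass_pos hφ.out 0 a hs
  rw [lintegral_scoreWeight hφ.out 0 a hs, ← lintegral_indicator hB]
  rw [lintegral_indicator_one hB] at h1
  have h2 : ∀ t, scoreWeight 0 a s t * B.indicator 1 t = B.indicator (scoreWeight 0 a s) t :=
    fun t => by by_cases ht : t ∈ B <;> simp [ht]
  simp_rw [h2] at h1
  rw [h1, ← mul_assoc, ENNReal.inv_mul_cancel (by simpa using hpos) ENNReal.ofReal_ne_top, one_mul]
  simp [mul_comm]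

lemma IsCompoundRep.scores_tilt
    (h : IsCompoundRep P (betaLevy φ) α (fun _ _ => gammaMeasure φ 1) J x m) (u : Fin d → ℝ≥0) :
    IsCondIndepWithLaws (tilt P J x m u) (points J x) m
      (fun q z => gammaMeasure φ (u q.2 * (z q.1).1 + 1)) := by
  classical
  refine ⟨h.scores.measurable_cond, h.scores.measurable, fun s B D hB hD => ?_⟩
  -- the (unnormalized) law of a score
  let G : Fin d → ℝ → ℝ≥0∞ := fun j r => ∫⁻ t, scoreWeight 0 (u j) r t ∂(gammaMeasure φ 1)
  have hG : ∀ j, Measurable (G j) := fun j =>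
    (measurable_lintegral_scoreWeight 0).comp (f := fun r => (u j, r)) (by fun_prop)
  have hG1 : ∀ j r, G j r ≤ 1 := fun j r => lintegral_scoreWeight_zero_le_one _ _
  let GB : ℕ × Fin d → ℝ → ℝ≥0∞ := fun q r => ∫⁻ t in B q, scoreWeight 0 (u q.2) r t ∂(gammaMeasure φ 1)
  have hGB : ∀ q, Measurable (GB q) := fun q => by
    refine Measurable.lintegral_prod_right' (f := fun z : ℝ × ℝ => scoreWeight 0 (u q.2) z.1 z.2) ?_
    exact (measurable_scoreWeight 0).comp (f := fun z : ℝ × ℝ => (u q.2, z.1, z.2)) (by fun_prop)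
  have hGB_le : ∀ q r, GB q r ≤ G q.2 r := fun q r => setLIntegral_le_lintegral _ _
  -- The conditional probability of `B q` under the tilted score law: the part of the exponential
  -- weight carried by `B q`, relative to the whole.
  let ρ : ℕ × Fin d → ℝ → ℝ≥0∞ := fun q r => (G q.2 r)⁻¹ * GB q r
  have hρ : ∀ q, Measurable (ρ q) := fun q => (hG q.2).inv.mul (hGB q)
  have hρ1 : ∀ q r, ρ q r ≤ 1 := fun q r =>
    (mul_le_mul_right (hGB_le q r) _).trans (by
      rw [mul_comm]; exact ENNReal.mul_inv_le_one _)
  have hJ := h.ae_jump_mem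
  have hJ' : ∀ᵐ ω ∂(tilt P J x m u), ∀ i, J i ω ∈ Set.Ioo (0 : ℝ) 1 :=
    (tilt_absolutelyContinuous u).ae_le hJ
  have hZ := h.scores.measurable_cond
  have hmJ : ∀ i, Measurable (J i) := h.measurable_jump
  have hmeasS : MeasurableSet ((points J x) ⁻¹' D ∩ ⋂ q ∈ s, m q ⁻¹' B q) :=
    (hZ hD).inter (Finset.measurableSet_biInter s fun q _ => h.scores.measurable q (hB q))
  have hone : Measurable (D.indicator fun _ => (1 : ℝ≥0∞)) := measurable_const.indicator hD
  -- the right-hand side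
  have hR : ∫⁻ ω in (points J x) ⁻¹' D, ∏ q ∈ s,
        gammaMeasure φ (u q.2 * (points J x ω q.1).1 + 1) (B q) ∂(tilt P J x m u)
      = (expNeg (lapExponent φ α fun j _ => u j))⁻¹ * ∫⁻ ω,
        (D.indicator (fun _ => 1) (points J x ω) * ∏ q ∈ s, ρ q (J q.1 ω)) *
          expNeg (∑' q : ℕ × Fin d, negLog (G q.2 (J q.1 ω))) ∂P := by
    have h1 : ∫⁻ ω in (points J x) ⁻¹' D, ∏ q ∈ s,
        gammaMeasure φ (u q.2 * (points J x ω q.1).1 + 1) (B q) ∂(tilt P J x m u)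
        = ∫⁻ ω, D.indicator (fun _ => 1) (points J x ω) * ∏ q ∈ s, ρ q (J q.1 ω)
          ∂(tilt P J x m u) := by
      rw [← lintegral_indicator (hZ hD)]
      refine lintegral_congr_ae ?_
      filter_upwards [hJ'] with ω hω
      have h2 : ∀ q ∈ s, gammaMeasure φ (u q.2 * (points J x ω q.1).1 + 1) (B q)
          = ρ q (J q.1 ω) := fun q _ =>
        gammaMeasure_tilt_apply (u q.2) (hω q.1).1 (hB q)
      by_cases hωD : points J x ω ∈ D
      · rw [Set.indicator_of_mem (by exact hωD), Set.indicator_of_mem hωD, one_mul]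
        exact Finset.prod_congr rfl h2
      · rw [Set.indicator_of_notMem (by exact hωD), Set.indicator_of_notMem hωD, zero_mul]
    have hk : Measurable fun z : ℕ → ℝ × X =>
        D.indicator (fun _ => (1 : ℝ≥0∞)) z * ∏ q ∈ s, ρ q (z q.1).1 :=
      hone.mul (Finset.measurable_prod _ fun q _ => (hρ q).comp (by fun_prop))
    have hkZ : Measurable fun ω =>
        D.indicator (fun _ => (1 : ℝ≥0∞)) (points J x ω) * ∏ q ∈ s, ρ q (J q.1 ω) := hk.comp hZ
    rw [h1, h.lintegral_tilt u hkZ]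
    congr 1
    have h3 := h.scores.lintegral_expNeg hk
      (fun z => mul_le_one' (Set.indicator_le (fun _ _ => le_rfl) z)
        (Finset.prod_le_one' fun q _ => hρ1 q _))
      (g := fun q z t => ENNReal.ofReal (t * (z q.1).1) * u q.2) (fun q => by
        unfold Function.uncurry; fun_prop)
    have h4 : ∀ q : ℕ × Fin d, ∀ r : ℝ, ∫⁻ t, expNeg (ENNReal.ofReal (t * r) * u q.2) ∂(gammaMeasure φ 1)
        = G q.2 r := fun q r => by simp only [G, scoreWeight, pow_zero, one_mul]
    simp_rw [h4] at h3
    refine Eq.trans ?_ h3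
    refine lintegral_congr fun ω => ?_
    rw [pairing_compoundMeasure fun j => measurable_const, mul_comm]
    rfl
  rw [hR, ← lintegral_indicator_one hmeasS, h.lintegral_tilt u (measurable_one.indicator hmeasS)]
  congr 1
  -- the left-hand side
  let g : ℕ × Fin d → (ℕ → ℝ × X) → ℝ → ℝ≥0∞ := fun q z t =>
    ENNReal.ofReal (t * (z q.1).1) * u q.2 + if q ∈ s then (B q)ᶜ.indicator (fun _ => ∞) t else 0
  have hg : ∀ q, Measurable (Function.uncurry (g q)) := fun q => by
    unfold Function.uncurry
    refine Measurable.add (f := fun y : (ℕ → ℝ × X) × ℝ => ENNReal.ofReal (y.2 * (y.1 q.1).1) * (u q.2 : ℝ≥0∞)) (by fun_prop) ?_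
    by_cases hq : q ∈ s
    · simp only [hq, if_true]
      exact (measurable_const.indicator (hB q).compl).comp measurable_snd
    · simp only [hq, if_false]
      exact measurable_const
  have h5 := h.scores.lintegral_expNeg hone (Set.indicator_le fun _ _ => le_rfl) hg
  have h6 : ∀ ω, expNeg (pairing (fun j _ => (u j : ℝ≥0∞)) fun j => compoundMeasure J x m j ω) *
      ((points J x) ⁻¹' D ∩ ⋂ q ∈ s, m q ⁻¹' B q).indicator 1 ω
      = D.indicator (fun _ => 1) (points J x ω) *
        expNeg (∑' q, g q (points J x ω) (m q ω)) := by
    intro ω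
    have hsum : ∑' q, g q (points J x ω) (m q ω)
        = pairing (fun j _ => (u j : ℝ≥0∞)) (fun j => compoundMeasure J x m j ω)
          + ∑ q ∈ s, (B q)ᶜ.indicator (fun _ => ∞) (m q ω) := by
      rw [pairing_compoundMeasure fun j => measurable_const]
      simp only [g]
      rw [ENNReal.tsum_add]
      congr 1
      rw [tsum_eq_sum (s := s) fun q hq => by simp [hq]]
      exact Finset.sum_congr rfl fun q hq => by simp [hq]
    rw [hsum, expNeg_add, expNeg_sum]
    by_cases hωD : points J x ω ∈ D
    · by_cases hωB : ∀ q ∈ s, m q ω ∈ B q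
      · rw [Set.indicator_of_mem (by exact ⟨hωD, by simpa using hωB⟩),
          Set.indicator_of_mem hωD, Finset.prod_eq_one]
        · simp
        · intro q hq
          simp [hωB q hq]
      · rw [Set.indicator_of_notMem (fun hmem => hωB (by simpa using hmem.2))]
        push Not at hωB
        obtain ⟨q, hq, hqB⟩ := hωB
        rw [Finset.prod_eq_zero hq]
        · simp
        · simp [hqB]
    · rw [Set.indicator_of_notMem (fun hmem => hωD hmem.1), Set.indicator_of_notMem hωD]
      simp
  simp_rw [h6]
  refine (show _ = _ from h5).trans ?_
  refine lintegral_congr_ae ?_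
  filter_upwards [hJ] with ω hω
  rw [mul_assoc]
  congr 1
  -- Each transform splits as the total tilted weight times a conditional probability, the latter
  -- only for the finitely many scores under constraint.
  have h7 : ∀ q : ℕ × Fin d, negLog (∫⁻ t, expNeg (g q (points J x ω) t) ∂(gammaMeasure φ 1))
      = (if q ∈ s then negLog (ρ q (J q.1 ω)) else 0) + negLog (G q.2 (J q.1 ω)) := by
    intro q
    by_cases hq : q ∈ s
    · rw [if_pos hq, ← negLog_mul (hρ1 _ _) (hG1 _ _)]
      congr 1
      have hGpos : G q.2 (J q.1 ω) ≠ 0 := by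
        have := scoreMass_pos hφ.out 0 (u q.2) (hω q.1).1
        simp only [G]
        rw [lintegral_scoreWeight hφ.out 0 _ (hω q.1).1]
        simpa using this
      have hGtop : G q.2 (J q.1 ω) ≠ ∞ := ((hG1 _ _).trans_lt ENNReal.one_lt_top).ne
      have h8 : ρ q (J q.1 ω) * G q.2 (J q.1 ω) = GB q (J q.1 ω) := by
        simp only [ρ]
        rw [mul_right_comm, ENNReal.inv_mul_cancel hGpos hGtop, one_mul]
      rw [h8]
      simp only [GB]
      rw [← lintegral_indicator (hB q)]
      refine lintegral_congr fun t => ?_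
      by_cases ht : t ∈ B q <;> simp [g, hq, ht, scoreWeight, points]
    · rw [if_neg hq, zero_add]
      congr 1
      refine lintegral_congr fun t => ?_
      simp [g, hq, scoreWeight, points]
  simp_rw [h7]
  rw [ENNReal.tsum_add, expNeg_add]
  congr 1
  rw [tsum_eq_sum (s := s) fun q hq => by simp [hq], expNeg_sum]
  refine Finset.prod_congr rfl fun q hq => ?_
  rw [if_pos hq, expNeg_negLog (hρ1 _ _)]

/-- The exponential tilting of a vector of compound random measures. -/
lemma IsCompoundRep.tilt
    (h : IsCompoundRep P (betaLevy φ) α (fun _ _ => gammaMeasure φ 1) J x m) (u : Fin d → ℝ≥0) :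
    IsCompoundRep (tilt P J x m u) (updatedLevy φ fun j => u j) α
      (fun j s => gammaMeasure φ (u j * s + 1)) J x m :=
  ⟨h.isPoisson_tilt u, h.scores_tilt u⟩

end Tilt


/-! ### The law of the jump and scores of an observed atom -/

section MarkLaw

attribute [local irreducible] expNeg scoreWeight

variable {φ : ℝ} {d : ℕ}

/-- The intensity of the jump and the scores of an atom. -/
def markBase (φ : ℝ) (d : ℕ) : Measure (ℝ × (Fin d → ℝ)) :=
  (betaLevy φ).prod (Measure.pi fun _ => gammaMeasure φ 1)

/-- The likelihood factor of an atom observed `c j` times in group `j`. -/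
def markWeight (c : Fin d → ℕ) (a : Fin d → ℝ≥0) (y : ℝ × (Fin d → ℝ)) : ℝ≥0∞ :=
  ∏ j, scoreWeight (c j) (a j) y.1 (y.2 j)

/-- The linear functional `∑ j, b j * t j * s` of an atom with jump `s` and scores `t`. -/
def markPairing (b : Fin d → ℝ≥0) (y : ℝ × (Fin d → ℝ)) : ℝ≥0∞ :=
  ∑ j, ENNReal.ofReal (y.2 j * y.1) * b j

/-- The posterior law of the jump and the scores of an atom observed `c j` times in group `j`. -/
def markLaw (φ : ℝ) (c : Fin d → ℕ) (a : Fin d → ℝ≥0) : Measure (ℝ × (Fin d → ℝ)) :=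
  -- Zero counts label an index carrying no new value: the Dirac mass at `0` produces an atom of
  -- weight zero. The same convention gives `markQuot = 1` and `markRate = 0`.
  if c = 0 then Measure.dirac 0 else normalize ((markBase φ d).withDensity (markWeight c a))

/-- The Laplace transform of `markLaw φ c a`, at `b - a`. -/
def markQuot (φ : ℝ) (c : Fin d → ℕ) (b a : Fin d → ℝ≥0) : ℝ≥0∞ :=
  if c = 0 then 1 else jumpMass φ c b / jumpMass φ c a

/-- The mean weight in group `j` under `markLaw φ c b`. -/
def markRate (φ : ℝ) (c : Fin d → ℕ) (j : Fin d) (b : Fin d → ℝ≥0) : ℝ≥0∞ :=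
  if c = 0 then 0 else jumpMass φ (c + Pi.single j 1) b / jumpMass φ c b

@[fun_prop]
lemma measurable_markWeight (c : Fin d → ℕ) :
    Measurable fun z : (Fin d → ℝ≥0) × (ℝ × (Fin d → ℝ)) => markWeight c z.1 z.2 :=
  Finset.measurable_prod _ fun j _ => (measurable_scoreWeight (c j)).comp
    (f := fun z : (Fin d → ℝ≥0) × (ℝ × (Fin d → ℝ)) => (z.1 j, z.2.1, z.2.2 j)) (by fun_prop)

lemma measurable_markWeight_right (c : Fin d → ℕ) (a : Fin d → ℝ≥0) :
    Measurable (markWeight c a) :=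
  (measurable_markWeight c).comp measurable_prodMk_left

lemma measurable_markPairing (b : Fin d → ℝ≥0) : Measurable (markPairing b) := by
  unfold markPairing
  fun_prop

lemma markWeight_add (c : Fin d → ℕ) (a b : Fin d → ℝ≥0) (y : ℝ × (Fin d → ℝ)) :
    markWeight c (fun j => a j + b j) y = markWeight c a y * expNeg (markPairing b y) := by
  simp only [markWeight, markPairing, scoreWeight_add, expNeg_sum, Finset.prod_mul_distrib]

lemma markWeight_add_single (c : Fin d → ℕ) (j : Fin d) (a : Fin d → ℝ≥0)
    (y : ℝ × (Fin d → ℝ)) : markWeight (c + Pi.single j 1) a y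
      = ENNReal.ofReal (y.2 j * y.1) * markWeight c a y := by
  simp only [markWeight]
  rw [← Finset.mul_prod_erase _ _ (Finset.mem_univ j),
    ← Finset.mul_prod_erase _ (fun i => scoreWeight (c i) (a i) y.1 (y.2 i)) (Finset.mem_univ j),
    ← mul_assoc, ← scoreWeight_succ]
  congr 1
  · simp
  · refine Finset.prod_congr rfl fun i hi => ?_
    simp [Finset.ne_of_mem_erase hi]

variable [hφ : Fact (0 < φ)]

lemma lintegral_markWeight (c : Fin d → ℕ) (a : Fin d → ℝ≥0) :
    ∫⁻ y, markWeight c a y ∂(markBase φ d) = jumpMass φ c a := by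
  rw [markBase, lintegral_prod _ (measurable_markWeight_right c a).aemeasurable]
  refine lintegral_congr fun s => ?_
  refine lintegral_pi_prod (g := fun j t => scoreWeight (c j) (a j) s t) fun j => ?_
  exact (measurable_scoreWeight (c j)).comp (f := fun t => (a j, s, t)) (by fun_prop)

lemma lintegral_markLaw {c : Fin d → ℕ} (hc : c ≠ 0) (a : Fin d → ℝ≥0)
    {g : ℝ × (Fin d → ℝ) → ℝ≥0∞} (hg : Measurable g) :
    ∫⁻ y, g y ∂(markLaw φ c a)
      = (jumpMass φ c a)⁻¹ * ∫⁻ y, markWeight c a y * g y ∂(markBase φ d) := by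
  rw [markLaw, if_neg hc, normalize, lintegral_smul_measure,
    lintegral_withDensity_eq_lintegral_mul _ (measurable_markWeight_right c a) hg,
    withDensity_apply _ MeasurableSet.univ, setLIntegral_univ, lintegral_markWeight]
  rfl

instance (c : Fin d → ℕ) (a : Fin d → ℝ≥0) : IsProbabilityMeasure (markLaw φ c a) := by
  by_cases hc : c = 0
  · rw [markLaw, if_pos hc]
    infer_instance
  · refine ⟨?_⟩
    rw [← setLIntegral_one, setLIntegral_univ, lintegral_markLaw hc a measurable_const]
    simp_rw [mul_one]
    rw [lintegral_markWeight, ENNReal.inv_mul_cancel (jumpMass_ne_zero c a) (jumpMass_ne_top hc a)]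

instance {ι : Type*} [Fintype ι] (c : ι → Fin d → ℕ) (a : Fin d → ℝ≥0) :
    IsProbabilityMeasure (Measure.pi fun l => markLaw φ (c l) a) :=
  Measure.pi.instIsProbabilityMeasure _

instance {ι : Type*} [Fintype ι] (c : ι → Fin d → ℕ) (a : Fin d → ℝ≥0) :
    SFinite (Measure.pi fun l => markLaw φ (c l) a) :=
  have : IsFiniteMeasure (Measure.pi fun l => markLaw φ (c l) a) := IsZeroOrProbabilityMeasure.toIsFiniteMeasure _
  have : SigmaFinite (Measure.pi fun l => markLaw φ (c l) a) := IsFiniteMeasure.toSigmaFinite _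
  inferInstance

/-- An exponential factor shifts the parameter of the weight from `a` to `a + b`, leaving a quotient
of masses. -/
lemma lintegral_expNeg_markLaw (c : Fin d → ℕ) (a b : Fin d → ℝ≥0) :
    ∫⁻ y, expNeg (markPairing b y) ∂(markLaw φ c a)
      = markQuot φ c (fun j => a j + b j) a := by
  have hm : Measurable fun y => expNeg (markPairing b y) :=
    measurable_expNeg.comp (measurable_markPairing b)
  by_cases hc : c = 0
  · rw [markLaw, if_pos hc, lintegral_dirac' _ hm, markQuot, if_pos hc]
    simp [markPairing]
  · rw [lintegral_markLaw hc a hm, markQuot, if_neg hc]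
    simp_rw [← markWeight_add]
    rw [lintegral_markWeight, mul_comm, div_eq_mul_inv]

/-- The linear factor raises the count of group `j` by one, and the mass with counts `c` at `a + b`
is inserted to split the quotient into a rate and a Laplace transform. -/
lemma lintegral_apply_mul_expNeg_markLaw (c : Fin d → ℕ) (j : Fin d) (a b : Fin d → ℝ≥0) :
    ∫⁻ y, ENNReal.ofReal (y.2 j * y.1) * expNeg (markPairing b y) ∂(markLaw φ c a)
      = markRate φ c j (fun j => a j + b j) * markQuot φ c (fun j => a j + b j) a := by
  have hm : Measurable fun y : ℝ × (Fin d → ℝ) =>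
      ENNReal.ofReal (y.2 j * y.1) * expNeg (markPairing b y) := by
    have := measurable_markPairing b
    fun_prop
  by_cases hc : c = 0
  · rw [markLaw, if_pos hc, lintegral_dirac' _ hm, markRate, if_pos hc]
    simp
  · rw [lintegral_markLaw hc a hm, markQuot, if_neg hc, markRate, if_neg hc]
    simp_rw [mul_left_comm (markWeight c a _), ← markWeight_add, ← markWeight_add_single]
    rw [lintegral_markWeight, div_eq_mul_inv, div_eq_mul_inv, ← mul_assoc,
      mul_assoc (jumpMass φ (c + _) _), ENNReal.inv_mul_cancel (jumpMass_ne_zero _ _)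
      (jumpMass_ne_top hc _), mul_one, mul_comm]

lemma measurable_markLaw :
    Measurable fun z : (Fin d → ℕ) × (Fin d → ℝ≥0) => markLaw φ z.1 z.2 := by
  refine measurable_from_prod_countable_right fun c => ?_
  by_cases hc : c = 0
  · simp only [markLaw, if_pos hc]
    exact measurable_const
  · refine Measure.measurable_of_measurable_coe _ fun B hB => ?_
    have h1 : ∀ a, markLaw φ c a B = (jumpMass φ c a)⁻¹ *
        ∫⁻ y, markWeight c a y * B.indicator 1 y ∂(markBase φ d) := fun a => by
      rw [← lintegral_markLaw hc a (measurable_one.indicator hB), lintegral_indicator_one hB]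
    simp_rw [h1]
    have h2 : SFinite (markBase φ d) := by unfold markBase; infer_instance
    refine (measurable_jumpMass c).inv.mul (Measurable.lintegral_prod_right' (f := fun z :
      (Fin d → ℝ≥0) × (ℝ × (Fin d → ℝ)) => markWeight c z.1 z.2 * B.indicator 1 z.2) ?_)
    exact (measurable_markWeight c).mul ((measurable_one.indicator hB).comp measurable_snd)

end MarkLaw

/-! ### Tilted vectors with independent fixed atoms -/

section FixedLaw

attribute [local irreducible] expNeg scoreWeight

variable {X : Type u} [MeasurableSpace X] {Ω : Type v} [MeasurableSpace Ω] {P : Measure Ω}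
  [IsProbabilityMeasure P] {α : Measure X} [IsFiniteMeasure α] {φ : ℝ} [hφ : Fact (0 < φ)]
  {d : ℕ} {J : ℕ → Ω → ℝ} {x : ℕ → Ω → X} {m : ℕ × Fin d → Ω → ℝ}
  {ι : Type*} [Fintype ι]

/-- The vector of measures `M` with atoms at the points `xs l` added, of weights
`(y l).2 j * (y l).1` in group `j`. -/
def addFixed (xs : ι → X) (M : Fin d → Measure X) (y : ι → ℝ × (Fin d → ℝ)) :
    Fin d → Measure X :=
  fun j => M j + ∑ l, ENNReal.ofReal ((y l).2 j * (y l).1) • Measure.dirac (xs l)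

lemma addFixed_apply (xs : ι → X) (M : Fin d → Measure X) (y : ι → ℝ × (Fin d → ℝ)) (j : Fin d)
    {B : Set X} (hB : MeasurableSet B) : addFixed xs M y j B
      = M j B + ∑ l, ENNReal.ofReal ((y l).2 j * (y l).1) * B.indicator 1 (xs l) := by
  simp [addFixed, Measure.dirac_apply' _ hB]

lemma measurable_addFixed : Measurable fun z : (ι → X) × (Fin d → Measure X) ×
    (ι → ℝ × (Fin d → ℝ)) => addFixed z.1 z.2.1 z.2.2 := by
  refine measurable_pi_lambda _ fun j => Measure.measurable_of_measurable_coe _ fun B hB => ?_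
  simp only [addFixed_apply _ _ _ _ hB]
  refine Measurable.add ?_ (Finset.measurable_sum _ fun l _ => Measurable.mul (by fun_prop) ?_)
  · exact (Measure.measurable_coe hB).comp (by fun_prop)
  · exact (measurable_one.indicator hB).comp (by fun_prop)

lemma pairing_addFixed {f : Fin d → X → ℝ≥0} (hf : ∀ j, Measurable (f j)) (xs : ι → X)
    (M : Fin d → Measure X) (y : ι → ℝ × (Fin d → ℝ)) :
    pairing (fun j z => f j z) (addFixed xs M y)
      = pairing (fun j z => f j z) M + ∑ l, markPairing (fun j => f j (xs l)) (y l) := by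
  have h1 : ∀ j, ∫⁻ z, f j z ∂(addFixed xs M y j) = ∫⁻ z, f j z ∂(M j) +
      ∑ l, ENNReal.ofReal ((y l).2 j * (y l).1) * f j (xs l) := fun j => by
    simp only [addFixed, lintegral_add_measure, lintegral_finsetSum_measure,
      lintegral_smul_measure, lintegral_dirac' _ (hf j).coe_nnreal_ennreal, smul_eq_mul]
  simp only [pairing, h1, Finset.sum_add_distrib, markPairing]
  rw [Finset.sum_comm]

/-- The law of a tilted vector of compound random measures with independent fixed atoms added. -/
def fixedLaw (P : Measure Ω) (φ : ℝ) (J : ℕ → Ω → ℝ) (x : ℕ → Ω → X) (m : ℕ × Fin d → Ω → ℝ)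
    (xs : ι → X) (c : ι → Fin d → ℕ) (u : Fin d → ℝ≥0) : Measure (Fin d → Measure X) :=
  ((tilt P J x m u).prod (Measure.pi fun l => markLaw φ (c l) u)).map
    fun z => addFixed xs (fun j => compoundMeasure J x m j z.1) z.2

/-- The Laplace functional of `fixedLaw`. -/
def fixedLap (φ : ℝ) (α : Measure X) (xs : ι → X) (c : ι → Fin d → ℕ) (u : Fin d → ℝ≥0)
    (f : Fin d → X → ℝ≥0) : ℝ≥0∞ :=
  (expNeg (lapExponent φ α fun j _ => u j))⁻¹ * expNeg (lapExponent φ α fun j z => u j + f j z) *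
    ∏ l, markQuot φ (c l) (fun j => u j + f j (xs l)) u

lemma IsCompoundRep.measurable_fixed
    (h : IsCompoundRep P (betaLevy φ) α (fun _ _ => gammaMeasure φ 1) J x m) (xs : ι → X) :
    Measurable fun z : Ω × (ι → ℝ × (Fin d → ℝ)) =>
      addFixed xs (fun j => compoundMeasure J x m j z.1) z.2 :=
  measurable_addFixed.comp (measurable_const.prodMk
    ((h.measurable_vec.comp measurable_fst).prodMk measurable_snd))

lemma IsCompoundRep.isProbabilityMeasure_fixedLaw
    (h : IsCompoundRep P (betaLevy φ) α (fun _ _ => gammaMeasure φ 1) J x m) (xs : ι → X)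
    (c : ι → Fin d → ℕ) (u : Fin d → ℝ≥0) :
    IsProbabilityMeasure (fixedLaw P φ J x m xs c u) := by
  have := h.isProbabilityMeasure_tilt u
  exact Measure.isProbabilityMeasure_map (h.measurable_fixed xs).aemeasurable

lemma IsCompoundRep.lintegral_expNeg_tilt
    (h : IsCompoundRep P (betaLevy φ) α (fun _ _ => gammaMeasure φ 1) J x m) (u : Fin d → ℝ≥0)
    {f : Fin d → X → ℝ≥0} (hf : ∀ j, Measurable (f j)) {g : Ω → ℝ≥0∞} (hg : Measurable g) :
    ∫⁻ ω, g ω * expNeg (pairing (fun j y => f j y) fun j => compoundMeasure J x m j ω)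
        ∂(CoRM.tilt P J x m u)
      = (expNeg (lapExponent φ α fun j _ => u j))⁻¹ * ∫⁻ ω, g ω * expNeg (pairing
        (fun j y => ((u j + f j y : ℝ≥0) : ℝ≥0∞)) fun j => compoundMeasure J x m j ω) ∂P := by
  have hm := h.measurable_expNeg_pairing fun j => (hf j).coe_nnreal_ennreal
  have hgm : Measurable fun ω => g ω *
      expNeg (pairing (fun j y => (f j y : ℝ≥0∞)) fun j => compoundMeasure J x m j ω) := hg.mul hm
  rw [h.lintegral_tilt u hgm]
  congr 1
  refine lintegral_congr fun ω => ?_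
  have h1 : ∀ M : Fin d → Measure X, pairing (fun j y => ((u j + f j y : ℝ≥0) : ℝ≥0∞)) M
      = pairing (fun j _ => (u j : ℝ≥0∞)) M + pairing (fun j y => (f j y : ℝ≥0∞)) M := fun M => by
    simp only [pairing, ENNReal.coe_add, ← Finset.sum_add_distrib]
    exact Finset.sum_congr rfl fun j _ => lintegral_add_left measurable_const _
  rw [h1, expNeg_add, mul_left_comm]

lemma IsCompoundRep.lintegral_expNeg_fixedLaw
    (h : IsCompoundRep P (betaLevy φ) α (fun _ _ => gammaMeasure φ 1) J x m) (xs : ι → X)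
    (c : ι → Fin d → ℕ) (u : Fin d → ℝ≥0) {f : Fin d → X → ℝ≥0} (hf : ∀ j, Measurable (f j)) :
    ∫⁻ M, expNeg (pairing (fun j z => f j z) M) ∂(fixedLaw P φ J x m xs c u)
      = fixedLap φ α xs c u f := by
  have := h.isProbabilityMeasure_tilt u
  have hfc : ∀ j, Measurable fun z => (f j z : ℝ≥0∞) := fun j => (hf j).coe_nnreal_ennreal
  have hmp := h.measurable_expNeg_pairing hfc
  have hmk : ∀ l, Measurable fun y => expNeg (markPairing (fun j => f j (xs l)) y) := fun l =>
    measurable_expNeg.comp (measurable_markPairing _)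
  have hmE : Measurable fun M => expNeg (pairing (fun j z => (f j z : ℝ≥0∞)) M) :=
    measurable_expNeg.comp (measurable_pairing hfc)
  rw [fixedLaw, lintegral_map hmE
    (h.measurable_fixed xs)]
  simp_rw [pairing_addFixed hf, expNeg_add, expNeg_sum]
  have hmP : Measurable fun y : ι → ℝ × (Fin d → ℝ) =>
      ∏ l, expNeg (markPairing (fun j => f j (xs l)) (y l)) :=
    Finset.measurable_prod _ fun l _ => (hmk l).comp (measurable_pi_apply l)
  rw [lintegral_prod_mul hmp.aemeasurable hmP.aemeasurable, lintegral_pi_prod hmk]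
  simp_rw [lintegral_expNeg_markLaw]
  have h1 := h.lintegral_expNeg_tilt u hf (g := fun _ => 1) measurable_const
  simp only [one_mul] at h1
  rw [h1, h.lintegral_expNeg_pairing (f := fun j z => u j + f j z)
    fun j => (hf j).const_add (u j), fixedLap]

/-- The mass of `B` is the sum of the contributions of the compound part and of each fixed atom. By
independence every term factorizes: the first uses the Campbell formula, the others the rate of one
atom, and all share the factor `fixedLap`. -/
lemma IsCompoundRep.lintegral_apply_mul_expNeg_fixedLaw
    (h : IsCompoundRep P (betaLevy φ) α (fun _ _ => gammaMeasure φ 1) J x m) (xs : ι → X)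
    (c : ι → Fin d → ℕ) (u : Fin d → ℝ≥0) {f : Fin d → X → ℝ≥0} (hf : ∀ j, Measurable (f j))
    (j : Fin d) {B : Set X} (hB : MeasurableSet B) :
    ∫⁻ M, M j B * expNeg (pairing (fun j z => f j z) M) ∂(fixedLaw P φ J x m xs c u)
      = fixedLap φ α xs c u f * (∫⁻ z in B, jumpMass φ (Pi.single j 1) (fun i => u i + f i z) ∂α +
        ∑ l, B.indicator 1 (xs l) * markRate φ (c l) j (fun i => u i + f i (xs l))) := by
  classical
  have := h.isProbabilityMeasure_tilt u
  have hfc : ∀ j, Measurable fun z => (f j z : ℝ≥0∞) := fun j => (hf j).coe_nnreal_ennreal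
  have hmp := h.measurable_expNeg_pairing hfc
  have hmk : ∀ l, Measurable fun y => expNeg (markPairing (fun j => f j (xs l)) y) := fun l =>
    measurable_expNeg.comp (measurable_markPairing _)
  have hmB : Measurable fun ω => compoundMeasure J x m j ω B :=
    (Measure.measurable_coe hB).comp ((measurable_pi_apply j).comp h.measurable_vec)
  have hmE : Measurable fun y : ι → ℝ × (Fin d → ℝ) =>
      ∏ l, expNeg (markPairing (fun j => f j (xs l)) (y l)) :=
    Finset.measurable_prod _ fun l _ => (hmk l).comp (measurable_pi_apply l)
  have hmM : Measurable fun M : Fin d → Measure X => M j B :=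
    (Measure.measurable_coe hB).comp (measurable_pi_apply j)
  have hmW : ∀ l, Measurable fun y : ι → ℝ × (Fin d → ℝ) =>
      ENNReal.ofReal ((y l).2 j * (y l).1) := fun l => by fun_prop
  have hmME : Measurable fun M => M j B * expNeg (pairing (fun j z => (f j z : ℝ≥0∞)) M) :=
    hmM.mul (measurable_expNeg.comp (measurable_pairing hfc))
  rw [fixedLaw, lintegral_map hmME
    (h.measurable_fixed xs)]
  simp_rw [pairing_addFixed hf, expNeg_add, expNeg_sum, addFixed_apply _ _ _ _ hB, add_mul]
  rw [lintegral_add_left]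
  swap
  · exact (hmB.comp measurable_fst).mul ((hmp.comp measurable_fst).mul (hmE.comp measurable_snd))
  have hE : ∫⁻ y, ∏ l, expNeg (markPairing (fun j => f j (xs l)) (y l))
        ∂(Measure.pi fun l => markLaw φ (c l) u)
      = ∏ l, markQuot φ (c l) (fun j => u j + f j (xs l)) u := by
    rw [lintegral_pi_prod hmk]
    simp_rw [lintegral_expNeg_markLaw]
  have hW : ∀ l, ∫⁻ y, ENNReal.ofReal ((y l).2 j * (y l).1) *
        ∏ l, expNeg (markPairing (fun j => f j (xs l)) (y l))
        ∂(Measure.pi fun l => markLaw φ (c l) u)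
      = markRate φ (c l) j (fun i => u i + f i (xs l)) *
        ∏ l, markQuot φ (c l) (fun j => u j + f j (xs l)) u := by
    intro l
    -- The linear factor is absorbed into the factor with index `l`, so that the integrand is a
    -- product over coordinates.
    have h1 : ∀ y : ι → ℝ × (Fin d → ℝ), ENNReal.ofReal ((y l).2 j * (y l).1) *
        ∏ l, expNeg (markPairing (fun j => f j (xs l)) (y l))
        = ∏ l', (if l' = l then ENNReal.ofReal ((y l').2 j * (y l').1) else 1) *
          expNeg (markPairing (fun j => f j (xs l')) (y l')) := fun y => by
      rw [Finset.prod_mul_distrib, Finset.prod_ite_eq' Finset.univ l, if_pos (Finset.mem_univ l)]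
    simp_rw [h1]
    rw [lintegral_pi_prod (g := fun l' (y : ℝ × (Fin d → ℝ)) =>
      (if l' = l then ENNReal.ofReal (y.2 j * y.1) else 1) *
          expNeg (markPairing (fun j => f j (xs l')) y))
      (fun l' => (by split_ifs <;> fun_prop : Measurable _).mul (hmk l'))]
    have h2 : ∀ l', ∫⁻ y, (if l' = l then ENNReal.ofReal (y.2 j * y.1) else 1) *
          expNeg (markPairing (fun j => f j (xs l')) y) ∂(markLaw φ (c l') u)
        = (if l' = l then markRate φ (c l') j (fun i => u i + f i (xs l')) else 1) *
          markQuot φ (c l') (fun j => u j + f j (xs l')) u := fun l' => by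
      split_ifs
      · exact lintegral_apply_mul_expNeg_markLaw _ _ _ _
      · simp_rw [one_mul]
        exact lintegral_expNeg_markLaw _ _ _
    simp_rw [h2]
    rw [Finset.prod_mul_distrib, Finset.prod_ite_eq' Finset.univ l, if_pos (Finset.mem_univ l)]
  have hT1 : ∫⁻ ω, expNeg (pairing (fun j z => f j z) fun j => compoundMeasure J x m j ω)
      ∂(CoRM.tilt P J x m u) = (expNeg (lapExponent φ α fun j _ => u j))⁻¹ *
        expNeg (lapExponent φ α fun j z => u j + f j z) := by
    have h1 := h.lintegral_expNeg_tilt u hf (g := fun _ => 1) measurable_const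
    simp only [one_mul] at h1
    rw [h1, h.lintegral_expNeg_pairing (f := fun j z => u j + f j z)
      fun j => (hf j).const_add (u j)]
  have hT2 : ∫⁻ ω, compoundMeasure J x m j ω B *
        expNeg (pairing (fun j z => f j z) fun j => compoundMeasure J x m j ω) ∂(CoRM.tilt P J x m u)
      = (expNeg (lapExponent φ α fun j _ => u j))⁻¹ *
        expNeg (lapExponent φ α fun j z => u j + f j z) *
        ∫⁻ z in B, jumpMass φ (Pi.single j 1) (fun i => u i + f i z) ∂α := by
    rw [h.lintegral_expNeg_tilt u hf hmB, h.lintegral_apply_mul_expNeg_pairing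
      (f := fun j z => u j + f j z) (fun j => (hf j).const_add (u j)) j hB, mul_assoc]
  have hI1 : ∫⁻ z : Ω × (ι → ℝ × (Fin d → ℝ)), compoundMeasure J x m j z.1 B *
        (expNeg (pairing (fun j z => f j z) fun j => compoundMeasure J x m j z.1) *
          ∏ l, expNeg (markPairing (fun j => f j (xs l)) (z.2 l)))
        ∂((CoRM.tilt P J x m u).prod (Measure.pi fun l => markLaw φ (c l) u))
      = fixedLap φ α xs c u f *
        ∫⁻ z in B, jumpMass φ (Pi.single j 1) (fun i => u i + f i z) ∂α := by
    have hmBp : Measurable fun ω => compoundMeasure J x m j ω B *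
      expNeg (pairing (fun j z => (f j z : ℝ≥0∞)) fun j => compoundMeasure J x m j ω) := hmB.mul hmp
    simp_rw [← mul_assoc]
    rw [lintegral_prod_mul hmBp.aemeasurable hmE.aemeasurable, hE, hT2, fixedLap]
    ring
  have hI2 : ∀ l, ∫⁻ z : Ω × (ι → ℝ × (Fin d → ℝ)),
        ENNReal.ofReal ((z.2 l).2 j * (z.2 l).1) * B.indicator 1 (xs l) *
        (expNeg (pairing (fun j z => f j z) fun j => compoundMeasure J x m j z.1) *
          ∏ l, expNeg (markPairing (fun j => f j (xs l)) (z.2 l)))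
        ∂((CoRM.tilt P J x m u).prod (Measure.pi fun l => markLaw φ (c l) u))
      = fixedLap φ α xs c u f *
        (B.indicator 1 (xs l) * markRate φ (c l) j (fun i => u i + f i (xs l))) := by
    intro l
    have h1 : ∀ z : Ω × (ι → ℝ × (Fin d → ℝ)),
        ENNReal.ofReal ((z.2 l).2 j * (z.2 l).1) * B.indicator 1 (xs l) *
        (expNeg (pairing (fun j z => f j z) fun j => compoundMeasure J x m j z.1) *
          ∏ l, expNeg (markPairing (fun j => f j (xs l)) (z.2 l)))
        = (B.indicator 1 (xs l) *
          expNeg (pairing (fun j z => f j z) fun j => compoundMeasure J x m j z.1)) *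
          (ENNReal.ofReal ((z.2 l).2 j * (z.2 l).1) *
            ∏ l, expNeg (markPairing (fun j => f j (xs l)) (z.2 l))) := fun z => by ring
    have hmWE : Measurable fun y : ι → ℝ × (Fin d → ℝ) => ENNReal.ofReal ((y l).2 j * (y l).1) *
        ∏ l, expNeg (markPairing (fun j => f j (xs l)) (y l)) := (hmW l).mul hmE
    simp_rw [h1]
    rw [lintegral_prod_mul (hmp.const_mul _).aemeasurable hmWE.aemeasurable, hW,
      lintegral_const_mul _ hmp, hT1, fixedLap]
    ring
  rw [hI1, mul_add]
  congr 1
  simp_rw [Finset.sum_mul]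
  rw [lintegral_finsetSum _ fun l _ => ?_, Finset.mul_sum]
  · exact Finset.sum_congr rfl fun l _ => hI2 l
  · exact (((hmW l).comp measurable_snd).mul_const _).mul
      ((hmp.comp measurable_fst).mul (hmE.comp measurable_snd))

end FixedLaw


/-! ### Distinct values indexed by their first occurrences -/

section FirstOccurrence

variable {X : Type u} {N : ℕ} {d : ℕ}

open Classical in
/-- Products over the distinct values of a finite sequence, indexed by first occurrences. -/
lemma prod_first_eq {M : Type*} [CommMonoid M] (o : Fin N → X) (F : X → M) :
    ∏ l, (if ∀ i < l, o i ≠ o l then F (o l) else 1) = ∏ v ∈ Finset.univ.image o, F v := by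
  rw [← Finset.prod_filter]
  have h1 : Finset.univ.image o = (Finset.univ.filter fun l => ∀ i < l, o i ≠ o l).image o := by
    ext v
    simp only [Finset.mem_image, Finset.mem_univ, true_and, Finset.mem_filter]
    refine ⟨fun ⟨l, hl⟩ => ?_, fun ⟨l, _, hl⟩ => ⟨l, hl⟩⟩
    have hex : ∃ k : Fin N, o k = v := ⟨l, hl⟩
    obtain ⟨k, hk, hmin⟩ := WellFounded.has_min (wellFounded_lt (α := Fin N)) {k | o k = v} hex
    exact ⟨k, fun i hi hik => hmin i (hik.trans hk) hi, hk⟩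
  rw [h1, Finset.prod_image]
  intro k hk l hl hkl
  simp only [Finset.coe_filter, Finset.mem_univ, true_and, Set.mem_ofPred_eq] at hk hl
  rcases lt_trichotomy k l with h | h | h
  · exact absurd hkl (hl k h)
  · exact h
  · exact absurd hkl.symm (hk l h)

open Classical in
lemma sum_first_eq {M : Type*} [AddCommMonoid M] (o : Fin N → X) (F : X → M) :
    ∑ l, (if ∀ i < l, o i ≠ o l then F (o l) else 0) = ∑ v ∈ Finset.univ.image o, F v :=
  prod_first_eq (M := Multiplicative M) o F

open Classical in
/-- The number of observations of each group `j` that are equal to `v`. -/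
def obsCount (lab : Fin N → Fin d) (o : Fin N → X) (v : X) (j : Fin d) : ℕ :=
  ∑ i, if lab i = j ∧ o i = v then 1 else 0

open Classical in
/-- The counts of the value `o l`, if `l` is its first occurrence. -/
def firstCount (lab : Fin N → Fin d) (o : Fin N → X) (l : Fin N) : Fin d → ℕ :=
  if ∀ i < l, o i ≠ o l then obsCount lab o (o l) else 0

lemma obsCount_ne_zero (lab : Fin N → Fin d) (o : Fin N → X) (l : Fin N) :
    obsCount lab o (o l) ≠ 0 := by
  classical
  refine Function.ne_iff.2 ⟨lab l, ?_⟩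
  simp only [obsCount, Pi.zero_apply, ne_eq, Finset.sum_eq_zero_iff, not_forall]
  exact ⟨l, Finset.mem_univ l, by simp⟩

open Classical in
lemma obsCount_ne_zero_of_mem (lab : Fin N → Fin d) {o : Fin N → X} {v : X}
    (hv : v ∈ Finset.univ.image o) : obsCount lab o v ≠ 0 := by
  obtain ⟨l, _, rfl⟩ := Finset.mem_image.1 hv
  exact obsCount_ne_zero lab o l

open Classical in
lemma obsCount_eq_zero_of_notMem (lab : Fin N → Fin d) {o : Fin N → X} {v : X}
    (hv : v ∉ Finset.univ.image o) : obsCount lab o v = 0 := by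
  funext j
  refine Finset.sum_eq_zero fun i _ => if_neg fun h => hv ?_
  exact Finset.mem_image.2 ⟨i, Finset.mem_univ i, h.2⟩

open Classical in
-- This is the effect of one more observation: a unit added in its group at its own value, nothing
-- elsewhere.
lemma obsCount_snoc (lab : Fin N → Fin d) (j : Fin d) (o : Fin N → X) (z v : X) :
    obsCount (Fin.snoc lab j : Fin (N + 1) → Fin d) (Fin.snoc o z : Fin (N + 1) → X) v
      = obsCount lab o v + if z = v then Pi.single j 1 else 0 := by
  funext i
  simp only [obsCount, Fin.sum_univ_castSucc, Fin.snoc_castSucc, Fin.snoc_last, Pi.add_apply]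
  congr 1
  by_cases hz : z = v
  · simp [hz, Pi.single_apply, eq_comm]
  · simp [hz]

open Classical in
lemma image_snoc (o : Fin N → X) (z : X) :
    Finset.univ.image (Fin.snoc o z : Fin (N + 1) → X) = insert z (Finset.univ.image o) := by
  ext v
  simp only [Finset.mem_image, Finset.mem_univ, true_and, Finset.mem_insert, Fin.exists_fin_succ',
    Fin.snoc_castSucc, Fin.snoc_last]
  tauto

open Classical in
-- The number of distinct values varies with the sample, whereas first occurrences keep the index
-- set `Fin N` fixed, and the counts depend only on finitely many events `o i = o k`. This makes the
-- posterior a kernel.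
lemma measurable_firstCount [MeasurableSpace X] [MeasurableEq X] (lab : Fin N → Fin d)
    (l : Fin N) : Measurable fun o : Fin N → X => firstCount lab o l := by
  have h1 : ∀ i k : Fin N, MeasurableSet {o : Fin N → X | o i = o k} := fun i k =>
    measurableSet_eq_fun (measurable_pi_apply i) (measurable_pi_apply k)
  refine Measurable.ite ?_ ?_ measurable_const
  · simp only [Set.ofPred_forall]
    exact MeasurableSet.iInter fun i => MeasurableSet.iInter fun _ => (h1 i l).compl
  · refine measurable_pi_lambda _ fun j => Finset.measurable_sum _ fun i _ => ?_
    refine Measurable.ite ?_ measurable_const measurable_const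
    by_cases hi : lab i = j
    · simpa [hi] using h1 i l
    · simp [hi]

end FirstOccurrence

/-! ### The posterior as a Markov kernel -/

section PosteriorKernel

attribute [local irreducible] expNeg scoreWeight

variable {X : Type u} [MeasurableSpace X] {Ω : Type v} [MeasurableSpace Ω] {P : Measure Ω}
  [IsProbabilityMeasure P] {α : Measure X} [IsFiniteMeasure α] {φ : ℝ} [hφ : Fact (0 < φ)]
  {d : ℕ} {J : ℕ → Ω → ℝ} {x : ℕ → Ω → X} {m : ℕ × Fin d → Ω → ℝ} {N : ℕ}

lemma IsCompoundRep.measurable_tilt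
    (h : IsCompoundRep P (betaLevy φ) α (fun _ _ => gammaMeasure φ 1) J x m) :
    Measurable fun u : Fin d → ℝ≥0 => CoRM.tilt P J x m u := by
  have h1 : Measurable fun z : (Fin d → ℝ≥0) × Ω => expNeg (pairing (fun j _ => (z.1 j : ℝ≥0∞))
      fun j => compoundMeasure J x m j z.2) := by
    simp only [pairing, lintegral_const]
    have h2 : ∀ j, Measurable fun ω => compoundMeasure J x m j ω Set.univ := fun j =>
      (Measure.measurable_coe MeasurableSet.univ).comp
        ((measurable_pi_apply j).comp h.measurable_vec)
    refine measurable_expNeg.comp (Finset.measurable_sum _ fun j _ => ?_)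
    exact Measurable.mul (by fun_prop) ((h2 j).comp measurable_snd)
  refine Measure.measurable_of_measurable_coe _ fun B hB => ?_
  have h3 : ∀ u, CoRM.tilt P J x m u B = (∫⁻ ω, expNeg (pairing (fun j _ => (u j : ℝ≥0∞))
      fun j => compoundMeasure J x m j ω) ∂P)⁻¹ * ∫⁻ ω, expNeg (pairing (fun j _ => (u j : ℝ≥0∞))
      fun j => compoundMeasure J x m j ω) * B.indicator 1 ω ∂P := fun u => by
    rw [← lintegral_indicator_one hB, h.lintegral_tilt u (measurable_one.indicator hB),
      ← h.lintegral_expNeg_pairing (f := fun j _ => u j) fun j => measurable_const]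
  simp_rw [h3]
  exact h1.lintegral_prod_right'.inv.mul (h1.mul ((measurable_one.indicator hB).comp
    measurable_snd)).lintegral_prod_right'

lemma measurable_pi_markLaw {T ι : Type*} [MeasurableSpace T] [Fintype ι]
    {c : T → ι → Fin d → ℕ} (hc : Measurable c) {a : T → Fin d → ℝ≥0} (ha : Measurable a) :
    Measurable fun z => Measure.pi fun l => markLaw φ (c z l) (a z) := by
  refine Measurable.measure_of_isPiSystem_of_isProbabilityMeasure generateFrom_pi.symm
    isPiSystem_pi ?_
  rintro _ ⟨B, hB, rfl⟩
  have hB' : ∀ l, MeasurableSet (B l) := by simpa using hB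
  simp_rw [Measure.pi_pi]
  refine Finset.measurable_prod _ fun l _ => ?_
  exact (Measure.measurable_coe (hB' l)).comp (measurable_markLaw.comp
    (((measurable_pi_apply l).comp hc).prodMk ha))

open Classical in
-- Indices which are not first occurrences contribute the factor `1`, so the product runs over the
-- distinct values.
lemma fixedLap_firstCount (lab : Fin N → Fin d) (o : Fin N → X) (u : Fin d → ℝ≥0)
    (f : Fin d → X → ℝ≥0) : fixedLap φ α o (firstCount lab o) u f
      = (expNeg (lapExponent φ α fun j _ => u j))⁻¹ *
          expNeg (lapExponent φ α fun j z => u j + f j z) *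
        ∏ v ∈ Finset.univ.image o, markQuot φ (obsCount lab o v) (fun j => u j + f j v) u := by
  rw [fixedLap, ← prod_first_eq]
  congr 1
  refine Finset.prod_congr rfl fun l _ => ?_
  rw [firstCount]
  split_ifs
  · rfl
  · simp [markQuot]

variable [MeasurableEq X]

/-- The posterior law of a vector of compound random measures, given the observations and the
latent variables. -/
def IsCompoundRep.posterior
    (h : IsCompoundRep P (betaLevy φ) α (fun _ _ => gammaMeasure φ 1) J x m)
    (lab : Fin N → Fin d) : Kernel ((Fin N → X) × (Fin d → ℝ≥0)) (Fin d → Measure X) where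
  toFun z := fixedLaw P φ J x m z.1 (firstCount lab z.1) z.2
  measurable' := by
    have hprob := h.isProbabilityMeasure_tilt
    -- The two independent ingredients are kernels in the data, so measurability of the pushforward
    -- follows from that of the map in all its arguments.
    let κ₁ : Kernel ((Fin N → X) × (Fin d → ℝ≥0)) Ω :=
      ⟨fun z => CoRM.tilt P J x m z.2, h.measurable_tilt.comp measurable_snd⟩
    let κ₂ : Kernel ((Fin N → X) × (Fin d → ℝ≥0)) (Fin N → ℝ × (Fin d → ℝ)) :=
      ⟨fun z => Measure.pi fun l => markLaw φ (firstCount lab z.1 l) z.2,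
        measurable_pi_markLaw (measurable_pi_lambda _ fun l =>
          (measurable_firstCount lab l).comp measurable_fst) measurable_snd⟩
    have : IsMarkovKernel κ₁ := ⟨fun z => hprob z.2⟩
    have : IsMarkovKernel κ₂ := ⟨fun z =>
      inferInstanceAs (IsProbabilityMeasure (Measure.pi fun l => markLaw φ _ z.2))⟩
    have hF : Measurable fun z : ((Fin N → X) × (Fin d → ℝ≥0)) × (Ω × (Fin N → ℝ × (Fin d → ℝ))) =>
        addFixed z.1.1 (fun j => compoundMeasure J x m j z.2.1) z.2.2 :=
      measurable_addFixed.comp ((measurable_fst.comp measurable_fst).prodMk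
        ((h.measurable_vec.comp (measurable_fst.comp measurable_snd)).prodMk
          (measurable_snd.comp measurable_snd)))
    refine Measure.measurable_of_measurable_coe _ fun B hB => ?_
    have h1 : ∀ z : (Fin N → X) × (Fin d → ℝ≥0),
        fixedLaw P φ J x m z.1 (firstCount lab z.1) z.2 B = ∫⁻ y,
          B.indicator 1 (addFixed z.1 (fun j => compoundMeasure J x m j y.1) y.2)
          ∂((κ₁ ×ₖ κ₂) z) := fun z => by
      rw [Kernel.prod_apply, fixedLaw, ← lintegral_indicator_one hB,
        lintegral_map (measurable_one.indicator hB) (h.measurable_fixed z.1)]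
      rfl
    simp_rw [h1]
    exact ((measurable_one.indicator hB).comp hF).lintegral_kernel_prod_right'

instance (h : IsCompoundRep P (betaLevy φ) α (fun _ _ => gammaMeasure φ 1) J x m)
    (lab : Fin N → Fin d) : IsMarkovKernel (h.posterior lab) :=
  ⟨fun _ => h.isProbabilityMeasure_fixedLaw _ _ _⟩

end PosteriorKernel

/-! ### Update of the Laplace functional by one observation -/

section OneStep

attribute [local irreducible] expNeg scoreWeight

variable {X : Type u} [MeasurableSpace X] {Ω : Type v} [MeasurableSpace Ω] {P : Measure Ω}
  [IsProbabilityMeasure P] {α : Measure X} [IsFiniteMeasure α] {φ : ℝ} [hφ : Fact (0 < φ)]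
  {d : ℕ} {J : ℕ → Ω → ℝ} {x : ℕ → Ω → X} {m : ℕ × Fin d → Ω → ℝ} {N : ℕ}

open Classical in
-- A new value only adds a quotient of single-observation masses, and the prefactor cancels its
-- denominator.
lemma fixedLap_snoc_of_notMem (lab : Fin N → Fin d) (j : Fin d) {o : Fin N → X} {z : X}
    (hz : z ∉ Finset.univ.image o) (u : Fin d → ℝ≥0) (f : Fin d → X → ℝ≥0) :
    jumpMass φ (Pi.single j 1) u * fixedLap φ α (Fin.snoc o z : Fin (N + 1) → X)
        (firstCount (Fin.snoc lab j : Fin (N + 1) → Fin d) (Fin.snoc o z : Fin (N + 1) → X)) u f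
      = fixedLap φ α o (firstCount lab o) u f *
        jumpMass φ (Pi.single j 1) (fun i => u i + f i z) := by
  have hs : (Pi.single j 1 : Fin d → ℕ) ≠ 0 := by simp
  rw [fixedLap_firstCount, fixedLap_firstCount, image_snoc, Finset.prod_insert hz,
    obsCount_snoc, if_pos rfl, obsCount_eq_zero_of_notMem lab hz, zero_add, markQuot, if_neg hs]
  have h1 : ∏ v ∈ Finset.univ.image o, markQuot φ (obsCount (Fin.snoc lab j : Fin (N + 1) → Fin d)
      (Fin.snoc o z : Fin (N + 1) → X) v) (fun j => u j + f j v) u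
      = ∏ v ∈ Finset.univ.image o, markQuot φ (obsCount lab o v) (fun j => u j + f j v) u :=
    Finset.prod_congr rfl fun v hv => by
      rw [obsCount_snoc, if_neg (by rintro rfl; exact hz hv), add_zero]
  rw [h1]
  have h2 : jumpMass φ (Pi.single j 1) u * (jumpMass φ (Pi.single j 1) (fun i => u i + f i z) /
      jumpMass φ (Pi.single j 1) u) = jumpMass φ (Pi.single j 1) (fun i => u i + f i z) :=
    ENNReal.mul_div_cancel (jumpMass_ne_zero _ _) (jumpMass_ne_top hs _)
  conv_rhs => rw [← h2]
  ring

open Classical in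
-- Only the factor of `z` changes, and its quotients of masses telescope: the intermediate masses
-- with counts `c` and `c + 1` cancel, being positive and finite.
lemma fixedLap_snoc_of_mem (lab : Fin N → Fin d) (j : Fin d) {o : Fin N → X} {z : X}
    (hz : z ∈ Finset.univ.image o) (u : Fin d → ℝ≥0) (f : Fin d → X → ℝ≥0) :
    markRate φ (obsCount lab o z) j u * fixedLap φ α (Fin.snoc o z : Fin (N + 1) → X)
        (firstCount (Fin.snoc lab j : Fin (N + 1) → Fin d) (Fin.snoc o z : Fin (N + 1) → X)) u f
      = fixedLap φ α o (firstCount lab o) u f *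
        markRate φ (obsCount lab o z) j (fun i => u i + f i z) := by
  have hc := obsCount_ne_zero_of_mem lab hz
  have hs : obsCount lab o z + (Pi.single j 1 : Fin d → ℕ) ≠ 0 := by simp [hc]
  rw [fixedLap_firstCount, fixedLap_firstCount, image_snoc, Finset.insert_eq_of_mem hz,
    ← Finset.mul_prod_erase _ _ hz, ← Finset.mul_prod_erase _ (fun v => markQuot φ
      (obsCount lab o v) (fun j => u j + f j v) u) hz, obsCount_snoc, if_pos rfl]
  have h1 : ∏ v ∈ (Finset.univ.image o).erase z,
      markQuot φ (obsCount (Fin.snoc lab j : Fin (N + 1) → Fin d)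
        (Fin.snoc o z : Fin (N + 1) → X) v) (fun j => u j + f j v) u
      = ∏ v ∈ (Finset.univ.image o).erase z,
        markQuot φ (obsCount lab o v) (fun j => u j + f j v) u :=
    Finset.prod_congr rfl fun v hv => by
      rw [obsCount_snoc, if_neg (fun h => Finset.ne_of_mem_erase hv h.symm), add_zero]
  have h2 : markRate φ (obsCount lab o z) j u *
        markQuot φ (obsCount lab o z + Pi.single j 1) (fun j => u j + f j z) u
      = markQuot φ (obsCount lab o z) (fun j => u j + f j z) u *
        markRate φ (obsCount lab o z) j (fun i => u i + f i z) := by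
    simp only [markRate, markQuot, if_neg hc, if_neg hs, div_eq_mul_inv]
    have e1 := ENNReal.mul_inv_cancel (jumpMass_ne_zero (φ := φ)
      (obsCount lab o z + Pi.single j 1) u) (jumpMass_ne_top hs u)
    have e2 := ENNReal.mul_inv_cancel (jumpMass_ne_zero (φ := φ)
      (obsCount lab o z) fun i => u i + f i z) (jumpMass_ne_top hc _)
    calc _ = jumpMass φ (obsCount lab o z + Pi.single j 1) (fun i => u i + f i z) *
          (jumpMass φ (obsCount lab o z) u)⁻¹ *
          (jumpMass φ (obsCount lab o z + Pi.single j 1) u *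
          (jumpMass φ (obsCount lab o z + Pi.single j 1) u)⁻¹) := by ring
      _ = jumpMass φ (obsCount lab o z + Pi.single j 1) (fun i => u i + f i z) *
          (jumpMass φ (obsCount lab o z) u)⁻¹ *
          (jumpMass φ (obsCount lab o z) (fun i => u i + f i z) *
          (jumpMass φ (obsCount lab o z) fun i => u i + f i z)⁻¹) := by rw [e1, e2]
      _ = _ := by ring
  rw [h1]
  calc _ = (expNeg (lapExponent φ α fun j _ => u j))⁻¹ *
          expNeg (lapExponent φ α fun j z => u j + f j z) *
          ((markRate φ (obsCount lab o z) j u *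
            markQuot φ (obsCount lab o z + Pi.single j 1) (fun j => u j + f j z) u) *
          ∏ v ∈ (Finset.univ.image o).erase z,
            markQuot φ (obsCount lab o v) (fun j => u j + f j v) u) := by ring
    _ = _ := by rw [h2]; ring

end OneStep


/-! ### Disintegration of the posterior along the next observation -/

section Disintegration

attribute [local irreducible] expNeg scoreWeight

variable {X : Type u} [MeasurableSpace X] [MeasurableEq X] {Ω : Type v} [MeasurableSpace Ω]
  {P : Measure Ω} [IsProbabilityMeasure P] {α : Measure X} [IsFiniteMeasure α]
  [NullSingletonClass α] {φ : ℝ} [hφ : Fact (0 < φ)]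
  {d : ℕ} {J : ℕ → Ω → ℝ} {x : ℕ → Ω → X} {m : ℕ × Fin d → Ω → ℝ} {N : ℕ}

lemma measurable_normalize {E : Type*} [MeasurableSpace E] :
    Measurable (normalize : Measure E → Measure E) := by
  refine Measure.measurable_of_measurable_coe _ fun B hB => ?_
  simp only [normalize, Measure.smul_apply, smul_eq_mul]
  exact (Measure.measurable_coe MeasurableSet.univ).inv.mul (Measure.measurable_coe hB)

/-- The conditional law, given the random measures, of an observation in group `j`. -/
def samplingKernel (X : Type u) [MeasurableSpace X] {d : ℕ} (j : Fin d) :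
    Kernel (Fin d → Measure X) X :=
  ⟨fun M => normalize (M j), measurable_normalize.comp (measurable_pi_apply j)⟩

lemma samplingKernel_apply (j : Fin d) (M : Fin d → Measure X) :
    samplingKernel X j M = normalize (M j) := rfl

instance (j : Fin d) : IsFiniteKernel (samplingKernel X j) :=
  ⟨1, ENNReal.one_lt_top, fun M => by
    rw [samplingKernel_apply, normalize, Measure.smul_apply, smul_eq_mul, mul_comm]
    exact ENNReal.mul_inv_le_one _⟩

lemma univ_mul_normalize_apply {E : Type*} [MeasurableSpace E] {M : Measure E}
    (hM : M Set.univ ≠ ∞) (B : Set E) : M Set.univ * normalize M B = M B := by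
  rw [normalize, Measure.smul_apply, smul_eq_mul, ← mul_assoc]
  by_cases h0 : M Set.univ = 0
  · rw [h0, zero_mul, zero_mul]
    exact (measure_mono_null (Set.subset_univ B) h0).symm
  · rw [ENNReal.mul_inv_cancel h0 hM, one_mul]

lemma measurable_eval_apply (j : Fin d) {B : Set X} (hB : MeasurableSet B) :
    Measurable fun M : Fin d → Measure X => M j B :=
  (Measure.measurable_coe hB).comp (measurable_pi_apply j)

open Classical in
/-- The predictive intensity of the next observation, in group `j`. -/
def predictive (φ : ℝ) (α : Measure X) (lab : Fin N → Fin d) (j : Fin d) (o : Fin N → X)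
    (u : Fin d → ℝ≥0) : Measure X :=
  jumpMass φ (Pi.single j 1) u • α +
    ∑ v ∈ Finset.univ.image o, markRate φ (obsCount lab o v) j u • Measure.dirac v

open Classical in
lemma lintegral_predictive (lab : Fin N → Fin d) (j : Fin d) (o : Fin N → X)
    (u : Fin d → ℝ≥0) {F : X → ℝ≥0∞} (hF : Measurable F) :
    ∫⁻ z, F z ∂(predictive φ α lab j o u) = jumpMass φ (Pi.single j 1) u * ∫⁻ z, F z ∂α +
      ∑ v ∈ Finset.univ.image o, markRate φ (obsCount lab o v) j u * F v := by
  simp only [predictive, lintegral_add_measure, lintegral_finsetSum_measure,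
    lintegral_smul_measure, lintegral_dirac' _ hF, smul_eq_mul]

open Classical in
lemma markRate_ne_top (c : Fin d → ℕ) (j : Fin d) (u : Fin d → ℝ≥0) : markRate φ c j u ≠ ∞ := by
  rw [markRate]
  split_ifs with hc
  · exact ENNReal.zero_ne_top
  · exact ENNReal.div_ne_top (jumpMass_ne_top (by simp [hc]) _) (jumpMass_ne_zero _ _)

instance (lab : Fin N → Fin d) (j : Fin d) (o : Fin N → X) (u : Fin d → ℝ≥0) :
    IsFiniteMeasure (predictive φ α lab j o u) := by
  classical
  refine ⟨?_⟩
  rw [← setLIntegral_one, setLIntegral_univ, lintegral_predictive _ _ _ _ measurable_const]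
  refine ENNReal.add_lt_top.2 ⟨ENNReal.mul_lt_top (jumpMass_ne_top (by simp) u).lt_top ?_, ?_⟩
  · simp
  · exact ENNReal.sum_lt_top.2 fun v _ => by simpa using (markRate_ne_top _ _ _).lt_top

/-- The posterior law after one more observation, as a kernel in that observation. -/
def IsCompoundRep.nextPosterior
    (h : IsCompoundRep P (betaLevy φ) α (fun _ _ => gammaMeasure φ 1) J x m)
    (lab : Fin N → Fin d) (j : Fin d) (o : Fin N → X) (u : Fin d → ℝ≥0) :
    Kernel X (Fin d → Measure X) :=
  (h.posterior (Fin.snoc lab j : Fin (N + 1) → Fin d)).comap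
    (fun z => ((Fin.snoc o z : Fin (N + 1) → X), u))
    (by
      refine Measurable.prodMk (measurable_pi_lambda _ fun i => ?_) measurable_const
      refine Fin.lastCases ?_ (fun i => ?_) i
      · simp only [Fin.snoc_last]
        exact measurable_id
      · simp)

instance (h : IsCompoundRep P (betaLevy φ) α (fun _ _ => gammaMeasure φ 1) J x m)
    (lab : Fin N → Fin d) (j : Fin d) (o : Fin N → X) (u : Fin d → ℝ≥0) :
    IsMarkovKernel (h.nextPosterior lab j o u) := by
  unfold IsCompoundRep.nextPosterior
  infer_instance

/-- The core of the induction. Weighting by `M j B` is, in Laplace functionals, a mixture over the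
location of the next observation in `B`: the diffuse part of the predictive intensity matches new
values, its atoms match repeated ones, each through the corresponding one-step identity. -/
lemma IsCompoundRep.lintegral_apply_posterior
    (h : IsCompoundRep P (betaLevy φ) α (fun _ _ => gammaMeasure φ 1) J x m)
    (lab : Fin N → Fin d) (j : Fin d) (o : Fin N → X) (u : Fin d → ℝ≥0)
    {f : Fin d → X → ℝ≥0} (hf : ∀ j, Measurable (f j)) {B : Set X} (hB : MeasurableSet B) :
    ∫⁻ M, M j B * expNeg (pairing (fun j z => f j z) M) ∂(h.posterior lab (o, u))
      = ∫⁻ z in B, ∫⁻ M, expNeg (pairing (fun j z => f j z) M) ∂(h.nextPosterior lab j o u z)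
        ∂(predictive φ α lab j o u) := by
  classical
  have hE : Measurable fun M => expNeg (pairing (fun j z => (f j z : ℝ≥0∞)) M) :=
    measurable_expNeg.comp (measurable_pairing fun j => (hf j).coe_nnreal_ennreal)
  have hL : Measurable fun z => ∫⁻ M, expNeg (pairing (fun j z => (f j z : ℝ≥0∞)) M)
      ∂(h.nextPosterior lab j o u z) :=
    (Measure.measurable_lintegral hE).comp (h.nextPosterior lab j o u).measurable
  have hnext : ∀ z, ∫⁻ M, expNeg (pairing (fun j z => (f j z : ℝ≥0∞)) M)
      ∂(h.nextPosterior lab j o u z) = fixedLap φ α (Fin.snoc o z : Fin (N + 1) → X)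
        (firstCount (Fin.snoc lab j : Fin (N + 1) → Fin d) (Fin.snoc o z : Fin (N + 1) → X)) u f :=
    fun z => h.lintegral_expNeg_fixedLaw _ _ u hf
  have hjm : Measurable fun z => jumpMass φ (Pi.single j 1) fun i => u i + f i z :=
    (measurable_jumpMass _).comp (measurable_pi_lambda _ fun i => (hf i).const_add (u i))
  refine (h.lintegral_apply_mul_expNeg_fixedLaw o (firstCount lab o) u hf j hB).trans ?_
  rw [← lintegral_indicator hB (fun z => ∫⁻ M, _ ∂(h.nextPosterior lab j o u z)),
    lintegral_predictive _ _ _ _ (hL.indicator hB),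
    lintegral_indicator hB, mul_add]
  congr 1
  · rw [← lintegral_const_mul _ hjm, ← lintegral_const_mul _ hL]
    -- This is where diffuseness of `α` enters: a location drawn from `α` almost surely avoids the
    -- finitely many values already seen.
    have hae : ∀ᵐ z ∂(α.restrict B), z ∉ Finset.univ.image o :=
      ae_restrict_of_ae (measure_eq_zero_iff_ae_notMem.1 (Finset.measure_zero _ α))
    refine lintegral_congr_ae ?_
    filter_upwards [hae] with z hz
    rw [hnext, fixedLap_snoc_of_notMem lab j hz]
  · have h1 : ∀ l, B.indicator 1 (o l) * markRate φ (firstCount lab o l) j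
          (fun i => u i + f i (o l))
        = if ∀ i < l, o i ≠ o l then B.indicator 1 (o l) * markRate φ (obsCount lab o (o l)) j
          (fun i => u i + f i (o l)) else 0 := fun l => by
      rw [firstCount]
      split_ifs
      · rfl
      · simp [markRate]
    simp_rw [h1]
    rw [sum_first_eq o fun v => B.indicator 1 v * markRate φ (obsCount lab o v) j
      (fun i => u i + f i v), Finset.mul_sum]
    refine Finset.sum_congr rfl fun v hv => ?_
    by_cases hvB : v ∈ B
    · rw [Set.indicator_of_mem hvB, Set.indicator_of_mem hvB, hnext,
        fixedLap_snoc_of_mem lab j hv, Pi.one_apply, one_mul]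
    · simp [hvB]

/-- The test function zero. Since the predictive intensity is finite, the posterior masses are
almost surely finite. -/
lemma IsCompoundRep.lintegral_eval_posterior
    (h : IsCompoundRep P (betaLevy φ) α (fun _ _ => gammaMeasure φ 1) J x m)
    (lab : Fin N → Fin d) (j : Fin d) (o : Fin N → X) (u : Fin d → ℝ≥0)
    {B : Set X} (hB : MeasurableSet B) :
    ∫⁻ M, M j B ∂(h.posterior lab (o, u)) = predictive φ α lab j o u B := by
  have hpair0 : ∀ M : Fin d → Measure X, pairing (fun j z => (((0 : Fin d → X → ℝ≥0) j z : ℝ≥0) :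
      ℝ≥0∞)) M = 0 := fun M => by simp [pairing]
  have := h.lintegral_apply_posterior lab j o u (f := 0) (fun _ => measurable_zero) hB
  simpa only [hpair0, expNeg_zero, mul_one, lintegral_const, measure_univ,
    Measure.restrict_apply MeasurableSet.univ, Set.univ_inter, one_mul] using this

/-- The disintegration of the joint law of the random measures and the next observation. -/
lemma IsCompoundRep.compProd_posterior
    (h : IsCompoundRep P (betaLevy φ) α (fun _ _ => gammaMeasure φ 1) J x m)
    (lab : Fin N → Fin d) (j : Fin d) (o : Fin N → X) (u : Fin d → ℝ≥0) :
    ((h.posterior lab (o, u)).withDensity fun M => M j Set.univ) ⊗ₘ samplingKernel X j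
      = (predictive φ α lab j o u ⊗ₘ h.nextPosterior lab j o u).map Prod.swap := by
  have hmean := fun {B : Set X} (hB : MeasurableSet B) => h.lintegral_eval_posterior lab j o u hB
  have hfin : ∀ᵐ M ∂(h.posterior lab (o, u)), M j Set.univ ≠ ∞ := by
    have := ae_lt_top (measurable_eval_apply j MeasurableSet.univ)
      (by rw [hmean MeasurableSet.univ]; exact measure_ne_top _ _)
    filter_upwards [this] with M hM using hM.ne
  have hfm : ∀ {B : Set X}, MeasurableSet B →
      IsFiniteMeasure ((h.posterior lab (o, u)).withDensity fun M => M j B) := fun {B} hB =>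
    isFiniteMeasure_withDensity (by rw [hmean hB]; exact measure_ne_top _ _)
  have := hfm MeasurableSet.univ
  refine Measure.ext_prod fun {C B} hC hB => ?_
  have := hfm hB
  -- For fixed `B` both sides are finite laws of vectors of measures, so equality of Laplace
  -- functionals suffices.
  have key : (h.posterior lab (o, u)).withDensity (fun M => M j B)
      = ((predictive φ α lab j o u).restrict B).bind (h.nextPosterior lab j o u) := by
    refine ext_of_lintegral_pairing fun f hf => ?_
    have hE : Measurable fun M => expNeg (pairing (fun j z => (f j z : ℝ≥0∞)) M) :=
      measurable_expNeg.comp (measurable_pairing fun j => (hf j).coe_nnreal_ennreal)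
    rw [lintegral_withDensity_eq_lintegral_mul _ (measurable_eval_apply j hB) hE,
      Measure.lintegral_bind (h.nextPosterior lab j o u).measurable.aemeasurable hE.aemeasurable]
    exact h.lintegral_apply_posterior lab j o u hf hB
  rw [Measure.compProd_apply_prod hC hB, Measure.map_apply measurable_swap (hC.prod hB),
    Set.preimage_swap_prod, Measure.compProd_apply_prod hB hC,
    setLIntegral_withDensity_eq_setLIntegral_mul _ (measurable_eval_apply j MeasurableSet.univ)
      ((samplingKernel X j).measurable_coe hB) hC]
  have h1 := congrArg (fun Q => Q C) key
  simp only [withDensity_apply _ hC] at h1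
  rw [Measure.bind_apply hC (h.nextPosterior lab j o u).measurable.aemeasurable] at h1
  rw [← h1]
  refine lintegral_congr_ae (ae_restrict_of_ae ?_)
  -- The density `M j univ` cancels the normalization of the sampling law, which requires a finite
  -- total mass.
  filter_upwards [hfin] with M hM
  exact univ_mul_normalize_apply hM B

/-- Bayes' rule for one more observation. -/
lemma IsCompoundRep.lintegral_posterior_next
    (h : IsCompoundRep P (betaLevy φ) α (fun _ _ => gammaMeasure φ 1) J x m)
    (lab : Fin N → Fin d) (j : Fin d) (o : Fin N → X) (u : Fin d → ℝ≥0)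
    {K : X × (Fin d → Measure X) → ℝ≥0∞} (hK : Measurable K) :
    ∫⁻ M, M j Set.univ * ∫⁻ z, K (z, M) ∂(samplingKernel X j M) ∂(h.posterior lab (o, u))
      = ∫⁻ M, M j Set.univ * ∫⁻ z, ∫⁻ M', K (z, M') ∂(h.nextPosterior lab j o u z)
        ∂(samplingKernel X j M) ∂(h.posterior lab (o, u)) := by
  have key : ∀ {K : X × (Fin d → Measure X) → ℝ≥0∞}, Measurable K →
      ∫⁻ M, M j Set.univ * ∫⁻ z, K (z, M) ∂(samplingKernel X j M) ∂(h.posterior lab (o, u))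
      = ∫⁻ z, ∫⁻ M, K (z, M) ∂(h.nextPosterior lab j o u z) ∂(predictive φ α lab j o u) := by
    intro K hK
    have hKs : Measurable fun y : (Fin d → Measure X) × X => K y.swap := hK.comp measurable_swap
    have hf : IsFiniteMeasure ((h.posterior lab (o, u)).withDensity fun M => M j Set.univ) :=
      isFiniteMeasure_withDensity
        (by rw [h.lintegral_eval_posterior _ _ _ _ MeasurableSet.univ]; exact measure_ne_top _ _)
    have hKint : Measurable fun M => ∫⁻ z, K (z, M) ∂(samplingKernel X j M) :=
      Measurable.lintegral_kernel_prod_right' hKs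
    have h1 := congrArg (fun Q => ∫⁻ y, K y.swap ∂Q) (h.compProd_posterior lab j o u)
    rw [Measure.lintegral_compProd hKs, lintegral_map hKs measurable_swap] at h1
    simp only [Prod.swap_swap, Prod.swap_prod_mk] at h1
    rw [Measure.lintegral_compProd hK, lintegral_withDensity_eq_lintegral_mul _
      (measurable_eval_apply j MeasurableSet.univ)
      hKint] at h1
    exact h1
  -- The right side is the same formula for a function of the observation alone, on which the next
  -- posterior, a probability law, acts trivially.
  have hK' : Measurable fun y : X × (Fin d → Measure X) =>
      ∫⁻ M', K (y.1, M') ∂(h.nextPosterior lab j o u y.1) :=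
    (Measurable.lintegral_kernel_prod_right' hK).comp measurable_fst
  rw [key hK, key hK']
  simp

end Disintegration


/-- Subfamilies of conditionally independent families are conditionally independent. -/
lemma IsCondIndepWithLaws.comp_injective {Ω : Type v} [MeasurableSpace Ω] {P : Measure Ω}
    {F E ι ι' : Type*} [MeasurableSpace F] [MeasurableSpace E] {Z : Ω → F} {Y : ι → Ω → E}
    {K : ι → F → Measure E} (h : IsCondIndepWithLaws P Z Y K) {e : ι' → ι}
    (he : Function.Injective e) :
    IsCondIndepWithLaws P Z (fun i => Y (e i)) fun i => K (e i) := by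
  refine ⟨h.measurable_cond, fun i => h.measurable _, fun s B D hB hD => ?_⟩
  have hB' : ∀ i, MeasurableSet (Function.extend e B (fun _ => Set.univ) i) := fun i => by
    by_cases hi : ∃ a, e a = i
    · obtain ⟨a, rfl⟩ := hi
      rw [he.extend_apply]
      exact hB a
    · rw [Function.extend_apply' _ _ _ hi]
      exact MeasurableSet.univ
  have h1 := h.law (s.map ⟨e, he⟩) (Function.extend e B fun _ => Set.univ) D hB' hD
  simp only [Finset.prod_map, Function.Embedding.coeFn_mk, he.extend_apply] at h1
  rw [← h1]
  congr 2
  ext ω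
  simp [he.extend_apply]

/-! ### Integrating out the last conditionally independent observation -/

section LastObservation

variable {Ω : Type v} [MeasurableSpace Ω] {P : Measure Ω} [IsProbabilityMeasure P]
  {F E : Type*} [MeasurableSpace F] [MeasurableSpace E] {Z : Ω → F} {N : ℕ}
  {Y : Fin (N + 1) → Ω → E} {κ : Fin (N + 1) → Kernel F E} [∀ i, IsFiniteKernel (κ i)]

/-- The conditional law of the last of finitely many conditionally independent observations. -/
lemma IsCondIndepWithLaws.lintegral_last
    (h : IsCondIndepWithLaws P Z Y fun i z => κ i z) {K : (F × (Fin N → E)) × E → ℝ≥0∞}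
    (hK : Measurable K) :
    ∫⁻ ω, K ((Z ω, fun i => Y i.castSucc ω), Y (Fin.last N) ω) ∂P
      = ∫⁻ ω, ∫⁻ z, K ((Z ω, fun i => Y i.castSucc ω), z) ∂(κ (Fin.last N) (Z ω)) ∂P := by
  have hZ := h.measurable_cond
  have hY : Measurable fun ω (i : Fin N) => Y i.castSucc ω :=
    measurable_pi_lambda _ fun i => h.measurable _
  have hL := h.measurable (Fin.last N)
  have hZY := hZ.prodMk hY
  -- integrals against the law of `Z` on the event that the other observations lie in a box
  have hbox : ∀ (B : Fin N → Set E), (∀ i, MeasurableSet (B i)) → ∀ g : F → ℝ≥0∞, Measurable g →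
      ∫⁻ ω in ⋂ i, Y i.castSucc ⁻¹' B i, g (Z ω) ∂P
        = ∫⁻ ω, g (Z ω) * ∏ i, κ (Fin.castSucc i) (Z ω) (B i) ∂P := by
    intro B hB g hg
    have hmp : Measurable fun ω => ∏ i, κ (Fin.castSucc i) (Z ω) (B i) :=
      Finset.measurable_prod _ fun i _ => ((κ _).measurable_coe (hB i)).comp hZ
    -- Letting the set of values of `Z` vary in the defining identity turns it into an equality of
    -- measures, which extends to all functions of `Z`.
    have h1 : (P.restrict (⋂ i, Y i.castSucc ⁻¹' B i)).map Z
        = (P.withDensity fun ω => ∏ i, κ (Fin.castSucc i) (Z ω) (B i)).map Z := by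
      ext D hD
      rw [Measure.map_apply hZ hD, Measure.map_apply hZ hD, Measure.restrict_apply (hZ hD),
        withDensity_apply _ (hZ hD)]
      have h2 := (h.comp_injective (Fin.castSucc_injective N)).law Finset.univ B D hB hD
      simp only [Finset.mem_univ, Set.iInter_true] at h2
      exact h2
    have hgZ : Measurable fun ω => g (Z ω) := hg.comp hZ
    rw [← lintegral_map hg hZ, h1, lintegral_map hg hZ,
      lintegral_withDensity_eq_lintegral_mul _ hmp hgZ]
    exact lintegral_congr fun ω => mul_comm _ _
  have hQ : P.map (fun ω => ((Z ω, fun i : Fin N => Y i.castSucc ω), Y (Fin.last N) ω))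
      = (P.map fun ω => (Z ω, fun i : Fin N => Y i.castSucc ω)) ⊗ₘ
        ((κ (Fin.last N)).comap Prod.fst measurable_fst) := by
    have hprob : IsProbabilityMeasure (P.map fun ω => (Z ω, fun i : Fin N => Y i.castSucc ω)) :=
      Measure.isProbabilityMeasure_map hZY.aemeasurable
    have hprob' : IsProbabilityMeasure
        (P.map fun ω => ((Z ω, fun i : Fin N => Y i.castSucc ω), Y (Fin.last N) ω)) :=
      Measure.isProbabilityMeasure_map (hZY.prodMk hL).aemeasurable
    refine (Measure.ext_prod₃_iff' (μ := _) (ν := _)).2 fun {D T C} hD hT hC => ?_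
    rw [Measure.map_apply (hZY.prodMk hL) ((hD.prod hT).prod hC),
      Measure.compProd_apply_prod (hD.prod hT) hC,
      setLIntegral_map (hD.prod hT) (((κ _).comap _ _).measurable_coe hC) hZY]
    -- The hypothesis concerns boxes only; two finite measures agreeing on this generating π-system
    -- agree on every `T`.
    have key : (P.restrict (Z ⁻¹' D ∩ Y (Fin.last N) ⁻¹' C)).map
          (fun ω (i : Fin N) => Y i.castSucc ω)
        = ((P.restrict (Z ⁻¹' D)).withDensity fun ω => κ (Fin.last N) (Z ω) C).map
          (fun ω (i : Fin N) => Y i.castSucc ω) := by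
      have hbox' : ∀ B : Fin N → Set E, (∀ i, MeasurableSet (B i)) →
          (P.restrict (Z ⁻¹' D ∩ Y (Fin.last N) ⁻¹' C)).map
            (fun ω (i : Fin N) => Y i.castSucc ω) (Set.univ.pi B)
          = ((P.restrict (Z ⁻¹' D)).withDensity fun ω => κ (Fin.last N) (Z ω) C).map
            (fun ω (i : Fin N) => Y i.castSucc ω) (Set.univ.pi B) := by
        intro B hB
        have hBm : MeasurableSet (Set.univ.pi B) := MeasurableSet.univ_pi hB
        have hpre : (fun ω (i : Fin N) => Y i.castSucc ω) ⁻¹' (Set.univ.pi B)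
            = ⋂ i, Y i.castSucc ⁻¹' B i := by ext ω; simp
        have h2 := h.law Finset.univ (Fin.snoc B C : Fin (N + 1) → Set E) D (fun i => by
          refine Fin.lastCases ?_ (fun i => ?_) i
          · simpa using hC
          · simpa using hB i) hD
        have hset : Z ⁻¹' D ∩ ⋂ i ∈ (Finset.univ : Finset (Fin (N + 1))),
              Y i ⁻¹' (Fin.snoc B C : Fin (N + 1) → Set E) i
            = (⋂ i, Y (Fin.castSucc i) ⁻¹' B i) ∩ (Z ⁻¹' D ∩ Y (Fin.last N) ⁻¹' C) := by
          ext ω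
          simp only [Set.mem_inter_iff, Set.mem_iInter, Finset.mem_univ, true_imp_iff,
            Fin.forall_fin_succ', Fin.snoc_castSucc, Fin.snoc_last]
          tauto
        rw [Measure.map_apply hY hBm, Measure.map_apply hY hBm, hpre,
          Measure.restrict_apply (hpre ▸ hY hBm), ← hset, h2,
          withDensity_apply _ (hpre ▸ hY hBm), Measure.restrict_restrict (hpre ▸ hY hBm)]
        have h3 := hbox B hB (D.indicator fun z => κ (Fin.last N) z C)
          (((κ _).measurable_coe hC).indicator hD)
        have h4 : ∀ ω, D.indicator (fun z => κ (Fin.last N) z C) (Z ω)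
            = (Z ⁻¹' D).indicator (fun ω => κ (Fin.last N) (Z ω) C) ω := fun ω => rfl
        simp_rw [h4] at h3
        rw [lintegral_indicator (hZ hD), Measure.restrict_restrict (hZ hD), Set.inter_comm] at h3
        rw [h3, ← lintegral_indicator (hZ hD)]
        refine lintegral_congr fun ω => ?_
        by_cases hω : ω ∈ Z ⁻¹' D
        · rw [Set.indicator_of_mem hω, Set.indicator_of_mem hω, Fin.prod_univ_castSucc]
          simp [mul_comm]
        · rw [Set.indicator_of_notMem hω, Set.indicator_of_notMem hω, zero_mul]
      refine ext_of_generate_finite _ generateFrom_pi.symm isPiSystem_pi ?_ ?_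
      · rintro _ ⟨B, hB, rfl⟩
        exact hbox' B (by simpa using hB)
      · simpa using hbox' (fun _ => Set.univ) fun _ => MeasurableSet.univ
    have h5 := congrArg (fun Q => Q T) key
    rw [Measure.map_apply hY hT, Measure.map_apply hY hT, Measure.restrict_apply (hY hT),
      withDensity_apply _ (hY hT), Measure.restrict_restrict (hY hT)] at h5
    have hset1 : (fun ω => ((Z ω, fun i : Fin N => Y i.castSucc ω), Y (Fin.last N) ω)) ⁻¹'
        ((D ×ˢ T) ×ˢ C) = (fun ω (i : Fin N) => Y i.castSucc ω) ⁻¹' T ∩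
          (Z ⁻¹' D ∩ Y (Fin.last N) ⁻¹' C) := by
      ext ω
      simp only [Set.mem_preimage, Set.mem_prod, Set.mem_inter_iff]
      tauto
    have hset2 : (fun ω => (Z ω, fun i : Fin N => Y i.castSucc ω)) ⁻¹' (D ×ˢ T)
        = (fun ω (i : Fin N) => Y i.castSucc ω) ⁻¹' T ∩ Z ⁻¹' D := by
      ext ω
      simp only [Set.mem_preimage, Set.mem_prod, Set.mem_inter_iff]
      tauto
    rw [hset1, h5, hset2]
    rfl
  have hprob : IsProbabilityMeasure (P.map fun ω => (Z ω, fun i : Fin N => Y i.castSucc ω)) :=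
      Measure.isProbabilityMeasure_map hZY.aemeasurable
  have hKint : Measurable fun y : F × (Fin N → E) => ∫⁻ z, K (y, z) ∂(κ (Fin.last N) y.1) :=
    Measurable.lintegral_kernel_prod_right' (κ := (κ (Fin.last N)).comap Prod.fst measurable_fst) hK
  calc ∫⁻ ω, K ((Z ω, fun i => Y i.castSucc ω), Y (Fin.last N) ω) ∂P
      = ∫⁻ y, K y ∂(P.map fun ω => ((Z ω, fun i : Fin N => Y i.castSucc ω), Y (Fin.last N) ω)) :=
        (lintegral_map hK (hZY.prodMk hL)).symm
    _ = ∫⁻ y, ∫⁻ z, K (y, z) ∂(κ (Fin.last N) y.1)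
          ∂(P.map fun ω => (Z ω, fun i : Fin N => Y i.castSucc ω)) := by
        rw [hQ, Measure.lintegral_compProd hK]
        rfl
    _ = _ := lintegral_map hKint hZY

end LastObservation

/-! ### Bayes' rule by induction on the number of observations -/

section Bayes

attribute [local irreducible] expNeg scoreWeight

variable {X : Type u} [MeasurableSpace X] [MeasurableEq X] {Ω : Type v} [MeasurableSpace Ω]
  {P : Measure Ω} [IsProbabilityMeasure P] {α : Measure X} [IsFiniteMeasure α]
  [NullSingletonClass α] {φ : ℝ} [hφ : Fact (0 < φ)]
  {d : ℕ} {J : ℕ → Ω → ℝ} {x : ℕ → Ω → X} {m : ℕ × Fin d → Ω → ℝ}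

lemma measurable_snoc {N : ℕ} :
    Measurable fun y : (Fin N → X) × X => (Fin.snoc y.1 y.2 : Fin (N + 1) → X) := by
  refine measurable_pi_lambda _ fun i => ?_
  refine Fin.lastCases ?_ (fun i => ?_) i
  · simp only [Fin.snoc_last]
    exact measurable_snd
  · simp only [Fin.snoc_castSucc]
    fun_prop

/-- The likelihood of the latent variables and of observations in the groups `lab`. -/
def likelihood {N : ℕ} (lab : Fin N → Fin d) (u : Fin d → ℝ≥0) (M : Fin d → Measure X) : ℝ≥0∞ :=
  expNeg (pairing (fun j _ => (u j : ℝ≥0∞)) M) * ∏ i, M (lab i) Set.univ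

lemma measurable_likelihood {N : ℕ} (lab : Fin N → Fin d) (u : Fin d → ℝ≥0) :
    Measurable (likelihood (X := X) lab u) :=
  (measurable_expNeg.comp (measurable_pairing fun _ => measurable_const)).mul
    (Finset.measurable_prod _ fun _ _ => measurable_eval_apply _ MeasurableSet.univ)

lemma measurable_snoc_right {N : ℕ} (o : Fin N → X) :
    Measurable fun z => (Fin.snoc o z : Fin (N + 1) → X) :=
  measurable_snoc.comp (f := fun z => (o, z)) (by fun_prop)

lemma likelihood_snoc {N : ℕ} (lab : Fin N → Fin d) (j : Fin d) (u : Fin d → ℝ≥0)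
    (M : Fin d → Measure X) : likelihood (Fin.snoc lab j : Fin (N + 1) → Fin d) u M
      = likelihood lab u M * M j Set.univ := by
  simp [likelihood, Fin.prod_univ_castSucc, mul_assoc]

lemma measurable_lintegral_posterior {N : ℕ}
    (h : IsCompoundRep P (betaLevy φ) α (fun _ _ => gammaMeasure φ 1) J x m)
    (lab : Fin N → Fin d) (u : Fin d → ℝ≥0) {H : (Fin N → X) × (Fin d → Measure X) → ℝ≥0∞}
    (hH : Measurable H) : Measurable fun o => ∫⁻ M, H (o, M) ∂(h.posterior lab (o, u)) :=
  Measurable.lintegral_kernel_prod_right'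
    (κ := (h.posterior lab).comap (fun o => (o, u)) (by fun_prop)) hH

/-- Bayes' rule for conditionally independent observations. -/
lemma IsCompoundRep.lintegral_likelihood_mul {N : ℕ} (lab : Fin N → Fin d) (obs : Fin N → Ω → X)
    (h : IsCompoundRep P (betaLevy φ) α (fun _ _ => gammaMeasure φ 1) J x m)
    (hobs : IsCondIndepWithLaws P (fun ω j => compoundMeasure J x m j ω) obs
      fun i M => samplingKernel X (lab i) M) (u : Fin d → ℝ≥0)
    {H : (Fin N → X) × (Fin d → Measure X) → ℝ≥0∞} (hH : Measurable H) :
    ∫⁻ ω, likelihood lab u (fun j => compoundMeasure J x m j ω) *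
        H (fun i => obs i ω, fun j => compoundMeasure J x m j ω) ∂P
      = ∫⁻ ω, likelihood lab u (fun j => compoundMeasure J x m j ω) *
        ∫⁻ M, H (fun i => obs i ω, M) ∂(h.posterior lab (fun i => obs i ω, u)) ∂P := by
  have hvec := h.measurable_vec
  induction N with
  | zero =>
    -- Without observations the likelihood is the exponential weight and the posterior is the
    -- normalized tilting, so the claim is the definition of the latter.
    have hHr : Measurable fun M => H (Fin.elim0, M) := hH.comp measurable_prodMk_left
    have hpair := h.measurable_expNeg_pairing (f := fun j _ => (u j : ℝ≥0∞))
      fun j => measurable_const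
    have h0 : ∀ ω, (fun i => obs i ω) = (Fin.elim0 : Fin 0 → X) := fun ω => Subsingleton.elim _ _
    have h1 : ∫⁻ M, H (Fin.elim0, M) ∂(h.posterior lab (Fin.elim0, u))
        = ∫⁻ ω, H (Fin.elim0, fun j => compoundMeasure J x m j ω) ∂(CoRM.tilt P J x m u) := by
      have := h.isProbabilityMeasure_tilt u
      refine (lintegral_map hHr (h.measurable_fixed _)).trans ?_
      have hadd : ∀ (M : Fin d → Measure X) y, addFixed (Fin.elim0 : Fin 0 → X) M y = M :=
        fun M y => by
          funext j; simp [addFixed]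
      have hmHv : Measurable fun z : Ω × (Fin 0 → ℝ × (Fin d → ℝ)) =>
        H (Fin.elim0, fun j => compoundMeasure J x m j z.1) := hHr.comp (hvec.comp measurable_fst)
      simp_rw [hadd]
      rw [lintegral_prod _ hmHv.aemeasurable]
      simp
    simp only [h0, h1, likelihood, Finset.univ_eq_empty, Finset.prod_empty, mul_one]
    have hHv : Measurable fun ω => H (Fin.elim0, fun j => compoundMeasure J x m j ω) :=
      hHr.comp hvec
    rw [h.lintegral_tilt u hHv, lintegral_mul_const _ hpair,
      h.lintegral_expNeg_pairing (f := fun j _ => u j) fun j => measurable_const, ← mul_assoc,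
      ENNReal.mul_inv_cancel (expNeg_pos (lapExponent_const_ne_top u)).ne' (expNeg_ne_top _),
      one_mul]
  | succ N ih =>
    obtain ⟨lab, j, rfl⟩ : ∃ (l : Fin N → Fin d) (j : Fin d),
        lab = (Fin.snoc l j : Fin (N + 1) → Fin d) :=
      ⟨Fin.init lab, lab (Fin.last N), (Fin.snoc_init_self lab).symm⟩
    have hinit : IsCondIndepWithLaws P (fun ω j => compoundMeasure J x m j ω)
        (fun i : Fin N => obs i.castSucc) fun i M => samplingKernel X (lab i) M := by
      have h2 := hobs.comp_injective (Fin.castSucc_injective N)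
      simpa only [Fin.snoc_castSucc] using h2
    have hsnoc : ∀ ω, (fun i => obs i ω)
        = (Fin.snoc (fun i : Fin N => obs i.castSucc ω) (obs (Fin.last N) ω) : Fin (N + 1) → X) :=
      fun ω => (Fin.snoc_init_self fun i => obs i ω).symm
    -- the law of the last observation
    have hlast : ∀ {F : (Fin (N + 1) → X) × (Fin d → Measure X) → ℝ≥0∞}, Measurable F →
        ∫⁻ ω, likelihood (Fin.snoc lab j : Fin (N + 1) → Fin d) u
            (fun j => compoundMeasure J x m j ω) *
          F (fun i => obs i ω, fun j => compoundMeasure J x m j ω) ∂P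
        = ∫⁻ ω, likelihood lab u (fun j => compoundMeasure J x m j ω) *
          (compoundMeasure J x m j ω Set.univ * ∫⁻ z, F (Fin.snoc (fun i => obs i.castSucc ω) z,
            fun j => compoundMeasure J x m j ω)
            ∂(samplingKernel X j fun j => compoundMeasure J x m j ω)) ∂P := by
      intro F hF
      have hK : Measurable fun y : ((Fin d → Measure X) × (Fin N → X)) × X =>
          likelihood (Fin.snoc lab j : Fin (N + 1) → Fin d) u y.1.1 *
            F (Fin.snoc y.1.2 y.2, y.1.1) := by
        refine ((measurable_likelihood _ u).comp (by fun_prop)).mul (hF.comp ?_)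
        exact (measurable_snoc.comp (f := fun y : ((Fin d → Measure X) × (Fin N → X)) × X =>
          (y.1.2, y.2)) (by fun_prop)).prodMk (by fun_prop)
      have h3 := hobs.lintegral_last (κ := fun i =>
        samplingKernel X ((Fin.snoc lab j : Fin (N + 1) → Fin d) i)) hK
      simp only [Fin.snoc_last] at h3
      simp_rw [hsnoc]
      refine h3.trans (lintegral_congr fun ω => ?_)
      rw [lintegral_const_mul, likelihood_snoc, mul_assoc]
      exact hF.comp ((measurable_snoc_right _).prodMk measurable_const)
    have hG : Measurable fun o => ∫⁻ M, H (o, M)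
        ∂(h.posterior (Fin.snoc lab j : Fin (N + 1) → Fin d) (o, u)) :=
      measurable_lintegral_posterior h _ u hH
    have hmint : ∀ {F : (Fin (N + 1) → X) × (Fin d → Measure X) → ℝ≥0∞}, Measurable F →
        Measurable fun y : (Fin N → X) × (Fin d → Measure X) =>
          y.2 j Set.univ * ∫⁻ z, F (Fin.snoc y.1 z, y.2) ∂(samplingKernel X j y.2) := by
      intro F hF
      refine ((measurable_eval_apply j MeasurableSet.univ).comp measurable_snd).mul ?_
      refine Measurable.lintegral_kernel_prod_right' (f := fun w : ((Fin N → X) ×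
        (Fin d → Measure X)) × X => F (Fin.snoc w.1.1 w.2, w.1.2))
        (κ := (samplingKernel X j).comap Prod.snd measurable_snd) (hF.comp ?_)
      exact (measurable_snoc.comp (f := fun w : ((Fin N → X) × (Fin d → Measure X)) × X =>
          (w.1.1, w.2)) (by fun_prop)).prodMk (by fun_prop)
    rw [hlast hH, hlast (F := fun y => ∫⁻ M, H (y.1, M)
      ∂(h.posterior (Fin.snoc lab j : Fin (N + 1) → Fin d) (y.1, u))) (hG.comp measurable_fst)]
    -- The induction hypothesis replaces the random measures by a draw from the posterior given the
    -- earlier observations; the one-step Bayes rule acts under that draw, and the hypothesis is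
    -- then undone on the other side.
    refine (ih lab (fun i => obs i.castSucc) hinit (hmint hH)).trans (Eq.trans ?_
      (ih lab (fun i => obs i.castSucc) hinit (hmint (F := fun y => ∫⁻ M, H (y.1, M)
      ∂(h.posterior (Fin.snoc lab j : Fin (N + 1) → Fin d) (y.1, u)))
        (hG.comp measurable_fst))).symm)
    refine lintegral_congr fun ω => ?_
    congr 1
    have hmE : Measurable fun y : X × (Fin d → Measure X) =>
        ((Fin.snoc (fun i : Fin N => obs i.castSucc ω) y.1 : Fin (N + 1) → X), y.2) :=
      ((measurable_snoc_right fun i => obs i.castSucc ω).comp measurable_fst).prodMk measurable_snd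
    exact h.lintegral_posterior_next lab j (fun i => obs i.castSucc ω) u
      (K := fun y => H (Fin.snoc (fun i => obs i.castSucc ω) y.1, y.2)) (hH.comp hmE)

end Bayes


/-! ### Rescaled gamma variables -/

section GammaScaling

/-- The density, with respect to `Gamma(n, 1)`, of `Gamma(n, m)`. -/
def latentWeight (n : ℕ) (m : ℝ≥0∞) (r : ℝ) : ℝ≥0∞ :=
  ENNReal.ofReal (Real.exp r) * (m ^ n * expNeg (ENNReal.ofReal r * m))

@[fun_prop]
lemma measurable_latentWeight (n : ℕ) (m : ℝ≥0∞) : Measurable (latentWeight n m) := by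
  unfold latentWeight
  fun_prop

/-- Change of variables by the scale `m`. Keeping `Gamma(n, 1)` as reference measure, independent of
`m`, isolates the dependence on the total mass in the factor `m^n e^(-r m)`. -/
lemma gammaMeasure_map_div {n : ℕ} (hn : 1 ≤ n) {m : ℝ≥0∞} (h0 : m ≠ 0) (h1 : m ≠ ∞) :
    (gammaMeasure n 1).map (fun g => g / m.toReal)
      = (gammaMeasure n 1).withDensity (latentWeight n m) := by
  have ha : 0 < m.toReal := ENNReal.toReal_pos h0 h1
  have hm : ENNReal.ofReal m.toReal = m := ENNReal.ofReal_toReal h1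
  generalize m.toReal = a at ha hm
  subst hm
  have hn' : (0 : ℝ) < n := by exact_mod_cast hn
  have hpdf : Measurable (gammaPDF n 1) := (measurable_gammaPDFReal n 1).ennreal_ofReal
  refine Measure.ext_of_lintegral _ fun F hF => ?_
  have hFa : Measurable fun g => F (g / a) := hF.comp (by fun_prop)
  rw [lintegral_map hF (by fun_prop), lintegral_withDensity_eq_lintegral_mul _
    (measurable_latentWeight _ _) hF, gammaMeasure,
    lintegral_withDensity_eq_lintegral_mul _ hpdf hFa, lintegral_withDensity_eq_lintegral_mul _ hpdf
    ((measurable_latentWeight _ _).mul hF)]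
  have h2 : ∫⁻ g, (gammaPDF n 1 * fun g => F (g / a)) g
      = ENNReal.ofReal a * ∫⁻ r, (gammaPDF n 1 * fun g => F (g / a)) (a * r) := by
    conv_lhs => rw [← Real.smul_map_volume_mul_left ha.ne']
    rw [lintegral_smul_measure, lintegral_map (hpdf.mul hFa) (by fun_prop), abs_of_pos ha,
      smul_eq_mul]
  have hc : Measurable fun r => (gammaPDF n 1 * fun g => F (g / a)) (a * r) :=
    (hpdf.mul hFa).comp (by fun_prop)
  rw [h2, ← lintegral_const_mul _ hc]
  refine lintegral_congr fun r => ?_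
  simp only [Pi.mul_apply, mul_div_cancel_left₀ _ ha.ne', ← mul_assoc]
  congr 1
  rcases lt_or_ge r 0 with hr | hr
  · rw [gammaPDF_of_neg hr, gammaPDF_of_neg (mul_neg_of_pos_of_neg ha hr), mul_zero, zero_mul]
  · have hΓ := Real.Gamma_pos_of_pos hn'
    rw [gammaPDF_of_nonneg hr, gammaPDF_of_nonneg (by positivity), latentWeight,
      ← ENNReal.ofReal_mul hr, expNeg_ofReal (by positivity), ← ENNReal.ofReal_pow ha.le,
      ← ENNReal.ofReal_mul (by positivity), ← ENNReal.ofReal_mul (by positivity),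
      ← ENNReal.ofReal_mul (Real.exp_pos _).le, ← ENNReal.ofReal_mul (by positivity)]
    congr 1
    -- One factor `a` is the Jacobian, the remaining `n - 1` come from the power in the gamma
    -- density.
    have h3 : (a : ℝ) ^ n = a * a ^ ((n : ℝ) - 1) := by
      rw [Real.rpow_sub_one ha.ne', Real.rpow_natCast]
      field_simp
    rw [Real.mul_rpow ha.le hr, h3]
    have h4 : Real.exp (-(1 * r)) * (Real.exp r * Real.exp (-(r * a)))
        = Real.exp (-(1 * (a * r))) := by
      rw [← Real.exp_add, ← Real.exp_add]
      ring_nf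
    rw [← h4]
    ring

lemma pi_gammaMeasure_map_div {d : ℕ} {n : Fin d → ℕ} (hn : ∀ j, 1 ≤ n j) {m : Fin d → ℝ≥0∞}
    (h0 : ∀ j, m j ≠ 0) (h1 : ∀ j, m j ≠ ∞) :
    (Measure.pi fun j => gammaMeasure (n j) 1).map (fun g j => g j / (m j).toReal)
      = (Measure.pi fun j => gammaMeasure (n j) 1).withDensity
        fun r => ∏ j, latentWeight (n j) (m j) (r j) := by
  have hprob : ∀ j, IsProbabilityMeasure (gammaMeasure (n j) 1) := fun j =>
    isProbabilityMeasure_gammaMeasure (by exact_mod_cast hn j) one_pos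
  have hmeas : ∀ j, Measurable fun g : ℝ => g / (m j).toReal := fun j => by fun_prop
  have hprob' : ∀ j, IsProbabilityMeasure
      ((gammaMeasure (n j) 1).map fun g => g / (m j).toReal) := fun j =>
    Measure.isProbabilityMeasure_map (hmeas j).aemeasurable
  rw [Measure.pi_map_pi fun j => (hmeas j).aemeasurable]
  refine Measure.pi_eq fun B hB => ?_
  rw [withDensity_apply _ (MeasurableSet.univ_pi hB), ← lintegral_indicator
    (MeasurableSet.univ_pi hB)]
  have h2 : ∀ r : Fin d → ℝ, (Set.univ.pi B).indicator
        (fun r => ∏ j, latentWeight (n j) (m j) (r j)) r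
      = ∏ j, (B j).indicator (latentWeight (n j) (m j)) (r j) := fun r => by
    by_cases hr : r ∈ Set.univ.pi B
    · rw [Set.indicator_of_mem hr]
      exact Finset.prod_congr rfl fun j _ => (Set.indicator_of_mem (hr j (Set.mem_univ j)) _).symm
    · rw [Set.indicator_of_notMem hr]
      simp only [Set.mem_pi, Set.mem_univ, true_imp_iff, not_forall] at hr
      obtain ⟨j, hj⟩ := hr
      exact (Finset.prod_eq_zero (Finset.mem_univ j) (Set.indicator_of_notMem hj _)).symm
  simp_rw [h2]
  rw [lintegral_pi_prod fun j => (measurable_latentWeight _ _).indicator (hB j)]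
  refine Finset.prod_congr rfl fun j _ => ?_
  rw [gammaMeasure_map_div (hn j) (h0 j) (h1 j), withDensity_apply _ (hB j),
    lintegral_indicator (hB j)]

end GammaScaling

/-! ### Joint law with the latent variables -/

section Latent

attribute [local irreducible] expNeg scoreWeight

variable {X : Type u} [MeasurableSpace X] [MeasurableEq X] {Ω : Type v} [MeasurableSpace Ω]
  {P : Measure Ω} [IsProbabilityMeasure P] {α : Measure X} [IsFiniteMeasure α]
  [NullSingletonClass α] {φ : ℝ} [hφ : Fact (0 < φ)]
  {d : ℕ} {J : ℕ → Ω → ℝ} {x : ℕ → Ω → X} {m : ℕ × Fin d → Ω → ℝ} {N : ℕ}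
  {n : Fin d → ℕ} {G : Fin d → Ω → ℝ}

/-- The total mass is gamma distributed with positive shape, as `α ≠ 0`; hence the normalizations
and the latent quotients are almost surely nondegenerate. -/
lemma IsCompoundRep.ae_univ_ne
    (h : IsCompoundRep P (betaLevy φ) α (fun _ _ => gammaMeasure φ 1) J x m) (hα : α ≠ 0) :
    ∀ᵐ ω ∂P, ∀ j, compoundMeasure J x m j ω Set.univ ≠ 0 ∧
      compoundMeasure J x m j ω Set.univ ≠ ∞ := by
  refine ae_all_iff.2 fun j => ?_
  have hg := IsCompoundRep.isGammaProcess h j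
  have hα' : α Set.univ ≠ 0 := fun h0 => hα (Measure.measure_univ_eq_zero.1 h0)
  have hm : Measurable fun ω => compoundMeasure J x m j ω Set.univ :=
    (Measure.measurable_coe MeasurableSet.univ).comp hg.measurable
  have hS : MeasurableSet {a : ℝ≥0∞ | a ≠ 0 ∧ a ≠ ∞} :=
    (measurableSet_singleton 0).compl.inter (measurableSet_singleton ∞).compl
  refine (ae_map_iff hm.aemeasurable hS).1 ?_
  rw [hg.law _ MeasurableSet.univ hα', ae_map_iff (by fun_prop) hS]
  have h1 : ∀ᵐ t ∂(gammaMeasure (α Set.univ).toReal 1), t ≠ 0 :=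
    (withDensity_absolutelyContinuous _ _).ae_le (Measure.ae_ne volume 0)
  filter_upwards [h1, ae_nonneg_gammaMeasure _ _] with t ht ht'
  exact ⟨by simpa using lt_of_le_of_ne ht' ht.symm, ENNReal.ofReal_ne_top⟩

/-- The powers of the total masses, grouped by label, are the product in the likelihood, and the
exponentials are the tilting factor. Only `∏ e^(r j)`, free of the random measures, is left over. -/
lemma prod_latentWeight (lab : Fin N → Fin d) (hlab : ∀ j, ∑ i, (if lab i = j then 1 else 0) = n j)
    (M : Fin d → Measure X) (r : Fin d → ℝ) :
    ∏ j, latentWeight (n j) (M j Set.univ) (r j)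
      = (∏ j, ENNReal.ofReal (Real.exp (r j))) * likelihood lab (fun j => (r j).toNNReal) M := by
  have h1 : ∏ i, M (lab i) Set.univ = ∏ j, M j Set.univ ^ n j := by
    rw [← Finset.prod_fiberwise' Finset.univ lab fun j => M j Set.univ]
    refine Finset.prod_congr rfl fun j _ => ?_
    rw [Finset.prod_const, ← hlab j, Finset.card_filter]
  have h2 : expNeg (pairing (fun j _ => ((r j).toNNReal : ℝ≥0∞)) M)
      = ∏ j, expNeg (ENNReal.ofReal (r j) * M j Set.univ) := by
    simp only [pairing, lintegral_const, expNeg_sum]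
    rfl
  rw [likelihood, h1, h2]
  simp only [latentWeight, Finset.prod_mul_distrib]
  ring

/-- The joint law of the random measures, the observations and the latent variables. -/
lemma IsCompoundRep.lintegral_latent
    (h : IsCompoundRep P (betaLevy φ) α (fun _ _ => gammaMeasure φ 1) J x m) (hα : α ≠ 0)
    (lab : Fin N → Fin d) (hlab : ∀ j, ∑ i, (if lab i = j then 1 else 0) = n j)
    (hn : ∀ j, 1 ≤ n j) {obs : Fin N → Ω → X} (hobs : ∀ i, Measurable (obs i))
    (hG : ∀ j, Measurable (G j)) (hG_indep : iIndepFun G P)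
    (hG_law : ∀ j, P.map (G j) = gammaMeasure (n j) 1)
    (hG_data : IndepFun (fun ω j => G j ω)
      (fun ω => ((fun j => compoundMeasure J x m j ω), fun i => obs i ω)) P)
    {Φ : ((Fin N → X) × (Fin d → ℝ≥0)) × (Fin d → Measure X) → ℝ≥0∞} (hΦ : Measurable Φ) :
    ∫⁻ ω, Φ ((fun i => obs i ω, fun j =>
        (G j ω / (compoundMeasure J x m j ω Set.univ).toReal).toNNReal),
        fun j => compoundMeasure J x m j ω) ∂P
      = ∫⁻ r, (∏ j, ENNReal.ofReal (Real.exp (r j))) * ∫⁻ ω,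
          likelihood lab (fun j => (r j).toNNReal) (fun j => compoundMeasure J x m j ω) *
          Φ ((fun i => obs i ω, fun j => (r j).toNNReal), fun j => compoundMeasure J x m j ω) ∂P
        ∂(Measure.pi fun j => gammaMeasure (n j) 1) := by
  have hprob : ∀ j, IsProbabilityMeasure (gammaMeasure (n j) 1) := fun j =>
    isProbabilityMeasure_gammaMeasure (by exact_mod_cast hn j) one_pos
  have hvec := h.measurable_vec
  have hobs' : Measurable fun ω i => obs i ω := measurable_pi_lambda _ hobs
  have hG' : Measurable fun ω j => G j ω := measurable_pi_lambda _ hG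
  have hY : Measurable fun ω => ((fun j => compoundMeasure J x m j ω), fun i => obs i ω) :=
    hvec.prodMk hobs'
  have hGlaw : P.map (fun ω j => G j ω) = Measure.pi fun j => gammaMeasure (n j) 1 := by
    rw [(iIndepFun_iff_map_fun_eq_pi_map fun j => (hG j).aemeasurable).1 hG_indep]
    simp_rw [hG_law]
  have hjoint := (indepFun_iff_map_prod_eq_prod_map_map hG'.aemeasurable hY.aemeasurable).1 hG_data
  rw [hGlaw] at hjoint
  have hmass : ∀ j, Measurable fun M : Fin d → Measure X => M j Set.univ := fun j =>
    measurable_eval_apply j MeasurableSet.univ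
  -- the integrand, as a function of the variables `G` and of the data
  let Ψ : (Fin d → ℝ) × ((Fin d → Measure X) × (Fin N → X)) → ℝ≥0∞ := fun y =>
    Φ ((y.2.2, fun j => (y.1 j / (y.2.1 j Set.univ).toReal).toNNReal), y.2.1)
  have hΨ : Measurable Ψ := by
    refine hΦ.comp (Measurable.prodMk (Measurable.prodMk (by fun_prop) ?_) (by fun_prop))
    refine measurable_pi_lambda _ fun j => Measurable.real_toNNReal (Measurable.div (by fun_prop) ?_)
    exact ((hmass j).comp (measurable_fst.comp measurable_snd)).ennreal_toReal
  have hPY : IsProbabilityMeasure (P.map fun ω =>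
      ((fun j => compoundMeasure J x m j ω), fun i => obs i ω)) :=
    Measure.isProbabilityMeasure_map hY.aemeasurable
  have hΨint : Measurable fun y => ∫⁻ g, Ψ (g, y) ∂(Measure.pi fun j => gammaMeasure (n j) 1) :=
    hΨ.lintegral_prod_left'
  -- Independence of `G` from the data allows `G` to be integrated first with the data frozen.
  have h1 : ∫⁻ ω, Φ ((fun i => obs i ω, fun j =>
        (G j ω / (compoundMeasure J x m j ω Set.univ).toReal).toNNReal),
        fun j => compoundMeasure J x m j ω) ∂P
      = ∫⁻ ω, ∫⁻ g, Ψ (g, ((fun j => compoundMeasure J x m j ω), fun i => obs i ω))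
        ∂(Measure.pi fun j => gammaMeasure (n j) 1) ∂P := by
    rw [← lintegral_map hΨint hY, ← lintegral_prod_symm _ hΨ.aemeasurable, ← hjoint,
      lintegral_map hΨ (hG'.prodMk hY)]
  have hfull : Measurable fun y : Ω × (Fin d → ℝ) => (∏ j, ENNReal.ofReal (Real.exp (y.2 j))) *
      (likelihood lab (fun j => (y.2 j).toNNReal) (fun j => compoundMeasure J x m j y.1) *
      Φ ((fun i => obs i y.1, fun j => (y.2 j).toNNReal), fun j => compoundMeasure J x m j y.1)) := by
    refine Measurable.mul (by fun_prop) (Measurable.mul ?_ (hΦ.comp ?_))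
    · simp only [likelihood, pairing, lintegral_const]
      refine Measurable.mul (measurable_expNeg.comp (Finset.measurable_sum _ fun j _ =>
        Measurable.mul (by fun_prop) ?_)) (Finset.measurable_prod _ fun i _ => ?_)
      · exact (hmass j).comp (hvec.comp measurable_fst)
      · exact (hmass (lab i)).comp (hvec.comp measurable_fst)
    · exact ((hobs'.comp measurable_fst).prodMk (by fun_prop)).prodMk (hvec.comp measurable_fst)
  rw [h1]
  -- With the data frozen, the latent variables are rescaled gamma variables; the total masses are
  -- positive and finite off a null event.
  have h2 : ∀ᵐ ω ∂P, ∫⁻ g, Ψ (g, ((fun j => compoundMeasure J x m j ω), fun i => obs i ω))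
        ∂(Measure.pi fun j => gammaMeasure (n j) 1)
      = ∫⁻ r, (∏ j, ENNReal.ofReal (Real.exp (r j))) *
        (likelihood lab (fun j => (r j).toNNReal) (fun j => compoundMeasure J x m j ω) *
        Φ ((fun i => obs i ω, fun j => (r j).toNNReal), fun j => compoundMeasure J x m j ω))
        ∂(Measure.pi fun j => gammaMeasure (n j) 1) := by
    filter_upwards [h.ae_univ_ne hα] with ω hω
    have hF : Measurable fun r : Fin d → ℝ => Φ ((fun i => obs i ω, fun j => (r j).toNNReal),
        fun j => compoundMeasure J x m j ω) := hΦ.comp (by fun_prop)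
    have h3 := congrArg (fun Q => ∫⁻ r, Φ ((fun i => obs i ω, fun j => (r j).toNNReal),
      fun j => compoundMeasure J x m j ω) ∂Q)
      (pi_gammaMeasure_map_div hn (fun j => (hω j).1) fun j => (hω j).2)
    have hw : Measurable fun r : Fin d → ℝ =>
        ∏ j, latentWeight (n j) (compoundMeasure J x m j ω Set.univ) (r j) :=
      Finset.measurable_prod _ fun j _ =>
        (measurable_latentWeight _ _).comp (measurable_pi_apply j)
    rw [lintegral_map hF (by fun_prop), lintegral_withDensity_eq_lintegral_mul _ hw hF] at h3
    refine h3.trans (lintegral_congr fun r => ?_)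
    rw [Pi.mul_apply, prod_latentWeight lab hlab (fun j => compoundMeasure J x m j ω), mul_assoc]
  rw [lintegral_congr_ae h2, lintegral_lintegral_swap hfull.aemeasurable]
  refine lintegral_congr fun r => lintegral_const_mul _ ?_
  refine Measurable.mul ((measurable_likelihood _ _).comp hvec) (hΦ.comp ?_)
  exact (hobs'.prodMk measurable_const).prodMk hvec

/-- The posterior law of the random measures, given the observations and the latent variables. -/
lemma IsCompoundRep.lintegral_posterior
    (h : IsCompoundRep P (betaLevy φ) α (fun _ _ => gammaMeasure φ 1) J x m) (hα : α ≠ 0)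
    (lab : Fin N → Fin d) (hlab : ∀ j, ∑ i, (if lab i = j then 1 else 0) = n j)
    (hn : ∀ j, 1 ≤ n j) {obs : Fin N → Ω → X}
    (hobs : IsCondIndepWithLaws P (fun ω j => compoundMeasure J x m j ω) obs
      fun i M => samplingKernel X (lab i) M)
    (hG : ∀ j, Measurable (G j)) (hG_indep : iIndepFun G P)
    (hG_law : ∀ j, P.map (G j) = gammaMeasure (n j) 1)
    (hG_data : IndepFun (fun ω j => G j ω)
      (fun ω => ((fun j => compoundMeasure J x m j ω), fun i => obs i ω)) P)
    {Φ : ((Fin N → X) × (Fin d → ℝ≥0)) × (Fin d → Measure X) → ℝ≥0∞} (hΦ : Measurable Φ) :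
    ∫⁻ ω, Φ ((fun i => obs i ω, fun j =>
        (G j ω / (compoundMeasure J x m j ω Set.univ).toReal).toNNReal),
        fun j => compoundMeasure J x m j ω) ∂P
      = ∫⁻ ω, ∫⁻ M, Φ ((fun i => obs i ω, fun j =>
        (G j ω / (compoundMeasure J x m j ω Set.univ).toReal).toNNReal), M)
        ∂(h.posterior lab (fun i => obs i ω, fun j =>
          (G j ω / (compoundMeasure J x m j ω Set.univ).toReal).toNNReal)) ∂P := by
  have hΦ' : Measurable fun y : (Fin N → X) × (Fin d → ℝ≥0) =>
      ∫⁻ M, Φ (y, M) ∂(h.posterior lab y) := Measurable.lintegral_kernel_prod_right' hΦ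
  rw [h.lintegral_latent hα lab hlab hn hobs.measurable hG hG_indep hG_law hG_data hΦ,
    h.lintegral_latent hα lab hlab hn hobs.measurable hG hG_indep hG_law hG_data
      (Φ := fun y => ∫⁻ M, Φ (y.1, M) ∂(h.posterior lab y.1)) (hΦ'.comp measurable_fst)]
  -- Both sides are integrals over the latent value `r` against the same measure, so Bayes' rule at
  -- the fixed value `u = r` finishes.
  refine lintegral_congr fun r => ?_
  congr 1
  exact h.lintegral_likelihood_mul lab obs hobs (fun j => (r j).toNNReal)
    (H := fun y => Φ ((y.1, fun j => (r j).toNNReal), y.2)) (hΦ.comp (by fun_prop))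

end Latent


/-! ### Transfer along measure-preserving maps -/

section Transfer

variable {Ω : Type*} [MeasurableSpace Ω] {P : Measure Ω} [IsProbabilityMeasure P]
  {Ω₀ : Type*} [MeasurableSpace Ω₀] {Q : Measure Ω₀} [IsProbabilityMeasure Q] {p : Ω → Ω₀}

lemma iIndepFun_comp_iff {ι : Type*} [Fintype ι] {E : ι → Type*} [∀ i, MeasurableSpace (E i)]
    {Y : (i : ι) → Ω₀ → E i} (hp : MeasurePreserving p P Q) (hY : ∀ i, Measurable (Y i)) :
    iIndepFun (fun i ω => Y i (p ω)) P ↔ iIndepFun Y Q := by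
  have hY' : ∀ i, Measurable fun ω => Y i (p ω) := fun i => (hY i).comp hp.measurable
  rw [iIndepFun_iff_map_fun_eq_pi_map fun i => (hY' i).aemeasurable,
    iIndepFun_iff_map_fun_eq_pi_map fun i => (hY i).aemeasurable, ← hp.map_eq,
    Measure.map_map (measurable_pi_lambda _ hY) hp.measurable]
  simp_rw [Measure.map_map (hY _) hp.measurable]
  rfl

lemma isPoissonRandomMeasure_comp_iff {E : Type*} [MeasurableSpace E] {N : Ω₀ → Measure E}
    {Λ : Measure E} (hp : MeasurePreserving p P Q) (hN : Measurable N) :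
    IsPoissonRandomMeasure P (fun ω => N (p ω)) Λ ↔ IsPoissonRandomMeasure Q N Λ := by
  have hm : ∀ A, MeasurableSet A → Measurable fun w => N w A := fun A hA =>
    (Measure.measurable_coe hA).comp hN
  have hmap : ∀ A, MeasurableSet A → P.map (fun ω => N (p ω) A) = Q.map fun w => N w A :=
    fun A hA => by
      rw [← hp.map_eq, Measure.map_map (hm A hA) hp.measurable]
      rfl
  refine ⟨fun h => ⟨hN, fun r A hA hd => ?_, fun A hA hΛ => ?_⟩,
    fun h => ⟨hN.comp hp.measurable, fun r A hA hd => ?_, fun A hA hΛ => ?_⟩⟩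
  · exact (iIndepFun_comp_iff hp fun i => hm (A i) (hA i)).1 (h.indep r A hA hd)
  · exact (hmap A hA).symm.trans (h.law A hA hΛ)
  · exact (iIndepFun_comp_iff hp fun i => hm (A i) (hA i)).2 (h.indep r A hA hd)
  · exact (hmap A hA).trans (h.law A hA hΛ)

lemma isCondIndepWithLaws_comp_iff {F ι E : Type*} [MeasurableSpace F] [MeasurableSpace E]
    {Z : Ω₀ → F} {Y : ι → Ω₀ → E} {K : ι → F → Measure E} (hp : MeasurePreserving p P Q)
    (hZ : Measurable Z) (hY : ∀ i, Measurable (Y i)) (hK : ∀ i, Measurable (K i)) :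
    IsCondIndepWithLaws P (fun ω => Z (p ω)) (fun i ω => Y i (p ω)) K
      ↔ IsCondIndepWithLaws Q Z Y K := by
  have hl : ∀ (s : Finset ι) (B : ι → Set E) (D : Set F), (∀ i, MeasurableSet (B i)) →
      MeasurableSet D →
      P (((fun ω => Z (p ω)) ⁻¹' D) ∩ ⋂ i ∈ s, (fun ω => Y i (p ω)) ⁻¹' B i)
        = Q ((Z ⁻¹' D) ∩ ⋂ i ∈ s, Y i ⁻¹' B i) := fun s B D hB hD => by
    rw [← hp.measure_preimage ((hZ hD).inter (Finset.measurableSet_biInter s fun i _ =>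
      hY i (hB i))).nullMeasurableSet]
    congr 1
    ext ω
    simp
  have hr : ∀ (s : Finset ι) (B : ι → Set E) (D : Set F), (∀ i, MeasurableSet (B i)) →
      MeasurableSet D →
      ∫⁻ ω in (fun ω => Z (p ω)) ⁻¹' D, ∏ i ∈ s, K i (Z (p ω)) (B i) ∂P
        = ∫⁻ w in Z ⁻¹' D, ∏ i ∈ s, K i (Z w) (B i) ∂Q := fun s B D hB hD =>
    hp.setLIntegral_comp_preimage (hZ hD) (Finset.measurable_prod _ fun i _ =>
      (Measure.measurable_coe (hB i)).comp ((hK i).comp hZ))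
  refine ⟨fun h => ⟨hZ, hY, fun s B D hB hD => ?_⟩,
    fun h => ⟨hZ.comp hp.measurable, fun i => (hY i).comp hp.measurable, fun s B D hB hD => ?_⟩⟩
  · exact (hl s B D hB hD).symm.trans ((h.law s B D hB hD).trans (hr s B D hB hD))
  · exact (hl s B D hB hD).trans ((h.law s B D hB hD).trans (hr s B D hB hD).symm)

lemma measurable_gammaMeasure_rate (a : ℝ) : Measurable fun r => gammaMeasure a r := by
  refine Measure.measurable_of_measurable_coe _ fun B hB => ?_
  have h1 : Measurable fun z : ℝ × ℝ => gammaPDF a z.1 z.2 := by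
    unfold gammaPDF gammaPDFReal
    refine Measurable.ennreal_ofReal (Measurable.ite ?_ (by fun_prop) measurable_const)
    exact measurableSet_le measurable_const measurable_snd
  simp only [gammaMeasure, withDensity_apply _ hB]
  exact h1.lintegral_prod_right'

lemma isCompoundRep_comp_iff {X : Type u} [MeasurableSpace X] {d : ℕ} {ν : Measure ℝ}
    {α : Measure X} {s : Fin d → ℝ → Measure ℝ} {J : ℕ → Ω₀ → ℝ} {x : ℕ → Ω₀ → X}
    {m : ℕ × Fin d → Ω₀ → ℝ} (hp : MeasurePreserving p P Q) (hJ : ∀ i, Measurable (J i))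
    (hx : ∀ i, Measurable (x i)) (hm : ∀ q, Measurable (m q)) (hs : ∀ j, Measurable (s j)) :
    IsCompoundRep P ν α s (fun i ω => J i (p ω)) (fun i ω => x i (p ω)) (fun q ω => m q (p ω))
      ↔ IsCompoundRep Q ν α s J x m := by
  have hpt : Measurable (points J x) := measurable_pi_lambda _ fun i => (hJ i).prodMk (hx i)
  have hN : Measurable fun w => Measure.sum fun i => Measure.dirac (points J x w i) := by
    refine Measure.measurable_of_measurable_coe _ fun B hB => ?_
    simp only [Measure.sum_apply _ hB, Measure.dirac_apply' _ hB]
    exact Measurable.tsum fun i => (measurable_one.indicator hB).comp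
      ((measurable_pi_apply i).comp hpt)
  have h1 := isPoissonRandomMeasure_comp_iff (Λ := ν.prod α) hp hN
  have h2 := isCondIndepWithLaws_comp_iff (K := fun q z => s q.2 (z q.1).1) hp hpt hm fun q =>
    (hs q.2).comp (measurable_fst.comp (measurable_pi_apply q.1))
  exact ⟨fun h => ⟨h1.1 h.poisson, h2.1 h.scores⟩, fun h => ⟨h1.2 h.poisson, h2.2 h.scores⟩⟩

end Transfer

/-! ### Conditional laws of jumps and scores of the fixed atoms -/

section MarkLaws

attribute [local irreducible] expNeg scoreWeight

variable {φ : ℝ} [hφ : Fact (0 < φ)] {d : ℕ}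

lemma lintegral_markWeight_mul (c : Fin d → ℕ) (a : Fin d → ℝ≥0) {g : ℝ → ℝ≥0∞}
    (hg : Measurable g) {b : Fin d → ℝ → ℝ≥0∞} (hb : ∀ j, Measurable (b j)) :
    ∫⁻ y, markWeight c a y * (g y.1 * ∏ j, b j (y.2 j)) ∂(markBase φ d)
      = ∫⁻ s, g s * ∏ j, ∫⁻ t, scoreWeight (c j) (a j) s t * b j t ∂(gammaMeasure φ 1)
        ∂(betaLevy φ) := by
  have hbm : ∀ j, Measurable fun y : ℝ × (Fin d → ℝ) => b j (y.2 j) := fun j =>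
    (hb j).comp (by fun_prop)
  have hm : Measurable fun y : ℝ × (Fin d → ℝ) => markWeight c a y * (g y.1 * ∏ j, b j (y.2 j)) :=
    (measurable_markWeight_right c a).mul ((hg.comp measurable_fst).mul
      (Finset.measurable_prod _ fun j _ => hbm j))
  rw [markBase, lintegral_prod _ hm.aemeasurable]
  refine lintegral_congr fun s => ?_
  have hf : ∀ j, Measurable fun t => scoreWeight (c j) (a j) s t * b j t := fun j =>
    ((measurable_scoreWeight (c j)).comp (f := fun t => (a j, s, t)) (by fun_prop)).mul (hb j)
  have hF : Measurable fun t : Fin d → ℝ => ∏ j, (scoreWeight (c j) (a j) s (t j) * b j (t j)) :=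
    Finset.measurable_prod _ fun j _ => (hf j).comp (measurable_pi_apply j)
  rw [← lintegral_pi_prod hf, ← lintegral_const_mul _ hF]
  refine lintegral_congr fun t => ?_
  rw [markWeight, Finset.prod_mul_distrib]
  ring

/-- The conditional laws of the scores given the jump, under `markLaw`. -/
lemma lintegral_markLaw_scores {c : Fin d → ℕ} (hc : c ≠ 0) (a : Fin d → ℝ≥0) {g : ℝ → ℝ≥0∞}
    (hg : Measurable g) {b : Fin d → ℝ → ℝ≥0∞} (hb : ∀ j, Measurable (b j)) :
    ∫⁻ y, g y.1 * ∏ j, b j (y.2 j) ∂(markLaw φ c a)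
      = ∫⁻ y, g y.1 * ∏ j, ∫⁻ t, b j t ∂(gammaMeasure (φ + c j) (y.1 * a j + 1))
        ∂(markLaw φ c a) := by
  let I : Fin d → ℝ → ℝ≥0∞ := fun j s => ∫⁻ t, b j t ∂(gammaMeasure (φ + c j) (s * a j + 1))
  have hI : ∀ j, Measurable (I j) := fun j =>
    (Measure.measurable_lintegral (hb j)).comp
      ((measurable_gammaMeasure_rate _).comp (by fun_prop))
  have hgI : Measurable fun s => g s * ∏ j, I j s :=
    hg.mul (Finset.measurable_prod _ fun j _ => hI j)
  have hL : Measurable fun y : ℝ × (Fin d → ℝ) => g y.1 * ∏ j, b j (y.2 j) :=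
    (hg.comp measurable_fst).mul (Finset.measurable_prod _ fun j _ => (hb j).comp (by fun_prop))
  have hR : Measurable fun y : ℝ × (Fin d → ℝ) => g y.1 * ∏ j, I j y.1 := hgI.comp measurable_fst
  rw [lintegral_markLaw hc a hL]
  refine Eq.trans ?_ (lintegral_markLaw hc a hR).symm
  congr 1
  have h1 := lintegral_markWeight_mul (φ := φ) c a hgI (b := fun _ _ => 1) fun _ => measurable_const
  simp only [Finset.prod_const_one, mul_one] at h1
  rw [h1, lintegral_markWeight_mul c a hg hb]
  refine lintegral_congr_ae ?_
  filter_upwards [ae_betaLevy (φ := φ)] with s hs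
  rw [mul_assoc, ← Finset.prod_mul_distrib]
  congr 1
  refine Finset.prod_congr rfl fun j _ => ?_
  rw [lintegral_scoreWeight_mul hφ.out _ _ hs.1 (hb j), lintegral_scoreWeight hφ.out _ _ hs.1,
    mul_comm]

/-- Integrating the scores out of the likelihood weight leaves the mass of the score weights, which
is the density defining `fixedJumpWeight`. -/
lemma map_fst_markLaw {c : Fin d → ℕ} (hc : c ≠ 0) (a : Fin d → ℝ≥0) :
    (markLaw φ c a).map Prod.fst = normalize (fixedJumpWeight φ (fun j => a j) c) := by
  refine Measure.ext_of_lintegral _ fun g hg => ?_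
  have hm : Measurable fun s => ∏ j, ∫⁻ t, scoreWeight (c j) (a j) s t ∂(gammaMeasure φ 1) :=
    (measurable_prod_lintegral_scoreWeight c).comp (f := fun s => (a, s)) (by fun_prop)
  have h1 := lintegral_markWeight_mul (φ := φ) c a hg (b := fun _ _ => 1) fun _ => measurable_const
  simp only [Finset.prod_const_one, mul_one] at h1
  have hg1 : Measurable fun y : ℝ × (Fin d → ℝ) => g y.1 := hg.comp measurable_fst
  rw [lintegral_map hg measurable_fst, lintegral_markLaw hc a hg1, h1, normalize,
    lintegral_smul_measure, fixedJumpWeight_univ, fixedJumpWeight_eq,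
    lintegral_withDensity_eq_lintegral_mul _ hm hg, smul_eq_mul]
  simp only [Pi.mul_apply, mul_comm]

/-- Under a product of laws `markLaw`, the scores are independent given the jumps. -/
lemma isCondIndepWithLaws_pi_markLaw {ι : Type} [Fintype ι] {c : ι → Fin d → ℕ}
    (hc : ∀ l, c l ≠ 0) (a : Fin d → ℝ≥0) :
    IsCondIndepWithLaws (Measure.pi fun l => markLaw φ (c l) a)
      (fun (y : ι → ℝ × (Fin d → ℝ)) l => (y l).1) (fun (q : ι × Fin d) y => (y q.1).2 q.2)
      (fun q s => gammaMeasure (φ + c q.1 q.2) (s q.1 * a q.2 + 1)) := by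
  classical
  have hZ : Measurable fun (y : ι → ℝ × (Fin d → ℝ)) l => (y l).1 := by fun_prop
  have hY : ∀ q : ι × Fin d, Measurable fun y : ι → ℝ × (Fin d → ℝ) => (y q.1).2 q.2 := fun q => by
    fun_prop
  refine ⟨hZ, hY, fun s B D hB hD => ?_⟩
  let ρ : Measure (ι → ℝ × (Fin d → ℝ)) := Measure.pi fun l => markLaw φ (c l) a
  have hρ : IsProbabilityMeasure ρ :=
    inferInstanceAs (IsProbabilityMeasure (Measure.pi fun l => markLaw φ (c l) a))
  -- the indicator of the event, and its conditional expectation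
  let b : ι → Fin d → ℝ → ℝ≥0∞ := fun l j t => if (l, j) ∈ s then (B (l, j)).indicator 1 t else 1
  let I : ι → Fin d → ℝ → ℝ≥0∞ := fun l j r =>
    if (l, j) ∈ s then gammaMeasure (φ + c l j) (r * a j + 1) (B (l, j)) else 1
  have hb : ∀ l j, Measurable (b l j) := fun l j => by
    by_cases h : (l, j) ∈ s
    · simp only [b, if_pos h]
      exact measurable_one.indicator (hB _)
    · simp only [b, if_neg h]
      exact measurable_const
  have hI : ∀ l j, Measurable (I l j) := fun l j => by
    by_cases h : (l, j) ∈ s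
    · simp only [I, if_pos h]
      exact (Measure.measurable_coe (hB _)).comp ((measurable_gammaMeasure_rate _).comp
        (by fun_prop))
    · simp only [I, if_neg h]
      exact measurable_const
  have hprod : ∀ {w : ι × Fin d → ℝ≥0∞}, ∏ q ∈ s, w q = ∏ l, ∏ j, if (l, j) ∈ s then w (l, j) else 1 :=
    fun {w} => by
      rw [← Finset.prod_product', Finset.univ_product_univ, Finset.prod_ite_mem, Finset.univ_inter]
  have hkey : ∀ l (A : Set ℝ), MeasurableSet A →
      ∫⁻ y, A.indicator 1 y.1 * ∏ j, b l j (y.2 j) ∂(markLaw φ (c l) a)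
        = ∫⁻ y, A.indicator 1 y.1 * ∏ j, I l j y.1 ∂(markLaw φ (c l) a) := fun l A hA => by
    rw [lintegral_markLaw_scores (hc l) a (measurable_one.indicator hA) (hb l)]
    -- Positive jumps make the rates positive, so the gamma laws are probabilities and unconstrained
    -- scores integrate to `1`.
    have hfst : ∀ᵐ y ∂(markLaw φ (c l) a), 0 < y.1 := by
      refine ae_of_ae_map measurable_fst.aemeasurable ?_
      rw [map_fst_markLaw (hc l) a]
      refine Measure.ae_smul_measure ?_ _
      refine (withDensity_absolutelyContinuous _ _).ae_le ?_
      filter_upwards [ae_restrict_mem measurableSet_Ioo] with r hr using hr.1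
    refine lintegral_congr_ae ?_
    filter_upwards [hfst] with y hy
    congr 1
    refine Finset.prod_congr rfl fun j _ => ?_
    by_cases h : (l, j) ∈ s
    · simp only [b, I, if_pos h]
      exact lintegral_indicator_one (hB _)
    · have hφ' := hφ.out
      have := isProbabilityMeasure_gammaMeasure (a := φ + c l j) (r := y.1 * a j + 1)
        (by positivity) (by positivity)
      simp only [b, I, if_neg h, lintegral_one, measure_univ]
  let S : Set (ι → ℝ × (Fin d → ℝ)) := ⋂ q ∈ s, (fun y => (y q.1).2 q.2) ⁻¹' B q
  have hS : MeasurableSet S := Finset.measurableSet_biInter s fun q _ => hY q (hB q)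
  have hSb : ∀ y, S.indicator 1 y = ∏ l, ∏ j, b l j ((y l).2 j) := fun y => by
    have h1 : S.indicator 1 y = ∏ q ∈ s, (B q).indicator (1 : ℝ → ℝ≥0∞) ((y q.1).2 q.2) := by
      by_cases hy : y ∈ S
      · rw [Set.indicator_of_mem hy, Finset.prod_eq_one fun q hq => ?_]
        · rfl
        · exact Set.indicator_of_mem (by simpa using Set.mem_iInter₂.1 hy q hq) _
      · rw [Set.indicator_of_notMem hy]
        have hy' : ∃ q ∈ s, (y q.1).2 q.2 ∉ B q := by simpa [S] using hy
        obtain ⟨q, hq, hqB⟩ := hy'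
        exact (Finset.prod_eq_zero hq (Set.indicator_of_notMem hqB _)).symm
    rw [h1, hprod]
  have hW' : ∀ y : ι → ℝ × (Fin d → ℝ), ∏ q ∈ s, gammaMeasure (φ + c q.1 q.2)
      ((y q.1).1 * a q.2 + 1) (B q) = ∏ l, ∏ j, I l j (y l).1 := fun y => hprod
  -- For a box of jump values both integrands are products over the independent atoms; the π-system
  -- argument then covers arbitrary sets of jump vectors.
  have hbox : ∀ A : ι → Set ℝ, (∀ l, MeasurableSet (A l)) →
      (ρ.restrict S).map (fun y l => (y l).1) (Set.univ.pi A)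
        = (ρ.withDensity fun y => ∏ l, ∏ j, I l j (y l).1).map (fun y l => (y l).1)
          (Set.univ.pi A) := fun A hA => by
    have hA' := MeasurableSet.univ_pi hA
    have hind : ∀ y : ι → ℝ × (Fin d → ℝ), ((fun (y : ι → ℝ × (Fin d → ℝ)) l => (y l).1) ⁻¹'
        Set.univ.pi A).indicator 1 y = ∏ l, (A l).indicator (1 : ℝ → ℝ≥0∞) (y l).1 := fun y => by
      by_cases hy : ∀ l, (y l).1 ∈ A l
      · rw [Set.indicator_of_mem (by simpa using hy), Finset.prod_eq_one fun l _ => ?_]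
        · rfl
        · exact Set.indicator_of_mem (hy l) _
      · rw [Set.indicator_of_notMem (by simpa using hy)]
        push Not at hy
        obtain ⟨l, hl⟩ := hy
        exact (Finset.prod_eq_zero (Finset.mem_univ l) (Set.indicator_of_notMem hl _)).symm
    rw [Measure.map_apply hZ hA', Measure.map_apply hZ hA', Measure.restrict_apply (hZ hA'),
      withDensity_apply _ (hZ hA'), ← lintegral_indicator (hZ hA'),
      ← lintegral_indicator_one ((hZ hA').inter hS)]
    have hl : ∀ y, ((fun (y : ι → ℝ × (Fin d → ℝ)) l => (y l).1) ⁻¹' Set.univ.pi A ∩ S).indicator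
        (1 : (ι → ℝ × (Fin d → ℝ)) → ℝ≥0∞) y = ∏ l, ((A l).indicator 1 (y l).1 * ∏ j, b l j ((y l).2 j)) := fun y => by
      rw [Finset.prod_mul_distrib, ← hSb, ← hind, Set.inter_indicator_one]
      rfl
    have hr : ∀ y, ((fun (y : ι → ℝ × (Fin d → ℝ)) l => (y l).1) ⁻¹' Set.univ.pi A).indicator
        (fun y => ∏ l, ∏ j, I l j (y l).1) y
        = ∏ l, ((A l).indicator 1 (y l).1 * ∏ j, I l j (y l).1) := fun y => by
      rw [Finset.prod_mul_distrib, ← hind]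
      by_cases hy : y ∈ (fun (y : ι → ℝ × (Fin d → ℝ)) l => (y l).1) ⁻¹' Set.univ.pi A
      · rw [Set.indicator_of_mem hy, Set.indicator_of_mem hy, Pi.one_apply, one_mul]
      · rw [Set.indicator_of_notMem hy, Set.indicator_of_notMem hy, zero_mul]
    simp_rw [hl, hr]
    have hAm : ∀ l, Measurable fun y : ℝ × (Fin d → ℝ) => (A l).indicator (1 : ℝ → ℝ≥0∞) y.1 :=
      fun l => (measurable_one.indicator (hA l)).comp measurable_fst
    have hbm : ∀ l, Measurable fun y : ℝ × (Fin d → ℝ) =>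
        (A l).indicator 1 y.1 * ∏ j, b l j (y.2 j) := fun l =>
      (hAm l).mul (Finset.measurable_prod _ fun j _ => (hb l j).comp (by fun_prop))
    have hIm : ∀ l, Measurable fun y : ℝ × (Fin d → ℝ) =>
        (A l).indicator 1 y.1 * ∏ j, I l j y.1 := fun l =>
      (hAm l).mul (Finset.measurable_prod _ fun j _ => (hI l j).comp (by fun_prop))
    rw [lintegral_pi_prod hbm, lintegral_pi_prod hIm]
    exact Finset.prod_congr rfl fun l _ => hkey l (A l) (hA l)
  have hext : (ρ.restrict S).map (fun y l => (y l).1)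
      = (ρ.withDensity fun y => ∏ l, ∏ j, I l j (y l).1).map (fun y l => (y l).1) := by
    have : IsFiniteMeasure ((ρ.restrict S).map fun y l => (y l).1) :=
      Measure.isFiniteMeasure_map _ _
    refine ext_of_generate_finite _ generateFrom_pi.symm isPiSystem_pi ?_ ?_
    · rintro _ ⟨A, hA, rfl⟩
      exact hbox A (by simpa using hA)
    · simpa using hbox (fun _ => Set.univ) fun _ => MeasurableSet.univ
  have h := congrArg (fun M => M D) hext
  rw [Measure.map_apply hZ hD, Measure.map_apply hZ hD, Measure.restrict_apply (hZ hD),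
    withDensity_apply _ (hZ hD)] at h
  simp_rw [hW']
  exact h

end MarkLaws


/-! ### Identification of the posterior kernel -/

section PosteriorLaw

attribute [local irreducible] expNeg scoreWeight

variable {X : Type u} [MeasurableSpace X] {α : Measure X} [IsFiniteMeasure α] {φ : ℝ}
  [hφ : Fact (0 < φ)] {d k N : ℕ}

/-- A tilted representation with independent fixed atoms has the posterior law. -/
lemma IsCompoundRep.isPosteriorLaw_fixedLaw {Ω : Type u} [MeasurableSpace Ω] {P : Measure Ω}
    [IsProbabilityMeasure P] {J : ℕ → Ω → ℝ} {x : ℕ → Ω → X} {m : ℕ × Fin d → Ω → ℝ}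
    (h : IsCompoundRep P (betaLevy φ) α (fun _ _ => gammaMeasure φ 1) J x m) (xs : Fin k → X)
    {c : Fin k → Fin d → ℕ} (hc : ∀ l, c l ≠ 0) (u : Fin d → ℝ≥0) :
    IsPosteriorLaw φ α (fun j => u j) xs c (fixedLaw P φ J x m xs c u) := by
  have hQ := h.isProbabilityMeasure_tilt u
  let ρ : Measure (Fin k → ℝ × (Fin d → ℝ)) := Measure.pi fun l => markLaw φ (c l) u
  have hρ : IsProbabilityMeasure ρ :=
    inferInstanceAs (IsProbabilityMeasure (Measure.pi fun l => markLaw φ (c l) u))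
  let R : Measure (Ω × (Fin k → ℝ × (Fin d → ℝ))) := (CoRM.tilt P J x m u).prod ρ
  have hR : IsProbabilityMeasure R := inferInstanceAs (IsProbabilityMeasure (Measure.prod _ _))
  have hfst : MeasurePreserving Prod.fst R (CoRM.tilt P J x m u) := measurePreserving_fst
  have hsnd : MeasurePreserving Prod.snd R ρ := measurePreserving_snd
  have hgm : ∀ j : Fin d, Measurable fun s : ℝ => gammaMeasure φ (u j * s + 1) := fun j =>
    (measurable_gammaMeasure_rate φ).comp (by fun_prop)
  have hdata : Measurable fun ω => (points J x ω, fun q => m q ω) :=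
    h.scores.measurable_cond.prodMk (measurable_pi_lambda _ h.scores.measurable)
  -- The product of the tilted space with the laws of the marks has the two independent parts built
  -- in, and its image under `addFixed` is `fixedLaw` by definition.
  refine ⟨Ω × (Fin k → ℝ × (Fin d → ℝ)), inferInstance, R, hR, fun i z => J i z.1,
    fun i z => x i z.1, fun q z => m q z.1, fun l z => (z.2 l).1, fun q z => (z.2 q.1).2 q.2,
    ?_, ?_, fun l => ?_, ?_, ?_, ?_⟩
  · exact (isCompoundRep_comp_iff hfst h.measurable_jump h.measurable_loc h.scores.measurable
      hgm).2 (h.tilt u)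
  · exact (iIndepFun_comp_iff hsnd (Y := fun l (y : Fin k → ℝ × (Fin d → ℝ)) => (y l).1)
      fun l => by fun_prop).2 (iIndepFun_pi fun l => measurable_fst.aemeasurable)
  · refine ⟨by fun_prop, ?_⟩
    rw [← map_fst_markLaw (hc l) u, ← (measurePreserving_eval (fun l => markLaw φ (c l) u) l).map_eq]
    rw [← show R.map Prod.snd = Measure.pi fun l => markLaw φ (c l) u from hsnd.map_eq,
      Measure.map_map (measurable_pi_apply l) measurable_snd, Measure.map_map measurable_fst
      ((measurable_pi_apply l).comp measurable_snd)]
    rfl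
  · refine (isCondIndepWithLaws_comp_iff hsnd (Z := fun (y : Fin k → ℝ × (Fin d → ℝ)) l => (y l).1)
      (Y := fun (q : Fin k × Fin d) y => (y q.1).2 q.2) (by fun_prop) (fun q => by fun_prop)
      fun q => ?_).2 (isCondIndepWithLaws_pi_markLaw hc u)
    exact (measurable_gammaMeasure_rate _).comp (by fun_prop)
  · exact indepFun_prod (X := fun ω => (points J x ω, fun q => m q ω))
      (Y := fun y : Fin k → ℝ × (Fin d → ℝ) => ((fun l => (y l).1), fun q : Fin k × Fin d =>
        (y q.1).2 q.2)) hdata (by fun_prop)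
  · exact ⟨(h.measurable_fixed xs).aemeasurable, rfl⟩

/-- The Laplace functional sees the representation only through `φ` and `α`, and the indexing only
through a product over distinct values. Thus both the probability space and the enumeration of these
values may be changed. -/
lemma IsCompoundRep.fixedLaw_congr {Ω : Type v} [MeasurableSpace Ω] {P : Measure Ω}
    [IsProbabilityMeasure P] {J : ℕ → Ω → ℝ} {x : ℕ → Ω → X} {m : ℕ × Fin d → Ω → ℝ}
    {Ω' : Type w} [MeasurableSpace Ω'] {P' : Measure Ω'} [IsProbabilityMeasure P']
    {J' : ℕ → Ω' → ℝ} {x' : ℕ → Ω' → X} {m' : ℕ × Fin d → Ω' → ℝ}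
    (h : IsCompoundRep P (betaLevy φ) α (fun _ _ => gammaMeasure φ 1) J x m)
    (h' : IsCompoundRep P' (betaLevy φ) α (fun _ _ => gammaMeasure φ 1) J' x' m')
    (lab : Fin N → Fin d) (o : Fin N → X) {xs : Fin k → X} (hxs : Function.Injective xs)
    (hr : Set.range xs = Set.range o) (u : Fin d → ℝ≥0) :
    fixedLaw P φ J x m xs (fun l => obsCount lab o (xs l)) u
      = fixedLaw P' φ J' x' m' o (firstCount lab o) u := by
  classical
  have h1 := h.isProbabilityMeasure_fixedLaw xs (fun l => obsCount lab o (xs l)) u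
  have h2 := h'.isProbabilityMeasure_fixedLaw o (firstCount lab o) u
  refine ext_of_lintegral_pairing fun f hf => ?_
  rw [h.lintegral_expNeg_fixedLaw xs _ u hf, h'.lintegral_expNeg_fixedLaw o _ u hf,
    fixedLap_firstCount, fixedLap]
  congr 1
  have himg : Finset.univ.image o = Finset.univ.image xs := by
    ext v
    have := Set.ext_iff.1 hr v
    simpa using this.symm
  rw [himg, Finset.prod_image fun a _ b _ hab => hxs hab]

lemma IsCompoundRep.isPosteriorLaw_posterior [MeasurableEq X] {Ω : Type v} [MeasurableSpace Ω]
    {P : Measure Ω} [IsProbabilityMeasure P] {J : ℕ → Ω → ℝ} {x : ℕ → Ω → X}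
    {m : ℕ × Fin d → Ω → ℝ}
    (h : IsCompoundRep P (betaLevy φ) α (fun _ _ => gammaMeasure φ 1) J x m)
    (lab : Fin N → Fin d) (o : Fin N → X) {xs : Fin k → X} (hxs : Function.Injective xs)
    (hr : Set.range xs = Set.range o) (u : Fin d → ℝ≥0) :
    IsPosteriorLaw φ α (fun j => u j) xs (fun l => obsCount lab o (xs l))
      (h.posterior lab (o, u)) := by
  -- the canonical space of atoms and scores, which lives in the universe of `X`
  have hF : Measurable fun ω => (points J x ω, fun q => m q ω) :=
    h.scores.measurable_cond.prodMk (measurable_pi_lambda _ h.scores.measurable)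
  let P₀ : Measure ((ℕ → ℝ × X) × (ℕ × Fin d → ℝ)) := P.map fun ω => (points J x ω, fun q => m q ω)
  have hP₀ : IsProbabilityMeasure P₀ := Measure.isProbabilityMeasure_map hF.aemeasurable
  have hp : MeasurePreserving (fun ω => (points J x ω, fun q => m q ω)) P P₀ := ⟨hF, rfl⟩
  have h₀ : IsCompoundRep P₀ (betaLevy φ) α (fun _ _ => gammaMeasure φ 1)
      (fun i w => (w.1 i).1) (fun i w => (w.1 i).2) fun q w => w.2 q :=
    (isCompoundRep_comp_iff hp (fun i => by fun_prop) (fun i => by fun_prop)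
      (fun q => by fun_prop) fun j => measurable_const).1 h
  have hc : ∀ l, obsCount lab o (xs l) ≠ 0 := fun l => by
    obtain ⟨i, hi⟩ : xs l ∈ Set.range o := hr ▸ Set.mem_range_self l
    rw [← hi]
    exact obsCount_ne_zero lab o i
  have key := h₀.isPosteriorLaw_fixedLaw xs hc u
  rwa [h₀.fixedLaw_congr h lab o hxs hr u] at key

end PosteriorLaw

end

end CoRM

/-! ### Assembly of the theorem -/

theorem corollary2 {X : Type u} [TopologicalSpace X] [PolishSpace X] [MeasurableSpace X]
    [BorelSpace X] {Ω : Type v} [MeasurableSpace Ω] (P : Measure Ω) [IsProbabilityMeasure P]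
    (α : Measure X) [IsFiniteMeasure α] [NullSingletonClass α] (hα : α ≠ 0)
    (φ : ℝ) (hφ : 0 < φ) (d : ℕ) (hd : 1 ≤ d) (n : Fin d → ℕ) (hn : ∀ j, 1 ≤ n j)
    -- the vector `μ` of compound random measures: atoms `(J i, x i)` and i.i.d. gamma scores `m`
    (J : ℕ → Ω → ℝ) (x : ℕ → Ω → X) (m : ℕ × Fin d → Ω → ℝ)
    (hcorm : CoRM.IsCompoundRep P (CoRM.betaLevy φ) α (fun _ _ => gammaMeasure φ 1) J x m)
    (μ : Fin d → Ω → Measure X) (hμ : ∀ j ω, μ j ω = CoRM.compoundMeasure J x m j ω)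
    -- the samples: `obs ⟨j, i⟩` is the `i`-th observation of group `j`, and given `μ` the
    -- observations are independent, those of group `j` with law `μ j / μ j (X)`
    (obs : (Σ j : Fin d, Fin (n j)) → Ω → X)
    (hobs : CoRM.IsCondIndepWithLaws P (fun ω j => μ j ω) obs
      (fun q M => CoRM.normalize (M q.1)))
    -- the latent variables `U j = G j / μ j (X)`
    (G : Fin d → Ω → ℝ) (hG : ∀ j, Measurable (G j)) (hG_indep : iIndepFun G P)
    (hG_law : ∀ j, HasLaw (G j) (gammaMeasure (n j) 1) P)
    (hG_data : IndepFun (fun ω j => G j ω) (fun ω => ((fun j => μ j ω), fun q => obs q ω)) P)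
    (U : Fin d → Ω → ℝ) (hU : ∀ j ω, U j ω = G j ω / (μ j ω Set.univ).toReal) :
    (∀ j, CoRM.IsGammaProcess P (μ j) α) ∧
    ∃ κ : Kernel (((Σ j : Fin d, Fin (n j)) → X) × (Fin d → ℝ)) (Fin d → Measure X),
      IsMarkovKernel κ ∧
      HasCondDistrib (fun ω j => μ j ω) (fun ω => ((fun q => obs q ω), fun j => U j ω)) κ P ∧
      ∀ᵐ ω ∂P, ∀ (k : ℕ) (xs : Fin k → X), Function.Injective xs →
        Set.range xs = Set.range (fun q => obs q ω) →
        CoRM.IsPosteriorLaw φ α (fun j => U j ω) xs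
          (fun l j => Nat.card {i : Fin (n j) // obs ⟨j, i⟩ ω = xs l})
          (κ ((fun q => obs q ω), fun j => U j ω)) := by
  classical
  have : Fact (0 < φ) := ⟨hφ⟩
  obtain rfl : μ = fun j ω => CoRM.compoundMeasure J x m j ω := funext fun j => funext (hμ j)
  refine ⟨fun j => hcorm.isGammaProcess j, ?_⟩
  -- The observations of all groups are lined up in one sequence, `lab` recording the group, as the
  -- induction over single observations requires.
  let e := (Fintype.equivFin (Σ j : Fin d, Fin (n j))).symm
  let lab : Fin (Fintype.card (Σ j : Fin d, Fin (n j))) → Fin d := fun i => (e i).1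
  have hcount : ∀ (j : Fin d) (p : (Σ j : Fin d, Fin (n j)) → Prop) [DecidablePred p],
      ∑ i, (if lab i = j ∧ p (e i) then 1 else 0) = Nat.card {i : Fin (n j) // p ⟨j, i⟩} := by
    intro j p _
    rw [Equiv.sum_comp e fun q => if q.1 = j ∧ p q then 1 else 0, Fintype.sum_sigma,
      Finset.sum_eq_single j (fun j' _ hj' => by simp [hj']) (by simp)]
    simp [Fintype.card_subtype]
  have hlab : ∀ j, ∑ i, (if lab i = j then 1 else 0) = n j := fun j => by
    have h1 := hcount j fun _ => True
    simpa using h1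
  have hobs' := hobs.comp_injective e.injective
  have hGind : IndepFun (fun ω j => G j ω) (fun ω =>
      ((fun j => CoRM.compoundMeasure J x m j ω), fun i => obs (e i) ω)) P :=
    IndepFun.comp (φ := id) (ψ := fun y : (Fin d → Measure X) × ((Σ j : Fin d, Fin (n j)) → X) =>
      (y.1, fun i => y.2 (e i))) hG_data measurable_id (by fun_prop)
  have key := fun {Φ} hΦ => hcorm.lintegral_posterior hα lab hlab hn (obs := fun i => obs (e i))
    hobs' hG hG_indep (fun j => (hG_law j).map_eq) hGind (Φ := Φ) hΦ
  -- The posterior was built for nonnegative latent values; a gamma variable divided by a mass is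
  -- almost surely nonnegative, so truncation at zero changes nothing.
  have hUnn : ∀ᵐ ω ∂P, ∀ j, ((U j ω).toNNReal : ℝ) = U j ω := by
    refine ae_all_iff.2 fun j => ?_
    have h1 : ∀ᵐ ω ∂P, 0 ≤ G j ω := by
      refine ae_of_ae_map (hG j).aemeasurable ?_
      rw [(hG_law j).map_eq]
      exact CoRM.ae_nonneg_gammaMeasure _ _
    filter_upwards [h1] with ω hω
    rw [hU, Real.coe_toNNReal _ (div_nonneg hω ENNReal.toReal_nonneg)]
  have hpull : Measurable fun y : ((Σ j : Fin d, Fin (n j)) → X) × (Fin d → ℝ) =>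
      ((fun i => y.1 (e i)), fun j => (y.2 j).toNNReal) := by fun_prop
  have hvec := hcorm.measurable_vec
  have hobsm : Measurable fun ω q => obs q ω := measurable_pi_lambda _ hobs.measurable
  have hUm : Measurable fun ω j => U j ω := by
    refine measurable_pi_lambda _ fun j => ?_
    simp_rw [hU]
    refine (hG j).div (Measurable.ennreal_toReal ?_)
    exact (Measure.measurable_coe MeasurableSet.univ).comp ((measurable_pi_apply j).comp hvec)
  refine ⟨(hcorm.posterior lab).comap _ hpull, inferInstance, ?_, ?_⟩
  · refine ⟨((hobsm.prodMk hUm).prodMk hvec).aemeasurable, ?_⟩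
    refine Measure.ext_of_lintegral _ fun F hF => ?_
    have hF' : Measurable fun y => ∫⁻ M, F (y, M) ∂((hcorm.posterior lab).comap _ hpull y) :=
      Measurable.lintegral_kernel_prod_right' hF
    rw [Measure.lintegral_compProd hF, lintegral_map hF' (hobsm.prodMk hUm),
      lintegral_map hF ((hobsm.prodMk hUm).prodMk hvec)]
    -- The test function on the original data is pulled back through the enumeration `e` and the
    -- inclusion of nonnegative reals.
    have h1 := key (Φ := fun y => F (((fun q => y.1.1 (e.symm q)), fun j => (y.1.2 j : ℝ)), y.2))
      (hF.comp (by fun_prop))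
    simp only [Equiv.apply_symm_apply, ← hU] at h1
    refine Eq.trans (lintegral_congr_ae ?_) (h1.trans (lintegral_congr_ae ?_))
    · filter_upwards [hUnn] with ω hω
      simp_rw [hω]
    · filter_upwards [hUnn] with ω hω
      simp_rw [hω, Kernel.comap_apply]
  · filter_upwards [hUnn] with ω hω k xs hxs hr
    have hr' : Set.range xs = Set.range fun i => obs (e i) ω := by
      rw [hr]
      exact (e.surjective.range_comp fun q => obs q ω).symm
    have h1 := hcorm.isPosteriorLaw_posterior lab (fun i => obs (e i) ω) hxs hr'
      fun j => (U j ω).toNNReal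
    simp_rw [hω] at h1
    have h2 : (fun l => CoRM.obsCount lab (fun i => obs (e i) ω) (xs l))
        = fun l j => Nat.card {i : Fin (n j) // obs ⟨j, i⟩ ω = xs l} := by
      funext l j
      rw [← hcount j fun q => obs q ω = xs l]
      simp only [CoRM.obsCount]
    rw [h2] at h1
    exact h1
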